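/- Let $q\in C^2(0,2\pi)\cap L_2(0,2\pi)$ be real-valued, and put $\widetilde q(x)=q(x)$ for $0<x<2\pi$, $\widetilde q(x)=q(x+2\pi)$ for $-2\pi<x<0$ and $\widetilde q(x)=0$ elsewhere. **The two problems.** For a control $F=(f_1,f_2)$ with $f_1,f_2\in C_0^\infty(0,\infty)$ (extended by zero to $t\le 0$), let $u^F$ be the solution of the periodic problem $$u_{tt}-u_{xx}+qu=0\quad(0<x<2\pi,\ 0<t<2\pi),\qquad \Gamma_0u=\begin{pmatrix}f_1\\ f_2'\end{pmatrix},\qquad u(\cdot,0)=u_t(\cdot,0)=0,$$ and let $v^F$ be the solution of the whole-line problem $$v_{tt}-v_{xx}+\widetilde qv=0\quad(x\neq0,\ 0<t<2\pi),\qquad \widetilde\Gamma_0v=\begin{pmatrix}f_1\\ f_2'\end{pmatrix},\qquad v(\cdot,0)=v_t(\cdot,0)=0.$$ Here $$\Gamma_0w=\begin{pmatrix}w(0^+)-w(2\pi^-)\\ w'(0^+)-w'(2\pi^-)\end{pmatrix},\qquad \Gamma_1w=\frac12\begin{pmatrix}w'(0^+)+w'(2\pi^-)\\ -w(0^+)-w(2\pi^-)\end{pmatrix},$$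 and $\widetilde\Gamma_0,\widetilde\Gamma_1$ are given by the same formulas with $w(2\pi^-),w'(2\pi^-)$ replaced by $w(0^-),w'(0^-)$. Solutions are $C^2$ in the open domain ($x\in(0,2\pi)$, resp. $x\ne0$; $0<t<2\pi$), are $C^1$ up to the lateral boundary and up to $t=0$, and are, for each fixed $t$, of class $H^2(0,2\pi)$, resp. $H^2(-\infty,0)$ and $H^2(0,\infty)$. For $F\in L_2(0,2\pi;\mathbb R^2)$ the generalized solutions are the limits, in $L_2$ in $x$ uniformly in $t\in(0,2\pi)$, of solutions for smooth controls of the above kind that converge to $F$ in $L_2(0,2\pi;\mathbb R^2)$. The response operators, with domain $C_0^\infty(0,2\pi;\mathbb R^2)$, are $$(R^{2\pi}F)(t)=(\Gamma_1u^F)(t),\qquad(\widetilde R^{2\pi}F)(t)=(\widetilde\Gamma_1v^F)(t),\qquad 0<t<2\pi.$$ **Claim.** For smooth controls both problems have exactly one solution, and for controls in $L_2(0,2\pi;\mathbb R^2)$ both have a generalized solution. Moreover: 1. There are kernels $w_1^0,w_2^0$ on $0\le x\le t\le2\pi$ and $w_1^{2\pi},w_2^{2\pi}$ on $0\le2\pi-x\le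 t\le2\pi$, continuous there and $C^2$ in the interior, with first $x$-derivatives continuous up to $x=0$, resp. $x=2\pi$, for $0<t<2\pi$ (away from the characteristics $t=x$, resp. $t=2\pi-x$), which satisfy $w_{tt}-w_{xx}+qw=0$ in the interior and, for $0<x<2\pi$, $0<s<2\pi$, $i=1,2$, $$\tfrac{d}{dx}w_1^0(x,x)=-\tfrac{q(x)}4,\qquad \tfrac{d}{dx}w_2^0(x,x)=\tfrac{q(x)}4,\qquad \tfrac{d}{dx}w_i^{2\pi}(x,2\pi-x)=-\tfrac{q(x)}4,$$ $$w_i^0(0,0)=0,\qquad w_i^0(0,s)=w_i^{2\pi}(2\pi,s),\qquad (w_i^0)_x(0,s)=(w_i^{2\pi})_x(2\pi,s),$$ such that, with $$u_1^{F_+}(x,t)=\tfrac12f_1(t-x)-\tfrac12f_2(t-x)+\int_x^t\bigl(w_1^0(x,s)f_1(t-s)+w_2^0(x,s)f_2(t-s)\bigr)ds,$$ $$u_1^{F_-}(x,t)=-\tfrac12f_1(t+x-2\pi)-\tfrac12f_2(t+x-2\pi)+\int_{2\pi-x}^t\bigl(w_1^{2\pi}(x,s)f_1(t-s)+w_2^{2\pi}(x,s)f_2(t-s)\bigr)ds,$$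 for every smooth control $F$ and $0<t<2\pi$ $$u^F(x,t)=u_1^{F_+}(x,t)+u_1^{F_-}(x,t)\quad(0<x<2\pi),$$ $$v^F(x,t)=\begin{cases}u_1^{F_+}(x,t),&0<x<2\pi,\\ u_1^{F_-}(x+2\pi,t),&-2\pi<x<0;\end{cases}$$ in particular $u^F(x,t)=v^F(x,t)+v^F(x-2\pi,t)$ for $0<x<2\pi$. For $F\in L_2(0,2\pi;\mathbb R^2)$, extended by zero to $t\le0$, the same equalities hold for all generalized solutions, for every $t\in(0,2\pi)$ and almost every $x$. 2. $\Gamma_1u^F=\widetilde\Gamma_1v^F$ on $(0,2\pi)$ for every smooth control $F$, and $R^{2\pi}=\widetilde R^{2\pi}$. 3. The inverse problem of finding $q$ on $(0,2\pi)$ from $R^{2\pi}$ is thereby reduced to that of finding $\widetilde q$ on $(-\pi,\pi)$ from $\widetilde R^{2\pi}$: two such potentials agree on $(0,2\pi)$ if and only if the corresponding $\widetilde q$'s agree on $(-\pi,\pi)\setminus\{0\}$; and a map $S$ from operators to functions satisfies $S(\widetilde R^{2\pi})=\widetilde q$ on $(-\pi,\pi)\setminus\{0\}$ for all such $q$ if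 and only if, for all such $q$, the function equal to $S(R^{2\pi})(x)$ for $0<x<\pi$ and to $S(R^{2\pi})(x-2\pi)$ for $\pi<x<2\pi$ coincides with $q$. -/

import Mathlib

open Real Set Filter Topology MeasureTheory
open scoped ContDiff

noncomputable section

namespace PeriodicWave

/-- Potentials on `(0, 2π)`: twice continuously differentiable and square integrable, so that
`f ↦ -f'' + q f` maps `H²(0, 2π)` into `L²(0, 2π)`. Values outside `(0, 2π)` are never used. -/
def IsPotential (q : ℝ → ℝ) : Prop :=
  ContDiffOn ℝ 2 q (Ioo 0 (2 * π)) ∧ MemLp q 2 (volume.restrict (Ioo 0 (2 * π)))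

/-- The potential on the line: `q` on `(0, 2π)`, `q (x + 2π)` on `(-2π, 0)`, zero elsewhere. -/
def linePotential (q : ℝ → ℝ) (x : ℝ) : ℝ :=
  if x ∈ Ioo 0 (2 * π) then q x
  else if x ∈ Ioo (-(2 * π)) 0 then q (x + 2 * π)
  else 0

/-- The differential expression `-f'' + p f`. -/
def schrodinger (p f : ℝ → ℝ) (x : ℝ) : ℝ := -deriv (deriv f) x + p x * f x

/-- `lim_{ε → 0+} g (a + ε)`. -/
def traceRight (a : ℝ) (g : ℝ → ℝ) : ℝ := limUnder (𝓝[>] a) g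

/-- `lim_{ε → 0+} g (a - ε)`. -/
def traceLeft (a : ℝ) (g : ℝ → ℝ) : ℝ := limUnder (𝓝[<] a) g

/-- Boundary operator `Γ₀` of the interval `(0, 2π)`. -/
def Gamma0 (w : ℝ → ℝ) : ℝ × ℝ :=
  (traceRight 0 w - traceLeft (2 * π) w,
    traceRight 0 (deriv w) - traceLeft (2 * π) (deriv w))

/-- Boundary operator `Γ₁` of the interval `(0, 2π)`. -/
def Gamma1 (w : ℝ → ℝ) : ℝ × ℝ :=
  ((traceRight 0 (deriv w) + traceLeft (2 * π) (deriv w)) / 2,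
    (-traceRight 0 w - traceLeft (2 * π) w) / 2)

/-- Boundary operator `Γ₀` of the line punctured at the origin. -/
def lineGamma0 (w : ℝ → ℝ) : ℝ × ℝ :=
  (traceRight 0 w - traceLeft 0 w, traceRight 0 (deriv w) - traceLeft 0 (deriv w))

/-- Boundary operator `Γ₁` of the line punctured at the origin. -/
def lineGamma1 (w : ℝ → ℝ) : ℝ × ℝ :=
  ((traceRight 0 (deriv w) + traceLeft 0 (deriv w)) / 2,
    (-traceRight 0 w - traceLeft 0 w) / 2)

/-- The twice continuously differentiable members of `H²(s)`, for `s` an open interval. -/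
def MemC2H2 (f : ℝ → ℝ) (s : Set ℝ) : Prop :=
  ContDiffOn ℝ 2 f s ∧ MemLp f 2 (volume.restrict s) ∧
    MemLp (deriv f) 2 (volume.restrict s) ∧ MemLp (deriv (deriv f)) 2 (volume.restrict s)

/-- The restriction of `g` to `D` has a continuous extension to `E`. -/
def ExtendsContinuously (g : ℝ × ℝ → ℝ) (D E : Set (ℝ × ℝ)) : Prop :=
  ∃ G : ℝ × ℝ → ℝ, ContinuousOn G E ∧ EqOn G g D

/-- `u`, `u_x` and `u_t` are continuous on `s × (0, T)` up to the boundary of `s` and up to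
`t = 0`. -/
def C1UpToBoundary (u : ℝ → ℝ → ℝ) (s : Set ℝ) (T : ℝ) : Prop :=
  ExtendsContinuously (fun p => u p.1 p.2) (s ×ˢ Ioo 0 T) (closure s ×ˢ Ico 0 T) ∧
  ExtendsContinuously (fun p => deriv (fun x => u x p.2) p.1)
    (s ×ˢ Ioo 0 T) (closure s ×ˢ Ico 0 T) ∧
  ExtendsContinuously (fun p => deriv (u p.1) p.2) (s ×ˢ Ioo 0 T) (closure s ×ˢ Ico 0 T)

/-- `u` (written `u x t`) solves, for `0 < x < 2π` and `0 < t < T`,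
`u_tt - u_xx + q u = 0`, `Γ₀ u = (f₁, f₂')`, `u(·, 0) = u_t(·, 0) = 0`, where `F = (f₁, f₂)`. -/
structure IsPeriodicSolution (q : ℝ → ℝ) (T : ℝ) (F : ℝ → ℝ × ℝ) (u : ℝ → ℝ → ℝ) : Prop where
  contDiffOn : ContDiffOn ℝ 2 (fun p : ℝ × ℝ => u p.1 p.2) (Ioo 0 (2 * π) ×ˢ Ioo 0 T)
  upToBoundary : C1UpToBoundary u (Ioo 0 (2 * π)) T
  mem_dom : ∀ t ∈ Ioo 0 T, MemC2H2 (fun x => u x t) (Ioo 0 (2 * π))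
  wave : ∀ x ∈ Ioo 0 (2 * π), ∀ t ∈ Ioo 0 T,
    deriv (deriv (u x)) t + schrodinger q (fun y => u y t) x = 0
  boundary : ∀ t ∈ Ioo 0 T,
    Gamma0 (fun x => u x t) = ((F t).1, deriv (fun s => (F s).2) t)
  initial : ∀ x ∈ Ioo 0 (2 * π),
    Tendsto (u x) (𝓝[>] 0) (𝓝 0) ∧ Tendsto (deriv (u x)) (𝓝[>] 0) (𝓝 0)

/-- `v` (written `v x t`) solves, for `x ≠ 0` and `0 < t < T`,
`v_tt - v_xx + p v = 0`, `Γ₀ v = (f₁, f₂')` at the origin, `v(·, 0) = v_t(·, 0) = 0`,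
where `F = (f₁, f₂)`. -/
structure IsLineSolution (p : ℝ → ℝ) (T : ℝ) (F : ℝ → ℝ × ℝ) (v : ℝ → ℝ → ℝ) : Prop where
  contDiffOn : ContDiffOn ℝ 2 (fun z : ℝ × ℝ => v z.1 z.2) ({0}ᶜ ×ˢ Ioo 0 T)
  upToBoundary_left : C1UpToBoundary v (Iio 0) T
  upToBoundary_right : C1UpToBoundary v (Ioi 0) T
  mem_dom : ∀ t ∈ Ioo 0 T,
    MemC2H2 (fun x => v x t) (Iio 0) ∧ MemC2H2 (fun x => v x t) (Ioi 0)
  wave : ∀ x ≠ 0, ∀ t ∈ Ioo 0 T,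
    deriv (deriv (v x)) t + schrodinger p (fun y => v y t) x = 0
  boundary : ∀ t ∈ Ioo 0 T,
    lineGamma0 (fun x => v x t) = ((F t).1, deriv (fun s => (F s).2) t)
  initial : ∀ x ≠ 0,
    Tendsto (v x) (𝓝[>] 0) (𝓝 0) ∧ Tendsto (deriv (v x)) (𝓝[>] 0) (𝓝 0)

/-- Smooth controls: `F = (f₁, f₂) ∈ C₀^∞(ℝ₊; ℝ²)`, extended by zero to `t ≤ 0`. -/
def IsSmoothControl (F : ℝ → ℝ × ℝ) : Prop :=
  ContDiff ℝ ∞ F ∧ HasCompactSupport F ∧ tsupport F ⊆ Ioi 0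

/-- Square integrable controls `F ∈ L²(0, T; ℝ²)`, extended by zero to `t ≤ 0`. -/
def IsL2Control (T : ℝ) (F : ℝ → ℝ × ℝ) : Prop :=
  MemLp F 2 (volume.restrict (Ioo 0 T)) ∧ ∀ t ≤ 0, F t = 0

/-- The domain `C₀^∞(0, T; ℝ²)` of the response operators. -/
def ResponseDomain (T : ℝ) : Type :=
  {F : ℝ → ℝ × ℝ // ContDiff ℝ ∞ F ∧ HasCompactSupport F ∧ tsupport F ⊆ Ioo 0 T}

/-- The solution `u^F` of the periodic problem. -/
def periodicSolution (q : ℝ → ℝ) (T : ℝ) (F : ℝ → ℝ × ℝ) : ℝ → ℝ → ℝ :=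
  Classical.epsilon (IsPeriodicSolution q T F)

/-- The solution `v^F` of the problem on the line. -/
def lineSolution (p : ℝ → ℝ) (T : ℝ) (F : ℝ → ℝ × ℝ) : ℝ → ℝ → ℝ :=
  Classical.epsilon (IsLineSolution p T F)

/-- Response operator `(R^T F)(t) = (Γ₁ u^F)(t)`, `0 < t < T`, of the periodic problem. -/
def periodicResponse (q : ℝ → ℝ) (T : ℝ) (F : ResponseDomain T) (t : Ioo 0 T) : ℝ × ℝ :=
  Gamma1 (fun x => periodicSolution q T F.1 x t)

/-- Response operator `(R^T F)(t) = (Γ₁ v^F)(t)`, `0 < t < T`, of the problem on the line. -/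
def lineResponse (p : ℝ → ℝ) (T : ℝ) (F : ResponseDomain T) (t : Ioo 0 T) : ℝ × ℝ :=
  lineGamma1 (fun x => lineSolution p T F.1 x t)

/-- Generalized solution of the periodic problem for a square integrable control: the limit,
in `L²(0, 2π)` uniformly in `t ∈ (0, T)`, of solutions whose smooth controls converge to `F` in
`L²(0, T; ℝ²)`. -/
def IsGeneralizedPeriodicSolution (q : ℝ → ℝ) (T : ℝ) (F : ℝ → ℝ × ℝ) (u : ℝ → ℝ → ℝ) : Prop :=
  (∀ t ∈ Ioo 0 T, MemLp (fun x => u x t) 2 (volume.restrict (Ioo 0 (2 * π)))) ∧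
  ∃ (G : ℕ → ℝ → ℝ × ℝ) (U : ℕ → ℝ → ℝ → ℝ),
    (∀ n, IsSmoothControl (G n)) ∧ (∀ n, IsPeriodicSolution q T (G n) (U n)) ∧
    Tendsto (fun n => eLpNorm (fun t => G n t - F t) 2 (volume.restrict (Ioo 0 T)))
      atTop (𝓝 0) ∧
    Tendsto (fun n => ⨆ t ∈ Ioo 0 T,
      eLpNorm (fun x => U n x t - u x t) 2 (volume.restrict (Ioo 0 (2 * π)))) atTop (𝓝 0)

/-- Generalized solution of the problem on the line for a square integrable control. -/
def IsGeneralizedLineSolution (p : ℝ → ℝ) (T : ℝ) (F : ℝ → ℝ × ℝ) (v : ℝ → ℝ → ℝ) : Prop :=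
  (∀ t ∈ Ioo 0 T, MemLp (fun x => v x t) 2 volume) ∧
  ∃ (G : ℕ → ℝ → ℝ × ℝ) (V : ℕ → ℝ → ℝ → ℝ),
    (∀ n, IsSmoothControl (G n)) ∧ (∀ n, IsLineSolution p T (G n) (V n)) ∧
    Tendsto (fun n => eLpNorm (fun t => G n t - F t) 2 (volume.restrict (Ioo 0 T)))
      atTop (𝓝 0) ∧
    Tendsto (fun n => ⨆ t ∈ Ioo 0 T,
      eLpNorm (fun x => V n x t - v x t) 2 volume) atTop (𝓝 0)

/-- The Goursat problem, for times below `2π`, for a pair of kernels: `a = w^0` on `0 < x < t` and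
`b = w^{2π}` on `0 < 2π - x < t`. Both satisfy `w_tt - w_xx + q w = 0`, on the characteristics
`(d/dx) a(x, x) = σ q(x) / 4` and `(d/dx) b(x, 2π - x) = -q(x) / 4`, with `a(0, 0) = 0`, and
`a(0, s) = b(2π, s)`, `a_x(0, s) = b_x(2π, s)`. -/
structure IsGoursatPair (q : ℝ → ℝ) (σ : ℝ) (a b : ℝ → ℝ → ℝ) : Prop where
  a_cont : ContinuousOn (fun z : ℝ × ℝ => a z.1 z.2)
    {z | 0 ≤ z.1 ∧ z.1 ≤ z.2 ∧ z.2 ≤ 2 * π}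
  b_cont : ContinuousOn (fun z : ℝ × ℝ => b z.1 z.2)
    {z | 0 ≤ 2 * π - z.1 ∧ 2 * π - z.1 ≤ z.2 ∧ z.2 ≤ 2 * π}
  a_contDiffOn : ContDiffOn ℝ 2 (fun z : ℝ × ℝ => a z.1 z.2)
    {z | 0 < z.1 ∧ z.1 < z.2 ∧ z.2 < 2 * π}
  b_contDiffOn : ContDiffOn ℝ 2 (fun z : ℝ × ℝ => b z.1 z.2)
    {z | 0 < 2 * π - z.1 ∧ 2 * π - z.1 < z.2 ∧ z.2 < 2 * π}
  a_wave : ∀ x t, 0 < x → x < t → t < 2 * π →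
    deriv (deriv (a x)) t + schrodinger q (fun y => a y t) x = 0
  b_wave : ∀ x t, 0 < 2 * π - x → 2 * π - x < t → t < 2 * π →
    deriv (deriv (b x)) t + schrodinger q (fun y => b y t) x = 0
  a_diag : ∀ x ∈ Ioo 0 (2 * π), HasDerivAt (fun y => a y y) (σ * q x / 4) x
  b_diag : ∀ x ∈ Ioo 0 (2 * π), HasDerivAt (fun y => b y (2 * π - y)) (-q x / 4) x
  corner : a 0 0 = 0
  a_x_cont : ExtendsContinuously (fun z => deriv (fun y => a y z.2) z.1)
    {z | 0 < z.1 ∧ z.1 < z.2 ∧ z.2 < 2 * π} {z | 0 ≤ z.1 ∧ z.1 < z.2 ∧ z.2 < 2 * π}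
  b_x_cont : ExtendsContinuously (fun z => deriv (fun y => b y z.2) z.1)
    {z | 0 < 2 * π - z.1 ∧ 2 * π - z.1 < z.2 ∧ z.2 < 2 * π}
    {z | 0 ≤ 2 * π - z.1 ∧ 2 * π - z.1 < z.2 ∧ z.2 < 2 * π}
  matching : ∀ s ∈ Ioo 0 (2 * π), a 0 s = b (2 * π) s
  matching_deriv : ∀ s ∈ Ioo 0 (2 * π), ∃ k : ℝ,
    HasDerivWithinAt (fun x => a x s) k (Ici 0) 0 ∧
    HasDerivWithinAt (fun x => b x s) k (Iic (2 * π)) (2 * π)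

/-- The wave `u_1^{F_+}` issued from the end `x = 0`, with kernels `a₁ = w_1^0`, `a₂ = w_2^0`. -/
def waveFromZero (a₁ a₂ : ℝ → ℝ → ℝ) (F : ℝ → ℝ × ℝ) (x t : ℝ) : ℝ :=
  (1 / 2) * (F (t - x)).1 - (1 / 2) * (F (t - x)).2 +
    ∫ s in x..t, (a₁ x s * (F (t - s)).1 + a₂ x s * (F (t - s)).2)

/-- The wave `u_1^{F_-}` issued from the end `x = 2π`, with kernels `b₁ = w_1^{2π}`,
`b₂ = w_2^{2π}`. -/
def waveFromTwoPi (b₁ b₂ : ℝ → ℝ → ℝ) (F : ℝ → ℝ × ℝ) (x t : ℝ) : ℝ :=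
  -(1 / 2) * (F (t + x - 2 * π)).1 - (1 / 2) * (F (t + x - 2 * π)).2 +
    ∫ s in (2 * π - x)..t, (b₁ x s * (F (t - s)).1 + b₂ x s * (F (t - s)).2)

/-- A function on `(-π, π)` rearranged to a function on `(0, 2π)`: `g x` on `(0, π)` and
`g (x - 2π)` on `(π, 2π)`. -/
def unfold (g : ℝ → ℝ) (x : ℝ) : ℝ := if x < π then g x else g (x - 2 * π)

end PeriodicWave

end

/-! The boundary conditions couple the ends `0` and `2π` of the period exactly as the conditions on
the line couple the two sides of the origin, and waves have speed one. Let `v` solve the problem on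
the line. For `t < 2π` it vanishes where `|x| ≥ t`, so in the superposition `u(x, t) = v(x, t) + v(x
- 2π, t)` the translated wave is at rest near `x = 0⁺` and the original one is at rest near `x =
2π⁻`. Hence `u` has at `0⁺` and `2π⁻` the traces of `v` at `0⁺` and `0⁻`. The line potential repeats
`q` on `(-2π, 0)`, so `u` solves the periodic problem, with `Γ₀ u` and `Γ₁ u` equal to the
corresponding data of `v` (`IsLineWave.exists_traces`, `IsLineWave.isPeriodicSolution`). It remains
to construct `v` by kernels and to prove uniqueness.

Construction. A scalar control `f` generates `c f(t - |x|) + ∫ W(x, s) f(t - s) ds`, where `c` is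
`cp` for `x > 0` and `cm` for `x < 0`; its jump at the origin is `(cp - cm) f` and that of its
derivative is `-(cp + cm) f'`. The pairs `(1/2, -1/2)` and `(-1/2, -1/2)` therefore serve `f₁` and
`f₂`. The kernel solves a Volterra equation: `W` is the Duhamel integral of the singular part
(`freeKernel`) plus that of `W` itself, and a contraction in an exponentially weighted sup norm
gives a continuous solution (`exists_eq_add_duhamel`). One `W` on the whole line yields both `w^0`
(for `x > 0`) and `w^{2π}` (for `x < 0`, translated), so the matching at the ends is continuity
across `x = 0`.

Regularity. The potential may be singular at `0` and `±2π`, where only square integrability is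
known. The Duhamel integral is split into integrals along the two characteristics through `(x, t)`,
differentiated by a Leibniz rule that tolerates an integrable weight. The delicate point is the
second derivative of `W`, settled in `contDiffAt_forwardChar_cut`. Waves with smooth controls are
easier: convolving the kernel equation with a signal shows that the wave for `g'` is its singular
part plus the characteristic integrals of the wave for `g` (`IsWaveKernel.lineWave_eq`), which can
be differentiated twice.

Uniqueness. The difference of two solutions has no jumps, so it can be glued into a `C¹` function
satisfying the equation off finitely many vertical lines. Along characteristics `U_t ± U_x` has
derivative `-p U`, and iterating the resulting estimate gives `|U| ≤ C (κ t)ⁿ / n!` with `κ = ∫ |p|`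
(`eq_zero_of_isWaveAt`). For square integrable controls the formulas extend by an `L²` bound uniform
in `t` and by density of smooth controls. -/

noncomputable section

namespace PeriodicWave

/-! ### Calculus in two variables and a Leibniz rule with an integrable weight -/

/-- The functional `(x, y) ↦ a x + b y`. -/
def gradCLM (a b : ℝ) : ℝ × ℝ →L[ℝ] ℝ :=
  a • ContinuousLinearMap.fst ℝ ℝ ℝ + b • ContinuousLinearMap.snd ℝ ℝ ℝ

@[simp] theorem gradCLM_apply (a b : ℝ) (z : ℝ × ℝ) : gradCLM a b z = a * z.1 + b * z.2 := by
  simp [gradCLM]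

theorem hasFDerivAt_of_partials {G : ℝ × ℝ → ℝ} {a b : ℝ × ℝ → ℝ} {z₀ : ℝ × ℝ}
    (h₁ : ∀ᶠ z in 𝓝 z₀, HasDerivAt (fun x => G (x, z.2)) (a z) z.1)
    (h₂ : ∀ᶠ z in 𝓝 z₀, HasDerivAt (fun y => G (z.1, y)) (b z) z.2)
    (ha : ContinuousAt a z₀) (hb : ContinuousAt b z₀) :
    HasFDerivAt G (gradCLM (a z₀) (b z₀)) z₀ := by
  have := (hasStrictFDerivAt_uncurry_coprod (u := z₀) (f := fun x y => G (x, y))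
    (f₁ := fun x y => ContinuousLinearMap.toSpanSingleton ℝ (a (x, y)))
    (f₂ := fun x y => ContinuousLinearMap.toSpanSingleton ℝ (b (x, y)))
    h₁ h₂ ?_ ?_).hasFDerivAt
  · have he : gradCLM (a z₀) (b z₀) =
        (ContinuousLinearMap.toSpanSingleton ℝ (a z₀)).coprod
          (ContinuousLinearMap.toSpanSingleton ℝ (b z₀)) := by
      ext <;> simp
    rw [he]
    exact this
  · exact (ContinuousLinearMap.toSpanSingletonCLE (𝕜 := ℝ) (E := ℝ)).continuous.continuousAt.comp ha
  · exact (ContinuousLinearMap.toSpanSingletonCLE (𝕜 := ℝ) (E := ℝ)).continuous.continuousAt.comp hb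

theorem continuousOn_gradCLM {a b : ℝ × ℝ → ℝ} {U : Set (ℝ × ℝ)} (ha : ContinuousOn a U)
    (hb : ContinuousOn b U) : ContinuousOn (fun z => gradCLM (a z) (b z)) U := by
  unfold gradCLM
  fun_prop

theorem contDiffOn_one_of_hasFDerivAt {u a b : ℝ × ℝ → ℝ} {U : Set (ℝ × ℝ)} (hU : IsOpen U)
    (hu : ∀ z ∈ U, HasFDerivAt u (gradCLM (a z) (b z)) z) (ha : ContinuousOn a U)
    (hb : ContinuousOn b U) : ContDiffOn ℝ 1 u U := by
  have : ContDiffOn ℝ (0 + 1) u U := by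
    rw [contDiffOn_succ_iff_fderiv_of_isOpen hU]
    exact ⟨fun z hz => (hu z hz).differentiableAt.differentiableWithinAt, by simp,
      contDiffOn_zero.2 ((continuousOn_gradCLM ha hb).congr fun z hz => (hu z hz).fderiv)⟩
  simpa using this

theorem contDiffOn_two_of_hasFDerivAt {u a b : ℝ × ℝ → ℝ} {U : Set (ℝ × ℝ)}
    (hU : IsOpen U) (hu : ∀ z ∈ U, HasFDerivAt u (gradCLM (a z) (b z)) z)
    (ha : ContDiffOn ℝ 1 a U) (hb : ContDiffOn ℝ 1 b U) : ContDiffOn ℝ 2 u U := by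
  have h1 : ContDiffOn ℝ 1 (fderiv ℝ u) U := by
    have : ContDiffOn ℝ 1 (fun z => gradCLM (a z) (b z)) U := by
      unfold gradCLM
      exact (ha.smul contDiffOn_const).add (hb.smul contDiffOn_const)
    exact this.congr fun z hz => (hu z hz).fderiv
  have : ContDiffOn ℝ (1 + 1) u U := by
    rw [contDiffOn_succ_iff_fderiv_of_isOpen hU]
    exact ⟨fun z hz => (hu z hz).differentiableAt.differentiableWithinAt, by simp, h1⟩
  simpa [one_add_one_eq_two] using this

open Classical in
/-- Continuity of `(x, m) ↦ ∫ y in a..m, p y * K x y` for a bounded kernel. -/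
theorem continuousAt_weighted_primitive {X : Type*} [TopologicalSpace X]
    [FirstCountableTopology X] {p : ℝ → ℝ}
    (hp : ∀ a b, IntervalIntegrable p volume a b) {K : X → ℝ → ℝ} {ξ₀ : X} {a b m₀ C : ℝ}
    (ham : a < m₀) (hmb : m₀ < b)
    (hmeas : ∀ᶠ ξ in 𝓝 ξ₀, AEStronglyMeasurable (K ξ) (volume.restrict (Ioo a b)))
    (hK : ∀ᶠ ξ in 𝓝 ξ₀, ∀ y ∈ Ioo a b, |K ξ y| ≤ C)
    (hcont : ∀ᵐ y, y ∈ Ioo a b → ContinuousAt (fun ξ => K ξ y) ξ₀) :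
    ContinuousAt (fun z : X × ℝ => ∫ y in a..z.2, p y * K z.1 y) (ξ₀, m₀) := by
  -- The domination theorem asks for measurability at every parameter, which is available only near
  -- `ξ₀`; elsewhere the integrand is replaced by zero.
  let F : X → ℝ → ℝ := fun ξ =>
    if AEStronglyMeasurable (K ξ) (volume.restrict (Ioo a b)) then
      (Ioo a b).indicator fun y => p y * K ξ y
    else 0
  have hF : ∀ᶠ ξ in 𝓝 ξ₀, F ξ = (Ioo a b).indicator fun y => p y * K ξ y := by
    filter_upwards [hmeas] with ξ hξ using if_pos hξ
  have hpm : AEStronglyMeasurable p (volume.restrict (Ioo a b)) :=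
    (hp a b).def'.aestronglyMeasurable.mono_set (by
      rw [uIoc_of_le (ham.trans hmb).le]
      exact Ioo_subset_Ioc_self)
  -- The base point `a` has to be interior to the interval of integration, hence `a - 1`; the
  -- indicator keeps the added piece empty.
  have key := intervalIntegral.continuousAt_parametric_primitive_of_dominated (F := F)
    (μ := volume) (x₀ := ξ₀) (fun y => |p y| * |C|) (a - 1) b (a₀ := a) (b₀ := m₀)
    (fun ξ => by
      by_cases hξ : AEStronglyMeasurable (K ξ) (volume.restrict (Ioo a b))
      · simp only [F, if_pos hξ]
        exact ((aestronglyMeasurable_indicator_iff measurableSet_Ioo).2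
          (hpm.mul hξ)).mono_measure Measure.restrict_le_self
      · simp only [F, if_neg hξ]
        exact aestronglyMeasurable_zero)
    (by
      filter_upwards [hK, hF] with ξ hξ hξF
      refine Eventually.of_forall fun y => ?_
      rw [hξF]
      by_cases hy : y ∈ Ioo a b
      · simp only [indicator_of_mem hy, norm_mul, Real.norm_eq_abs]
        exact mul_le_mul_of_nonneg_left ((hξ y hy).trans (le_abs_self C)) (abs_nonneg _)
      · simp only [indicator_of_notMem hy, norm_zero]
        positivity)
    ((hp _ _).abs.mul_const _)
    (by
      refine ae_restrict_of_ae ?_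
      filter_upwards [hcont] with y hy
      have hFy : (fun ξ => F ξ y) =ᶠ[𝓝 ξ₀] fun ξ => (Ioo a b).indicator (fun y => p y * K ξ y) y := by
        filter_upwards [hF] with ξ hξ
        rw [hξ]
      refine ContinuousAt.congr ?_ hFy.symm
      by_cases hy' : y ∈ Ioo a b
      · simp only [indicator_of_mem hy']
        exact continuousAt_const.mul (hy hy')
      · simp only [indicator_of_notMem hy']
        exact continuousAt_const)
    ⟨by linarith, by linarith⟩ ⟨by linarith, hmb⟩ (by simp)
  refine key.congr ?_
  have : ∀ᶠ z : X × ℝ in 𝓝 (ξ₀, m₀), z.2 ∈ Ioo a b :=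
    continuousAt_snd.eventually_mem (Ioo_mem_nhds ham hmb)
  have hF' : ∀ᶠ z : X × ℝ in 𝓝 (ξ₀, m₀), F z.1 = (Ioo a b).indicator fun y => p y * K z.1 y :=
    (show Tendsto Prod.fst (𝓝 (ξ₀, m₀)) (𝓝 ξ₀) from continuousAt_fst).eventually hF
  filter_upwards [this, hF'] with z hz hzF
  refine intervalIntegral.integral_congr_ae ?_
  refine Eventually.of_forall fun y hy => ?_
  rw [uIoc_of_le hz.1.le] at hy
  have hm : y ∈ Ioo a b := ⟨hy.1, hy.2.trans_lt hz.2⟩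
  simp only [hzF, indicator_of_mem hm]

theorem intervalIntegrable_weighted {p : ℝ → ℝ}
    (hp : ∀ a b, IntervalIntegrable p volume a b) {k : ℝ → ℝ} {a m b C : ℝ}
    (hm : m ∈ Ico a b) (hmeas : AEStronglyMeasurable k (volume.restrict (Ioo a b)))
    (hk : ∀ y ∈ Ioo a b, |k y| ≤ C) :
    IntervalIntegrable (fun y => p y * k y) volume a m := by
  have hsub : uIoc a m ⊆ Ioo a b := fun y hy => by
    rw [uIoc_of_le hm.1] at hy
    exact ⟨hy.1, hy.2.trans_lt hm.2⟩
  refine ((hp a m).abs.mul_const |C|).mono_fun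
    ((hp a m).def'.aestronglyMeasurable.mul (hmeas.mono_set hsub)) ?_
  refine (ae_restrict_iff' measurableSet_uIoc).2 (Eventually.of_forall fun y hy => ?_)
  simp only [norm_mul, Real.norm_eq_abs, abs_abs]
  exact mul_le_mul_of_nonneg_left ((hk y (hsub hy)).trans (le_abs_self C)) (abs_nonneg _)

/-- The hypotheses of the Leibniz rule for `(ξ, m) ↦ ∫ y in a..m, p y * K ξ y`, for `ξ ∈ S` and
`m ∈ (a, b)`. -/
structure IsLeibnizKernel (p : ℝ → ℝ) (K K' : ℝ → ℝ → ℝ) (S : Set ℝ) (a b C : ℝ) : Prop where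
  int : ∀ a b, IntervalIntegrable p volume a b
  isOpen : IsOpen S
  meas : ∀ ξ ∈ S, AEStronglyMeasurable (K ξ) (volume.restrict (Ioo a b))
  meas' : ∀ ξ ∈ S, AEStronglyMeasurable (K' ξ) (volume.restrict (Ioo a b))
  bdd : ∀ ξ ∈ S, ∀ y ∈ Ioo a b, |K ξ y| ≤ C
  bdd' : ∀ ξ ∈ S, ∀ y ∈ Ioo a b, |K' ξ y| ≤ C
  lip : ∀ᵐ y, y ∈ Ioo a b → ∀ ξ ∈ S, ∀ ξ' ∈ S, |K ξ y - K ξ' y| ≤ C * |ξ - ξ'|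
  deriv : ∀ ξ ∈ S, ∀ᵐ y, y ∈ Ioo a b →
    HasDerivAt (fun ξ => K ξ y) (K' ξ y) ξ ∧ ContinuousAt (fun ξ => K' ξ y) ξ

theorem IsLeibnizKernel.continuousAt {p : ℝ → ℝ} {K K' : ℝ → ℝ → ℝ} {S : Set ℝ} {a b C : ℝ}
    (h : IsLeibnizKernel p K K' S a b C) {z : ℝ × ℝ} (hz : z.1 ∈ S) (hz' : z.2 ∈ Ioo a b) :
    ContinuousAt (fun z : ℝ × ℝ => ∫ y in a..z.2, p y * K' z.1 y) z := by
  have hS : ∀ᶠ ξ in 𝓝 z.1, ξ ∈ S := h.isOpen.mem_nhds hz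
  refine continuousAt_weighted_primitive h.int hz'.1 hz'.2 (hS.mono h.meas') (C := C)
    (hS.mono h.bdd') ?_
  filter_upwards [h.deriv z.1 hz] with y hy hyI using (hy hyI).2

/-- Joint differentiability of `(ξ, m) ↦ ∫ y in a..m, p y * K ξ y`: the Leibniz rule. -/
theorem IsLeibnizKernel.hasFDerivAt {p : ℝ → ℝ} {K K' : ℝ → ℝ → ℝ} {S : Set ℝ} {a b C : ℝ}
    (h : IsLeibnizKernel p K K' S a b C) {z : ℝ × ℝ} (hz : z.1 ∈ S) (hz' : z.2 ∈ Ioo a b)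
    (hjoint : ∀ᶠ w : ℝ × ℝ in 𝓝 z, ContinuousAt (fun w : ℝ × ℝ => p w.2 * K w.1 w.2) w) :
    HasFDerivAt (fun z : ℝ × ℝ => ∫ y in a..z.2, p y * K z.1 y)
      (gradCLM (∫ y in a..z.2, p y * K' z.1 y) (p z.2 * K z.1 z.2)) z := by
  have hp := h.int
  have hball : ∀ᶠ w : ℝ × ℝ in 𝓝 z, w.1 ∈ S ∧ w.2 ∈ Ioo a b :=
    (continuousAt_fst.eventually_mem (h.isOpen.mem_nhds hz)).and
      (continuousAt_snd.eventually_mem (Ioo_mem_nhds hz'.1 hz'.2))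
  refine hasFDerivAt_of_partials (G := fun z : ℝ × ℝ => ∫ y in a..z.2, p y * K z.1 y)
    (a := fun z : ℝ × ℝ => ∫ y in a..z.2, p y * K' z.1 y) (b := fun z => p z.2 * K z.1 z.2)
    (z₀ := z) ?_ ?_ (h.continuousAt hz hz') hjoint.self_of_nhds
  · filter_upwards [hball] with z hz
    have hsub : uIoc a z.2 ⊆ Ioo a b := fun y hy => by
      rw [uIoc_of_le hz.2.1.le] at hy
      exact ⟨hy.1, hy.2.trans_lt hz.2.2⟩
    -- The derivative in `ξ` exists only for almost every `y`, with an exceptional set depending on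
    -- `ξ`; the uniform Lipschitz bound replaces a bound on the derivative near `ξ`.
    refine (intervalIntegral.hasDerivAt_integral_of_dominated_loc_of_lip
      (F := fun ξ y => p y * K ξ y) (F' := fun y => p y * K' z.1 y)
      (bound := fun y => |p y| * |C|) (h.isOpen.mem_nhds hz.1) ?_ ?_ ?_ ?_ ?_ ?_).2
    · filter_upwards [h.isOpen.mem_nhds hz.1] with ξ hξ using
        (hp _ _).def'.aestronglyMeasurable.mul ((h.meas ξ hξ).mono_set hsub)
    · exact intervalIntegrable_weighted hp ⟨hz.2.1.le, hz.2.2⟩ (h.meas _ hz.1) (h.bdd _ hz.1)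
    · exact (hp _ _).def'.aestronglyMeasurable.mul ((h.meas' _ hz.1).mono_set hsub)
    · filter_upwards [h.lip] with y hlip hy
      refine LipschitzOnWith.of_dist_le_mul fun ξ hξ ξ' hξ' => ?_
      have := hlip (hsub hy) ξ hξ ξ' hξ'
      rw [Real.dist_eq, Real.dist_eq, ← mul_sub, abs_mul]
      simp only [coe_nnabs, abs_mul, abs_abs]
      rw [mul_assoc]
      gcongr
      exact this.trans (by gcongr; exact le_abs_self C)
    · exact (hp _ _).abs.mul_const _
    · filter_upwards [h.deriv z.1 hz.1] with y hy hyI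
      exact (hy (hsub hyI)).1.const_mul _
  · filter_upwards [hball, hjoint] with z hz hzc
    have hcont : ContinuousAt (fun y => p y * K z.1 y) z.2 := by
      have : ContinuousAt (fun y : ℝ => (z.1, y)) z.2 := by fun_prop
      exact ContinuousAt.comp (f := fun y : ℝ => (z.1, y))
        (g := fun z : ℝ × ℝ => p z.2 * K z.1 z.2) hzc this
    refine intervalIntegral.integral_hasDerivAt_right
      (intervalIntegrable_weighted hp ⟨hz.2.1.le, hz.2.2⟩ (h.meas _ hz.1) (h.bdd _ hz.1)) ?_ hcont
    refine ⟨Ioo a b, Ioo_mem_nhds hz.2.1 hz.2.2, ?_⟩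
    have := (hp a b).def'.aestronglyMeasurable
    rw [uIoc_of_le (hz'.1.trans hz'.2).le] at this
    exact (this.mono_set Ioo_subset_Ioc_self).mul (h.meas z.1 hz.1)

theorem IsLeibnizKernel.contDiffAt {p : ℝ → ℝ} {K K' : ℝ → ℝ → ℝ} {S : Set ℝ} {a b C : ℝ}
    (h : IsLeibnizKernel p K K' S a b C) {z : ℝ × ℝ} (hz : z.1 ∈ S) (hz' : z.2 ∈ Ioo a b)
    (hjoint : ∀ᶠ w : ℝ × ℝ in 𝓝 z, ContinuousAt (fun w : ℝ × ℝ => p w.2 * K w.1 w.2) w) :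
    ContDiffAt ℝ 1 (fun z : ℝ × ℝ => ∫ y in a..z.2, p y * K z.1 y) z := by
  have hball : ∀ᶠ w : ℝ × ℝ in 𝓝 z, w.1 ∈ S ∧ w.2 ∈ Ioo a b :=
    (continuousAt_fst.eventually_mem (h.isOpen.mem_nhds hz)).and
      (continuousAt_snd.eventually_mem (Ioo_mem_nhds hz'.1 hz'.2))
  obtain ⟨U, hU, hUo, hzU⟩ := eventually_nhds_iff.1 (hball.and hjoint)
  have hj : ∀ w ∈ U, ∀ᶠ v : ℝ × ℝ in 𝓝 w,
      ContinuousAt (fun w : ℝ × ℝ => p w.2 * K w.1 w.2) v := fun w hw => by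
    filter_upwards [hUo.mem_nhds hw] with v hv using (hU v hv).2
  refine (contDiffOn_one_of_hasFDerivAt hUo (fun w hw =>
    h.hasFDerivAt (hU w hw).1.1 (hU w hw).1.2 (hj w hw)) ?_ ?_).contDiffAt (hUo.mem_nhds hzU)
  · exact fun w hw => (h.continuousAt (hU w hw).1.1 (hU w hw).1.2).continuousWithinAt
  · exact fun w hw => (hU w hw).2.continuousWithinAt

/-! ### Causal kernels and their integrals along characteristics -/

/-- Kernels `k y τ` vanishing for `τ ≤ |y|`, bounded for bounded times, and continuous in time
off the characteristics `τ = |y|`. -/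
structure IsCausal (k : ℝ → ℝ → ℝ) : Prop where
  meas : Measurable (Function.uncurry k)
  zero : ∀ y τ, τ ≤ |y| → k y τ = 0
  bdd : ∀ R, ∃ C, ∀ y τ, τ ≤ R → |k y τ| ≤ C
  cont : ∀ y τ, τ ≠ |y| → ContinuousAt (k y) τ

/-- `k` is a primitive in time of `k'`. -/
structure IsCausalPrimitive (k k' : ℝ → ℝ → ℝ) : Prop where
  left : IsCausal k
  right : IsCausal k'
  deriv : ∀ y τ, τ ≠ |y| → HasDerivAt (k y) (k' y τ) τ
  lip : ∀ R, ∃ C, ∀ y τ τ', τ ≤ R → τ' ≤ R → |k y τ - k y τ'| ≤ C * |τ - τ'|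

/-- The integral of `p k` along the characteristic `t - x = ξ` up to `x`, at `z = (ξ, x)`. -/
def forwardChar (p : ℝ → ℝ) (k : ℝ → ℝ → ℝ) (z : ℝ × ℝ) : ℝ :=
  ∫ y in (-(2 * π))..z.2, p y * k y (z.1 + y)

/-- The integral of `p k` along the characteristic `t + x = η` from `x` on, at `z = (η, x)`. -/
def backwardChar (p : ℝ → ℝ) (k : ℝ → ℝ → ℝ) (z : ℝ × ℝ) : ℝ :=
  ∫ y in z.2..(2 * π), p y * k y (z.1 - y)

/-- The reflection `y ↦ -y` exchanges the two families of characteristics, so that everything is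
proved for the forward one only. -/
theorem backwardChar_eq (p : ℝ → ℝ) (k : ℝ → ℝ → ℝ) (z : ℝ × ℝ) :
    backwardChar p k z = forwardChar (fun y => p (-y)) (fun y => k (-y)) (z.1, -z.2) := by
  unfold backwardChar forwardChar
  have := intervalIntegral.integral_comp_neg (a := z.2) (b := 2 * π)
    (fun y => p (-y) * k (-y) (z.1 + y))
  simp only [neg_neg] at this
  rw [← this]
  simp [sub_eq_add_neg]

theorem IsCausal.reflect {k : ℝ → ℝ → ℝ} (hk : IsCausal k) : IsCausal (fun y => k (-y)) where
  meas := hk.meas.comp ((measurable_fst.neg).prodMk measurable_snd)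
  zero y τ h := hk.zero _ _ (by simpa using h)
  bdd R := (hk.bdd R).imp fun C h y τ => h _ _
  cont y τ h := hk.cont _ _ (by simpa using h)

theorem IsCausalPrimitive.reflect {k k' : ℝ → ℝ → ℝ} (hk : IsCausalPrimitive k k') :
    IsCausalPrimitive (fun y => k (-y)) (fun y => k' (-y)) where
  left := hk.left.reflect
  right := hk.right.reflect
  deriv y τ h := hk.deriv _ _ (by simpa using h)
  lip R := (hk.lip R).imp fun C h y τ τ' => h _ _ _

theorem IsCausal.measurable_char {k : ℝ → ℝ → ℝ} (hk : IsCausal k) (ξ : ℝ) :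
    Measurable (fun y => k y (ξ + y)) :=
  hk.meas.comp (f := fun y : ℝ => (y, ξ + y)) (by fun_prop)

/-- A characteristic with `ξ ≠ 0` meets the boundary of the light cone in at most the point `y = -ξ
/ 2`; the one with `ξ = 0` contains half of that boundary. -/
theorem ae_add_ne_abs {ξ : ℝ} (hξ : ξ ≠ 0) : ∀ᵐ y : ℝ, ξ + y ≠ |y| := by
  have : ∀ᵐ y : ℝ, y ≠ -ξ / 2 := by simp [ae_iff]
  filter_upwards [this] with y hy h
  rcases abs_cases y with h' | h'
  · exact hξ (by linarith)
  · exact hy (by linarith)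

/-- The alternative covers two uses: cut kernels jump across the cone, which is harmless only for `ξ
≠ 0`, whereas waves are continuous in time and need no restriction on `ξ`. -/
theorem continuousAt_forwardChar {p : ℝ → ℝ} (hp : ∀ a b, IntervalIntegrable p volume a b)
    {k : ℝ → ℝ → ℝ} (hk : IsCausal k) {z : ℝ × ℝ} (hz : -(2 * π) < z.2)
    (h : z.1 ≠ 0 ∨ ∀ y, Continuous (k y)) : ContinuousAt (forwardChar p k) z := by
  obtain ⟨C, hC⟩ := hk.bdd (z.1 + 1 + (z.2 + 1))
  refine continuousAt_weighted_primitive hp (K := fun ξ y => k y (ξ + y)) (ξ₀ := z.1)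
    (b := z.2 + 1) (m₀ := z.2) (C := C) hz (by linarith)
    (Eventually.of_forall fun ξ => (hk.measurable_char ξ).aestronglyMeasurable) ?_ ?_
  · filter_upwards [eventually_lt_nhds (show z.1 < z.1 + 1 by linarith)] with ξ hξ y hy
    exact hC _ _ (by linarith [hy.2])
  · have : ∀ᵐ y : ℝ, ContinuousAt (k y) (z.1 + y) := by
      rcases h with h | h
      · filter_upwards [ae_add_ne_abs h] with y hy using hk.cont _ _ hy
      · exact Eventually.of_forall fun y => (h y).continuousAt
    filter_upwards [this] with y hy _
    exact ContinuousAt.comp (f := fun ξ : ℝ => ξ + y) hy (by fun_prop)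

theorem IsCausalPrimitive.isLeibnizKernel {p : ℝ → ℝ}
    (hp : ∀ a b, IntervalIntegrable p volume a b)
    {k k' : ℝ → ℝ → ℝ} (hk : IsCausalPrimitive k k') {z : ℝ × ℝ}
    (h : z.1 ≠ 0 ∨ ∀ y τ, HasDerivAt (k y) (k' y τ) τ ∧ ContinuousAt (k' y) τ) :
    ∃ ε > 0, ∃ C, IsLeibnizKernel p (fun ξ y => k y (ξ + y)) (fun ξ y => k' y (ξ + y))
      (Metric.ball z.1 ε) (-(2 * π)) (z.2 + 1) C := by
  obtain ⟨C₁, hC₁⟩ := hk.left.bdd (z.1 + 1 + (z.2 + 1))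
  obtain ⟨C₂, hC₂⟩ := hk.right.bdd (z.1 + 1 + (z.2 + 1))
  obtain ⟨C₃, hC₃⟩ := hk.lip (z.1 + 1 + (z.2 + 1))
  -- A radius of at most `|z.1|` keeps `0` out of the ball, and a radius of at most `1` keeps all
  -- times below the bound for which the constants were chosen.
  obtain ⟨ε, hε, hε1, hne⟩ : ∃ ε > 0, ε ≤ 1 ∧ ∀ ξ ∈ Metric.ball z.1 ε,
      (ξ ≠ 0 ∨ ∀ y τ, HasDerivAt (k y) (k' y τ) τ ∧ ContinuousAt (k' y) τ) := by
    rcases h with h | h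
    · refine ⟨min 1 |z.1|, by positivity, min_le_left _ _, fun ξ hξ => Or.inl ?_⟩
      rintro rfl
      rw [Metric.mem_ball, Real.dist_eq, zero_sub, abs_neg] at hξ
      exact (hξ.trans_le (min_le_right _ _)).false
    · exact ⟨1, one_pos, le_rfl, fun _ _ => Or.inr h⟩
  have hlt : ∀ ξ ∈ Metric.ball z.1 ε, ∀ y ∈ Ioo (-(2 * π)) (z.2 + 1),
      ξ + y ≤ z.1 + 1 + (z.2 + 1) := fun ξ hξ y hy => by
    rw [Metric.mem_ball, Real.dist_eq] at hξ
    linarith [(abs_lt.1 hξ).2, hy.2]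
  refine ⟨ε, hε, max (max C₁ C₂) C₃, hp, Metric.isOpen_ball,
    fun ξ _ => (hk.left.measurable_char ξ).aestronglyMeasurable,
    fun ξ _ => (hk.right.measurable_char ξ).aestronglyMeasurable, ?_, ?_, ?_, ?_⟩
  · exact fun ξ hξ y hy => (hC₁ _ _ (hlt ξ hξ y hy)).trans (by simp)
  · exact fun ξ hξ y hy => (hC₂ _ _ (hlt ξ hξ y hy)).trans (by simp)
  · refine Eventually.of_forall fun y hy ξ hξ ξ' hξ' => ?_
    have := hC₃ y _ _ (hlt ξ hξ y hy) (hlt ξ' hξ' y hy)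
    rw [add_sub_add_right_eq_sub] at this
    exact this.trans (mul_le_mul_of_nonneg_right (le_max_right _ _) (abs_nonneg _))
  · intro ξ hξ
    have : ∀ᵐ y : ℝ, HasDerivAt (k y) (k' y (ξ + y)) (ξ + y) ∧ ContinuousAt (k' y) (ξ + y) := by
      rcases hne ξ hξ with h | h
      · filter_upwards [ae_add_ne_abs h] with y hy using ⟨hk.deriv _ _ hy, hk.right.cont _ _ hy⟩
      · exact Eventually.of_forall fun y => h y _
    filter_upwards [this] with y hy _
    refine ⟨?_, ContinuousAt.comp (f := fun ξ : ℝ => ξ + y) hy.2 (by fun_prop)⟩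
    simpa using hy.1.comp_add_const ξ y

theorem hasFDerivAt_forwardChar {p : ℝ → ℝ} (hp : ∀ a b, IntervalIntegrable p volume a b)
    {k k' : ℝ → ℝ → ℝ} (hk : IsCausalPrimitive k k') {z : ℝ × ℝ} (hz : -(2 * π) < z.2)
    (h : z.1 ≠ 0 ∨ ∀ y τ, HasDerivAt (k y) (k' y τ) τ ∧ ContinuousAt (k' y) τ)
    (hjoint : ∀ᶠ w : ℝ × ℝ in 𝓝 z, ContinuousAt (fun w : ℝ × ℝ => p w.2 * k w.2 (w.1 + w.2)) w) :
    HasFDerivAt (forwardChar p k)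
      (gradCLM (forwardChar p k' z) (p z.2 * k z.2 (z.1 + z.2))) z := by
  obtain ⟨ε, hε, C, hL⟩ := hk.isLeibnizKernel hp h
  exact hL.hasFDerivAt (Metric.mem_ball_self hε) ⟨hz, by linarith⟩ hjoint

theorem continuousAt_backwardChar {p : ℝ → ℝ} (hp : ∀ a b, IntervalIntegrable p volume a b)
    {k : ℝ → ℝ → ℝ} (hk : IsCausal k) {z : ℝ × ℝ} (hz : z.2 < 2 * π)
    (h : z.1 ≠ 0 ∨ ∀ y, Continuous (k y)) : ContinuousAt (backwardChar p k) z := by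
  have hp' : ∀ a b, IntervalIntegrable (fun y => p (-y)) volume a b := fun a b => by
    simpa using (IntervalIntegrable.iff_comp_neg (a := -a) (b := -b)).1 (hp (-a) (-b))
  have := continuousAt_forwardChar hp' hk.reflect (z := (z.1, -z.2)) (by simpa using hz)
    (h.imp id fun h y => h _)
  have h2 : backwardChar p k =
      forwardChar (fun y => p (-y)) (fun y => k (-y)) ∘ fun z : ℝ × ℝ => (z.1, -z.2) := by
    ext z
    exact backwardChar_eq p k z
  rw [h2]
  exact ContinuousAt.comp this (by fun_prop)

theorem hasFDerivAt_comp_snd_neg {G : ℝ × ℝ → ℝ} {a b : ℝ} {z : ℝ × ℝ}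
    (h : HasFDerivAt G (gradCLM a b) (z.1, -z.2)) :
    HasFDerivAt (fun w : ℝ × ℝ => G (w.1, -w.2)) (gradCLM a (-b)) z := by
  have h1 : HasFDerivAt (fun w : ℝ × ℝ => (w.1, -w.2))
      ((ContinuousLinearMap.fst ℝ ℝ ℝ).prod (-ContinuousLinearMap.snd ℝ ℝ ℝ)) z :=
    hasFDerivAt_fst.prodMk hasFDerivAt_snd.neg
  refine (HasFDerivAt.comp (f := fun w : ℝ × ℝ => (w.1, -w.2)) z h h1).congr_fderiv ?_
  ext <;> simp

theorem hasFDerivAt_backwardChar {p : ℝ → ℝ} (hp : ∀ a b, IntervalIntegrable p volume a b)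
    {k k' : ℝ → ℝ → ℝ} (hk : IsCausalPrimitive k k') {z : ℝ × ℝ} (hz : z.2 < 2 * π)
    (h : z.1 ≠ 0 ∨ ∀ y τ, HasDerivAt (k y) (k' y τ) τ ∧ ContinuousAt (k' y) τ)
    (hjoint : ∀ᶠ w : ℝ × ℝ in 𝓝 z, ContinuousAt (fun w : ℝ × ℝ => p w.2 * k w.2 (w.1 - w.2)) w) :
    HasFDerivAt (backwardChar p k)
      (gradCLM (backwardChar p k' z) (-(p z.2 * k z.2 (z.1 - z.2)))) z := by
  have hp' : ∀ a b, IntervalIntegrable (fun y => p (-y)) volume a b := fun a b => by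
    simpa using (IntervalIntegrable.iff_comp_neg (a := -a) (b := -b)).1 (hp (-a) (-b))
  have hj : ∀ᶠ w : ℝ × ℝ in 𝓝 (z.1, -z.2),
      ContinuousAt (fun w : ℝ × ℝ => p (-w.2) * k (-w.2) (w.1 + w.2)) w := by
    have hc : ContinuousAt (fun w : ℝ × ℝ => (w.1, -w.2)) (z.1, -z.2) := by fun_prop
    have : Tendsto (fun w : ℝ × ℝ => (w.1, -w.2)) (𝓝 (z.1, -z.2)) (𝓝 z) := by
      simpa [ContinuousAt] using hc
    filter_upwards [this.eventually hjoint] with w hw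
    have := ContinuousAt.comp (f := fun w : ℝ × ℝ => (w.1, -w.2)) hw (by fun_prop)
    simpa [Function.comp_def, sub_neg_eq_add] using this
  have := hasFDerivAt_forwardChar hp' hk.reflect (z := (z.1, -z.2)) (by simpa using hz)
    (h.imp id fun h y => h _) hj
  have h2 := hasFDerivAt_comp_snd_neg this
  rw [← backwardChar_eq p k'] at h2
  simp only [neg_neg, ← sub_eq_add_neg] at h2
  exact h2.congr_of_eventuallyEq (Eventually.of_forall fun w => backwardChar_eq p k w)

theorem hasFDerivAt_comp_forward {G : ℝ × ℝ → ℝ} {a b : ℝ} {z : ℝ × ℝ}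
    (h : HasFDerivAt G (gradCLM a b) (z.2 - z.1, z.1)) :
    HasFDerivAt (fun w : ℝ × ℝ => G (w.2 - w.1, w.1)) (gradCLM (b - a) a) z := by
  have h1 : HasFDerivAt (fun w : ℝ × ℝ => (w.2 - w.1, w.1))
      ((ContinuousLinearMap.snd ℝ ℝ ℝ - ContinuousLinearMap.fst ℝ ℝ ℝ).prod
        (ContinuousLinearMap.fst ℝ ℝ ℝ)) z :=
    (hasFDerivAt_snd.sub hasFDerivAt_fst).prodMk hasFDerivAt_fst
  refine (HasFDerivAt.comp (f := fun w : ℝ × ℝ => (w.2 - w.1, w.1)) z h h1).congr_fderiv ?_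
  ext <;> simp; ring

theorem hasFDerivAt_comp_backward {G : ℝ × ℝ → ℝ} {a b : ℝ} {z : ℝ × ℝ}
    (h : HasFDerivAt G (gradCLM a b) (z.2 + z.1, z.1)) :
    HasFDerivAt (fun w : ℝ × ℝ => G (w.2 + w.1, w.1)) (gradCLM (a + b) a) z := by
  have h1 : HasFDerivAt (fun w : ℝ × ℝ => (w.2 + w.1, w.1))
      ((ContinuousLinearMap.snd ℝ ℝ ℝ + ContinuousLinearMap.fst ℝ ℝ ℝ).prod
        (ContinuousLinearMap.fst ℝ ℝ ℝ)) z :=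
    (hasFDerivAt_snd.add hasFDerivAt_fst).prodMk hasFDerivAt_fst
  refine (HasFDerivAt.comp (f := fun w : ℝ × ℝ => (w.2 + w.1, w.1)) z h h1).congr_fderiv ?_
  ext <;> simp

/-! ### The Duhamel operator and the Volterra equation -/

/-- The primitive in time of `h` from the characteristic `τ = |y|` on. -/
def timePrimitive (h : ℝ → ℝ → ℝ) (y τ : ℝ) : ℝ := ∫ s in |y|..max |y| τ, h y s

/-- The Duhamel operator of the wave equation with potential `p`. -/
def duhamel (p : ℝ → ℝ) (h : ℝ → ℝ → ℝ) (x t : ℝ) : ℝ :=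
  -(1 / 2) * ∫ y, p y * timePrimitive h y (t - |x - y|)

theorem continuous_timePrimitive {h : ℝ → ℝ → ℝ} (hh : Continuous (Function.uncurry h)) :
    Continuous (Function.uncurry (timePrimitive h)) := by
  have hi : ∀ y a b, IntervalIntegrable (h y) volume a b := fun y a b =>
    (hh.comp (f := fun s : ℝ => (y, s)) (by fun_prop)).intervalIntegrable a b
  have : Function.uncurry (timePrimitive h) = fun z : ℝ × ℝ =>
      (∫ s in (0 : ℝ)..max |z.1| z.2, h z.1 s) - ∫ s in (0 : ℝ)..|z.1|, h z.1 s := by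
    ext z
    exact (intervalIntegral.integral_interval_sub_left (hi _ _ _) (hi _ _ _)).symm
  rw [this]
  have h' : Continuous (Function.uncurry fun (z : ℝ × ℝ) s => h z.1 s) :=
    hh.comp (f := fun w : (ℝ × ℝ) × ℝ => (w.1.1, w.2)) (by fun_prop)
  exact (intervalIntegral.continuous_parametric_intervalIntegral_of_continuous h'
    (by fun_prop)).sub
    (intervalIntegral.continuous_parametric_intervalIntegral_of_continuous h' (by fun_prop))

theorem timePrimitive_of_le {h : ℝ → ℝ → ℝ} {y τ : ℝ} (hτ : τ ≤ |y|) :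
    timePrimitive h y τ = 0 := by
  simp [timePrimitive, max_eq_left hτ]

theorem timePrimitive_of_ge {h : ℝ → ℝ → ℝ} {y τ : ℝ} (hτ : |y| ≤ τ) :
    timePrimitive h y τ = ∫ s in |y|..τ, h y s := by
  simp [timePrimitive, max_eq_right hτ]

/-- Integrating the weight `exp (l s)` in time gains the factor `1 / l`, which is the source of the
contraction. -/
theorem abs_timePrimitive_le {h : ℝ → ℝ → ℝ} {l M y τ t : ℝ} (hl : 0 < l)
    (hh : ∀ y s, |h y s| ≤ M * rexp (l * |s|)) (hτ : τ ≤ t) :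
    |timePrimitive h y τ| ≤ M * rexp (l * |t|) / l := by
  have hM : 0 ≤ M := by
    have := (abs_nonneg _).trans (hh 0 0)
    simpa using this
  rcases le_total τ |y| with h1 | h1
  · rw [timePrimitive_of_le h1, abs_zero]
    positivity
  · rw [timePrimitive_of_ge h1]
    have hy := abs_nonneg y
    have h2 : ∫ s in |y|..τ, M * rexp (l * s) = M * ((rexp (l * τ) - rexp (l * |y|)) / l) := by
      rw [intervalIntegral.integral_const_mul,
        intervalIntegral.integral_comp_mul_left (fun s => rexp s) hl.ne', integral_exp]
      simp [div_eq_inv_mul]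
    have h3 := intervalIntegral.norm_integral_le_of_norm_le (f := h y) (μ := volume) h1
      (g := fun s => M * rexp (l * s)) (Eventually.of_forall fun s hs => by
        have := hh y s
        rwa [abs_of_pos (hy.trans_lt hs.1)] at this)
      ((by fun_prop : Continuous fun s => M * rexp (l * s)).intervalIntegrable _ _)
    rw [h2, Real.norm_eq_abs] at h3
    refine h3.trans ?_
    rw [mul_div_assoc]
    gcongr
    have : rexp (l * τ) ≤ rexp (l * |t|) := by
      gcongr
      exact hτ.trans (le_abs_self t)
    linarith [Real.exp_pos (l * |y|)]

theorem sub_abs_le (t a : ℝ) : t - |a| ≤ t := by linarith [abs_nonneg a]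

theorem integrable_mul_timePrimitive {p : ℝ → ℝ} (hp : Integrable p) {h : ℝ → ℝ → ℝ} {l M : ℝ}
    (hl : 0 < l) (hc : Continuous (Function.uncurry h))
    (hh : ∀ y s, |h y s| ≤ M * rexp (l * |s|)) (x t : ℝ) :
    Integrable fun y => p y * timePrimitive h y (t - |x - y|) := by
  refine hp.mul_bdd (c := M * rexp (l * |t|) / l) ?_ (Eventually.of_forall fun y => ?_)
  · exact ((continuous_timePrimitive hc).comp (f := fun y : ℝ => (y, t - |x - y|))
      (by fun_prop)).aestronglyMeasurable
  · exact abs_timePrimitive_le hl hh (sub_abs_le _ _)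

/-- The gain `1 / l` from the time integration absorbs `∫ |p| ≤ l`, so only the `1 / 2` of
d'Alembert's formula remains. -/
theorem abs_duhamel_le {p : ℝ → ℝ} (hp : Integrable p) {h : ℝ → ℝ → ℝ} {l M : ℝ}
    (hl : ∫ y, |p y| ≤ l) (hl0 : 0 < l)
    (hh : ∀ y s, |h y s| ≤ M * rexp (l * |s|)) (x t : ℝ) :
    |duhamel p h x t| ≤ 1 / 2 * (M * rexp (l * |t|)) := by
  have hM : 0 ≤ M := by
    have := (abs_nonneg _).trans (hh 0 0)
    simpa using this
  rw [duhamel, abs_mul, abs_neg, abs_of_pos (by norm_num : (0 : ℝ) < 1 / 2)]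
  gcongr
  have h1 := norm_integral_le_of_norm_le (f := fun y => p y * timePrimitive h y (t - |x - y|))
    (hp.abs.mul_const (M * rexp (l * |t|) / l)) (Eventually.of_forall fun y => by
      rw [norm_mul]
      exact mul_le_mul_of_nonneg_left (abs_timePrimitive_le hl0 hh (sub_abs_le _ _))
        (abs_nonneg _))
  rw [integral_mul_const, Real.norm_eq_abs] at h1
  refine h1.trans ?_
  rw [mul_div_left_comm]
  exact mul_le_of_le_one_right (by positivity) ((div_le_one hl0).2 hl)

theorem continuous_duhamel {p : ℝ → ℝ} (hp : Integrable p) {h : ℝ → ℝ → ℝ} {l M : ℝ} (hl : 0 < l)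
    (hc : Continuous (Function.uncurry h)) (hh : ∀ y s, |h y s| ≤ M * rexp (l * |s|)) :
    Continuous (Function.uncurry (duhamel p h)) := by
  refine continuous_const.mul (continuous_iff_continuousAt.2 fun z => ?_)
  have hM : 0 ≤ M := by
    have := (abs_nonneg _).trans (hh 0 0)
    simpa using this
  refine continuousAt_of_dominated (bound := fun y => |p y| * (M * rexp (l * (|z.2| + 1)) / l))
    ?_ ?_ (hp.abs.mul_const _) ?_
  · exact Eventually.of_forall fun w =>
      (integrable_mul_timePrimitive hp hl hc hh w.1 w.2).aestronglyMeasurable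
  · have : ∀ᶠ w : ℝ × ℝ in 𝓝 z, |w.2| < |z.2| + 1 :=
      (by fun_prop : ContinuousAt (fun w : ℝ × ℝ => |w.2|) z).eventually_lt_const (by simp)
    filter_upwards [this] with w hw
    refine Eventually.of_forall fun y => ?_
    rw [norm_mul]
    refine mul_le_mul_of_nonneg_left
      ((abs_timePrimitive_le hl hh (sub_abs_le _ _)).trans ?_) (abs_nonneg _)
    gcongr
  · refine Eventually.of_forall fun y => continuousAt_const.mul ?_
    exact ((continuous_timePrimitive hc).comp (f := fun w : ℝ × ℝ => (y, w.2 - |w.1 - y|))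
      (by fun_prop)).continuousAt

theorem duhamel_sub {p : ℝ → ℝ} (hp : Integrable p) {h k : ℝ → ℝ → ℝ} {l M N : ℝ} (hl : 0 < l)
    (hc : Continuous (Function.uncurry h)) (hh : ∀ y s, |h y s| ≤ M * rexp (l * |s|))
    (kc : Continuous (Function.uncurry k)) (hk : ∀ y s, |k y s| ≤ N * rexp (l * |s|)) (x t : ℝ) :
    duhamel p h x t - duhamel p k x t = duhamel p (fun y s => h y s - k y s) x t := by
  unfold duhamel
  rw [← mul_sub, ← integral_sub (integrable_mul_timePrimitive hp hl hc hh x t)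
    (integrable_mul_timePrimitive hp hl kc hk x t)]
  congr 2
  ext y
  rw [← mul_sub]
  congr 1
  unfold timePrimitive
  rw [intervalIntegral.integral_sub]
  · exact (hc.comp (f := fun s : ℝ => (y, s)) (by fun_prop)).intervalIntegrable _ _
  · exact (kc.comp (f := fun s : ℝ => (y, s)) (by fun_prop)).intervalIntegrable _ _

open BoundedContinuousFunction in
/-- Solvability of the Volterra equation `W = g + duhamel p W`. -/
theorem exists_eq_add_duhamel {p : ℝ → ℝ} (hp : Integrable p) {g : ℝ → ℝ → ℝ} {N : ℝ}
    (hg : Continuous (Function.uncurry g)) (hN : ∀ x t, |g x t| ≤ N) :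
    ∃ W : ℝ → ℝ → ℝ, Continuous (Function.uncurry W) ∧
      ∀ x t, W x t = g x t + duhamel p W x t := by
  -- The summand `1` keeps the weight exponent positive when `p` vanishes almost everywhere.
  set l : ℝ := (∫ y, |p y|) + 1 with hl
  have hp0 : 0 ≤ ∫ y, |p y| := integral_nonneg fun y => abs_nonneg _
  have hl0 : 0 < l := by linarith
  have hpl : ∫ y, |p y| ≤ l := by linarith
  -- The unknown is written as a bounded continuous function times the weight; the equation becomes
  -- a fixed point problem for the bounded factor.
  let w : (ℝ × ℝ →ᵇ ℝ) → ℝ → ℝ → ℝ := fun f y s => f (y, s) * rexp (l * |s|)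
  have wc : ∀ f, Continuous (Function.uncurry (w f)) := fun f => by
    have : Continuous fun z : ℝ × ℝ => f z * rexp (l * |z.2|) := by fun_prop
    exact this
  have wb : ∀ f y s, |w f y s| ≤ ‖f‖ * rexp (l * |s|) := fun f y s => by
    simp only [w, abs_mul, Real.abs_exp]
    gcongr
    exact f.norm_coe_le_norm _
  have hΦ : ∀ (f : ℝ × ℝ →ᵇ ℝ) (z : ℝ × ℝ), ‖rexp (-(l * |z.2|)) * (g z.1 z.2 + duhamel p (w f) z.1 z.2)‖ ≤
      N + 1 / 2 * ‖f‖ := fun f z => by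
    have hN0 : 0 ≤ N := (abs_nonneg _).trans (hN 0 0)
    rw [norm_mul, Real.norm_eq_abs, Real.norm_eq_abs, Real.abs_exp]
    have h1 := abs_duhamel_le hp hpl hl0 (wb f) z.1 z.2
    have h2 : rexp (-(l * |z.2|)) ≤ 1 := by
      rw [Real.exp_le_one_iff]
      have : 0 ≤ l * |z.2| := by positivity
      linarith
    have h3 : rexp (-(l * |z.2|)) * rexp (l * |z.2|) = 1 := by rw [← Real.exp_add]; simp
    calc rexp (-(l * |z.2|)) * |g z.1 z.2 + duhamel p (w f) z.1 z.2|
        ≤ rexp (-(l * |z.2|)) * (N + 1 / 2 * (‖f‖ * rexp (l * |z.2|))) := by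
          gcongr
          exact (abs_add_le _ _).trans (add_le_add (hN _ _) h1)
      _ = rexp (-(l * |z.2|)) * N + 1 / 2 * ‖f‖ * (rexp (-(l * |z.2|)) * rexp (l * |z.2|)) := by
          ring
      _ ≤ N + 1 / 2 * ‖f‖ := by
          rw [h3, mul_one]
          gcongr
          exact mul_le_of_le_one_left hN0 h2
  let Φ : (ℝ × ℝ →ᵇ ℝ) → (ℝ × ℝ →ᵇ ℝ) := fun f => BoundedContinuousFunction.ofNormedAddCommGroup
    (fun z : ℝ × ℝ => rexp (-(l * |z.2|)) * (g z.1 z.2 + duhamel p (w f) z.1 z.2))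
    (by
      refine Continuous.mul (by fun_prop) (Continuous.add hg ?_)
      exact continuous_duhamel hp hl0 (wc f) (wb f))
    (N + 1 / 2 * ‖f‖) (hΦ f)
  have hc : ContractingWith (1 / 2) Φ := by
    refine ⟨by rw [← NNReal.coe_lt_coe]; norm_num, LipschitzWith.of_dist_le_mul fun f f' => ?_⟩
    rw [BoundedContinuousFunction.dist_le (by positivity)]
    intro z
    have h1 : (Φ f) z - (Φ f') z = rexp (-(l * |z.2|)) * duhamel p (w (f - f')) z.1 z.2 := by
      have : w (f - f') = fun y s => w f y s - w f' y s := by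
        ext y s
        simp [w, sub_mul]
      rw [this, ← duhamel_sub hp hl0 (wc f) (wb f) (wc f') (wb f')]
      simp only [Φ, BoundedContinuousFunction.coe_ofNormedAddCommGroup]
      ring
    rw [Real.dist_eq, h1, abs_mul, Real.abs_exp, dist_eq_norm]
    have h3 : rexp (-(l * |z.2|)) * rexp (l * |z.2|) = 1 := by rw [← Real.exp_add]; simp
    calc rexp (-(l * |z.2|)) * |duhamel p (w (f - f')) z.1 z.2|
        ≤ rexp (-(l * |z.2|)) * (1 / 2 * (‖f - f'‖ * rexp (l * |z.2|))) := by
          gcongr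
          exact abs_duhamel_le hp hpl hl0 (wb _) z.1 z.2
      _ = 1 / 2 * ‖f - f'‖ * (rexp (-(l * |z.2|)) * rexp (l * |z.2|)) := by ring
      _ = _ := by rw [h3]; simp
  let f := hc.fixedPoint
  refine ⟨w f, wc f, fun x t => ?_⟩
  have hf : Φ f = f := hc.fixedPoint_isFixedPt
  have h3 : rexp (-(l * |t|)) * rexp (l * |t|) = 1 := by rw [← Real.exp_add]; simp
  have : f (x, t) = rexp (-(l * |t|)) * (g x t + duhamel p (w f) x t) :=
    (DFunLike.congr_fun hf (x, t)).symm
  calc w f x t = f (x, t) * rexp (l * |t|) := rfl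
    _ = (g x t + duhamel p (w f) x t) * (rexp (-(l * |t|)) * rexp (l * |t|)) := by rw [this]; ring
    _ = _ := by rw [h3, mul_one]

/-! ### Line potentials and wave kernels -/

/-- Potentials on the line supported in `[-2π, 2π]`, continuously differentiable in `(-2π, 2π)` off
the origin. -/
structure IsLinePotential (p : ℝ → ℝ) : Prop where
  integrable : Integrable p
  memLp : MemLp p 2
  zero : ∀ x, 2 * π ≤ |x| → p x = 0
  smooth : ∀ x, x ≠ 0 → |x| < 2 * π → ContDiffAt ℝ 1 p x

theorem IsLinePotential.int {p : ℝ → ℝ} (hp : IsLinePotential p) (a b : ℝ) :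
    IntervalIntegrable p volume a b := hp.integrable.intervalIntegrable

theorem IsLinePotential.reflect {p : ℝ → ℝ} (hp : IsLinePotential p) :
    IsLinePotential (fun y => p (-y)) where
  integrable := hp.integrable.comp_neg
  memLp := hp.memLp.comp_measurePreserving (Measure.measurePreserving_neg volume)
  zero x h := hp.zero _ (by simpa using h)
  smooth x h h' := by
    have := hp.smooth (-x) (by simpa using h) (by simpa using h')
    exact ContDiffAt.comp x (g := p) (f := fun y => -y) this contDiffAt_id.neg

theorem IsLinePotential.eventually_contDiffAt {p : ℝ → ℝ} (hp : IsLinePotential p) {x : ℝ}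
    (h0 : x ≠ 0) (h : |x| < 2 * π) : ∀ᶠ y in 𝓝 x, ContDiffAt ℝ 1 p y := by
  filter_upwards [isOpen_ne.mem_nhds h0,
    (by fun_prop : ContinuousAt (fun y : ℝ => |y|) x).eventually_lt_const h] with y h1 h2
    using hp.smooth y h1 h2

/-- An integral over the line splits into those along the two characteristics through `(x, t)`. -/
theorem integral_eq_forwardChar_add_backwardChar {p : ℝ → ℝ} (hp : IsLinePotential p)
    {k : ℝ → ℝ → ℝ} (hk : IsCausal k) (x t : ℝ) :
    ∫ y, p y * k y (t - |x - y|) = forwardChar p k (t - x, x) + backwardChar p k (t + x, x) := by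
  have hπ := Real.pi_pos
  have hi : Integrable fun y => p y * k y (t - |x - y|) := by
    obtain ⟨C, hC⟩ := hk.bdd t
    refine hp.integrable.mul_bdd (c := C) ?_ (Eventually.of_forall fun y => ?_)
    · exact (hk.meas.comp (f := fun y : ℝ => (y, t - |x - y|)) (by fun_prop)).aestronglyMeasurable
    · exact hC _ _ (sub_abs_le _ _)
  have h1 : ∫ y, p y * k y (t - |x - y|) = ∫ y in (-(2 * π))..(2 * π), p y * k y (t - |x - y|) := by
    rw [intervalIntegral.integral_of_le (by linarith)]
    refine (setIntegral_eq_integral_of_forall_compl_eq_zero fun y hy => ?_).symm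
    rw [hp.zero, zero_mul]
    by_contra! h
    exact hy ⟨(abs_lt.1 h).1, (abs_lt.1 h).2.le⟩
  rw [h1, ← intervalIntegral.integral_add_adjacent_intervals (b := x)
    hi.intervalIntegrable hi.intervalIntegrable]
  unfold forwardChar backwardChar
  have hz : ∀ y, y ≤ -(2 * π) → p y = 0 := fun y hy => hp.zero y (by
    rw [abs_of_nonpos (by linarith)]; linarith)
  have hz' : ∀ y, 2 * π ≤ y → p y = 0 := fun y hy => hp.zero y (by
    rw [abs_of_nonneg (by linarith)]; linarith)
  congr 1
  · refine intervalIntegral.integral_congr fun y hy => ?_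
    -- To the left of `-2π` the oriented integral runs where `p` vanishes, so the sign of `x - y` is
    -- irrelevant there.
    rcases le_total (-(2 * π)) x with h | h
    · rw [uIcc_of_le h] at hy
      simp only [abs_of_nonneg (sub_nonneg.2 hy.2)]
      ring_nf
    · rw [uIcc_of_ge h] at hy
      simp [hz y hy.2]
  · refine intervalIntegral.integral_congr fun y hy => ?_
    rcases le_total x (2 * π) with h | h
    · rw [uIcc_of_le h] at hy
      simp only [abs_of_nonpos (sub_nonpos.2 hy.1)]
      ring_nf
    · rw [uIcc_of_ge h] at hy
      simp [hz' y hy.1]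

/-- The Duhamel term of the wave with jump `cp, cm` along the characteristics from the origin. -/
def freeKernel (p : ℝ → ℝ) (cp cm x t : ℝ) : ℝ :=
  -(1 / 2) * (cp * (∫ y in (0 : ℝ)..(t + x) / 2, p y) + cm * ∫ y in (-(t - x) / 2)..0, p y)

/-- Kernels of the transmission problem: `W = w^0` for `x > 0` and `W(x - 2π, ·) = w^{2π}(x, ·)`
for `x < 0`. -/
structure IsWaveKernel (p : ℝ → ℝ) (cp cm : ℝ) (W : ℝ → ℝ → ℝ) : Prop where
  cont : Continuous (Function.uncurry W)
  eq : ∀ x t, W x t = freeKernel p cp cm x t + duhamel p W x t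

theorem continuous_freeKernel {p : ℝ → ℝ} (hp : Integrable p) (cp cm : ℝ) :
    Continuous (Function.uncurry (freeKernel p cp cm)) := by
  have h : Continuous fun b : ℝ => ∫ y in (0 : ℝ)..b, p y := hp.continuous_primitive 0
  have : Function.uncurry (freeKernel p cp cm) = fun z : ℝ × ℝ => -(1 / 2) *
      (cp * (∫ y in (0 : ℝ)..(z.2 + z.1) / 2, p y) - cm * ∫ y in (0 : ℝ)..(-(z.2 - z.1) / 2), p y) := by
    ext z
    simp only [Function.uncurry, freeKernel]
    rw [intervalIntegral.integral_symm 0]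
    ring
  rw [this]
  have h1 : Continuous fun z : ℝ × ℝ => ∫ y in (0 : ℝ)..(z.2 + z.1) / 2, p y :=
    h.comp (f := fun z : ℝ × ℝ => (z.2 + z.1) / 2) (by fun_prop)
  have h2 : Continuous fun z : ℝ × ℝ => ∫ y in (0 : ℝ)..(-(z.2 - z.1) / 2), p y :=
    h.comp (f := fun z : ℝ × ℝ => -(z.2 - z.1) / 2) (by fun_prop)
  fun_prop

theorem exists_isWaveKernel {p : ℝ → ℝ} (hp : Integrable p) (cp cm : ℝ) :
    ∃ W, IsWaveKernel p cp cm W := by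
  have hb : ∀ a b : ℝ, |∫ y in a..b, p y| ≤ ∫ y, |p y| := fun a b => by
    refine (intervalIntegral.norm_integral_le_integral_norm_uIoc (f := p)).trans ?_
    exact setIntegral_le_integral hp.norm (Eventually.of_forall fun y => norm_nonneg _)
  obtain ⟨W, h1, h2⟩ := exists_eq_add_duhamel hp (continuous_freeKernel hp cp cm)
    (N := 1 / 2 * (|cp| * (∫ y, |p y|) + |cm| * ∫ y, |p y|)) (fun x t => by
      rw [freeKernel, abs_mul, abs_neg, abs_of_pos (by norm_num : (0 : ℝ) < 1 / 2)]
      gcongr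
      refine (abs_add_le _ _).trans ?_
      rw [abs_mul, abs_mul]
      gcongr <;> exact hb _ _)
  exact ⟨W, h1, h2⟩

theorem timePrimitive_reflect (W : ℝ → ℝ → ℝ) (y τ : ℝ) :
    timePrimitive (fun x => W (-x)) y τ = timePrimitive W (-y) τ := by
  simp [timePrimitive]

/-- Reflection in the origin exchanges the two half-lines and with them the coefficients `cp` and
`cm`; it carries the regularity of forward integrals over to backward ones. -/
theorem IsWaveKernel.reflect {p : ℝ → ℝ} {cp cm : ℝ} {W : ℝ → ℝ → ℝ}
    (hW : IsWaveKernel p cp cm W) :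
    IsWaveKernel (fun y => p (-y)) cm cp (fun x => W (-x)) where
  cont := hW.cont.comp (f := fun z : ℝ × ℝ => (-z.1, z.2)) (by fun_prop)
  eq x t := by
    rw [hW.eq]
    congr 1
    · simp only [freeKernel]
      rw [intervalIntegral.integral_comp_neg, intervalIntegral.integral_comp_neg]
      simp only [neg_zero, sub_neg_eq_add]
      ring_nf
    · simp only [duhamel, timePrimitive_reflect]
      rw [← integral_neg_eq_self]
      congr 2
      ext y
      rw [show |-x - -y| = |x - y| by rw [← abs_neg]; ring_nf]

/-- `W` restricted to the region `|y| < τ`. -/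
def cutKernel (W : ℝ → ℝ → ℝ) (y τ : ℝ) : ℝ := if |y| < τ then W y τ else 0

theorem exists_bound_of_continuous {k : ℝ → ℝ → ℝ} (hk : Continuous (Function.uncurry k)) (R : ℝ) :
    ∃ C, ∀ y τ, |y| ≤ τ → τ ≤ R → |k y τ| ≤ C := by
  obtain ⟨C, hC⟩ := (isCompact_Icc (a := -R) (b := R)).prod (isCompact_Icc (a := 0) (b := R))
    |>.exists_bound_of_continuousOn hk.continuousOn
  refine ⟨C, fun y τ h h' => hC (y, τ) ⟨?_, ?_⟩⟩
  · exact abs_le.1 (h.trans h')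
  · exact ⟨(abs_nonneg y).trans h, h'⟩

theorem isCausal_of_continuous {k : ℝ → ℝ → ℝ} (hk : Continuous (Function.uncurry k))
    (hz : ∀ y τ, τ ≤ |y| → k y τ = 0) : IsCausal k where
  meas := hk.measurable
  zero := hz
  bdd R := by
    obtain ⟨C, hC⟩ := exists_bound_of_continuous hk R
    refine ⟨max C 0, fun y τ h => ?_⟩
    rcases le_total τ |y| with h' | h'
    · simp [hz y τ h']
    · exact (hC y τ h' h).trans (le_max_left _ _)
  cont y τ _ := (hk.comp (f := fun s : ℝ => (y, s)) (by fun_prop)).continuousAt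

theorem isCausal_cutKernel {W : ℝ → ℝ → ℝ} (hW : Continuous (Function.uncurry W)) :
    IsCausal (cutKernel W) where
  meas := Measurable.ite (measurableSet_lt (by fun_prop) measurable_snd) hW.measurable
    measurable_const
  zero y τ h := if_neg h.not_gt
  bdd R := by
    obtain ⟨C, hC⟩ := exists_bound_of_continuous hW R
    refine ⟨max C 0, fun y τ h => ?_⟩
    unfold cutKernel
    split_ifs with h'
    · exact (hC y τ h'.le h).trans (le_max_left _ _)
    · simp
  cont y τ h := by
    rcases lt_or_gt_of_ne h with h | h
    · refine (continuousAt_const (y := (0 : ℝ))).congr ?_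
      filter_upwards [eventually_lt_nhds h] with s hs using (if_neg hs.not_gt).symm
    · refine (hW.comp (f := fun s : ℝ => (y, s)) (by fun_prop)).continuousAt.congr ?_
      filter_upwards [eventually_gt_nhds h] with s hs using (if_pos hs).symm

/-- The kernel `W` need not vanish outside the light cone, but its time primitive starts at `τ =
|y|` and sees only the part inside. The price of the cut is a jump of the time derivative across the
cone. -/
theorem isCausalPrimitive_timePrimitive {W : ℝ → ℝ → ℝ} (hW : Continuous (Function.uncurry W)) :
    IsCausalPrimitive (timePrimitive W) (cutKernel W) where
  left := isCausal_of_continuous (continuous_timePrimitive hW) fun _ _ => timePrimitive_of_le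
  right := isCausal_cutKernel hW
  deriv y τ h := by
    have hy : Continuous (W y) := hW.comp (f := fun s : ℝ => (y, s)) (by fun_prop)
    rcases lt_or_gt_of_ne h with h | h
    · rw [cutKernel, if_neg h.not_gt]
      refine (hasDerivAt_const τ (0 : ℝ)).congr_of_eventuallyEq ?_
      filter_upwards [eventually_lt_nhds h] with s hs using timePrimitive_of_le hs.le
    · rw [cutKernel, if_pos h]
      refine (hy.integral_hasStrictDerivAt |y| τ).hasDerivAt.congr_of_eventuallyEq ?_
      filter_upwards [eventually_gt_nhds h] with s hs using timePrimitive_of_ge hs.le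
  lip R := by
    obtain ⟨C, hC⟩ := exists_bound_of_continuous hW R
    refine ⟨max C 0, fun y τ τ' h h' => ?_⟩
    have hi : ∀ a b, IntervalIntegrable (W y) volume a b := fun a b =>
      (hW.comp (f := fun s : ℝ => (y, s)) (by fun_prop)).intervalIntegrable a b
    have hd : |max |y| τ - max |y| τ'| ≤ |τ - τ'| := 
      (abs_max_sub_max_le_max _ _ _ _).trans (by simp)
    unfold timePrimitive
    rw [intervalIntegral.integral_interval_sub_left (hi _ _) (hi _ _)]
    have := intervalIntegral.norm_integral_le_of_norm_le_const (a := max |y| τ') (b := max |y| τ)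
      (f := W y) (C := max C 0) fun s hs => by
        rcases mem_uIoc.1 hs with hs | hs
        · refine le_max_of_le_left (hC y s ((le_max_left _ _).trans hs.1.le) ?_)
          rcases max_cases |y| τ with hm | hm
          · exact absurd (hs.1.trans_le (hs.2.trans hm.1.le)) (le_max_left _ _).not_gt
          · linarith [hs.2]
        · refine le_max_of_le_left (hC y s ((le_max_left _ _).trans hs.1.le) ?_)
          rcases max_cases |y| τ' with hm | hm
          · exact absurd (hs.1.trans_le (hs.2.trans hm.1.le)) (le_max_left _ _).not_gt
          · linarith [hs.2]
    exact this.trans (by gcongr)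

theorem IsWaveKernel.eq_char {p : ℝ → ℝ} (hp : IsLinePotential p) {cp cm : ℝ} {W : ℝ → ℝ → ℝ}
    (hW : IsWaveKernel p cp cm W) (x t : ℝ) :
    W x t = freeKernel p cp cm x t - 1 / 2 * (forwardChar p (timePrimitive W) (t - x, x) +
      backwardChar p (timePrimitive W) (t + x, x)) := by
  rw [hW.eq, duhamel, integral_eq_forwardChar_add_backwardChar hp
    (isCausalPrimitive_timePrimitive hW.cont).left]
  ring

/-- For `t ≤ |x|` the backward cone of `(x, t)` misses the open light cone of the origin, so the
Duhamel term vanishes. This yields the values on the characteristics in the Goursat problem. -/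
theorem IsWaveKernel.eq_freeKernel {p : ℝ → ℝ} {cp cm : ℝ} {W : ℝ → ℝ → ℝ}
    (hW : IsWaveKernel p cp cm W) {x t : ℝ} (h : t ≤ |x|) : W x t = freeKernel p cp cm x t := by
  rw [hW.eq, duhamel]
  have : ∀ y, timePrimitive W y (t - |x - y|) = 0 := fun y => timePrimitive_of_le (by
    have := abs_sub_abs_le_abs_sub x y
    linarith)
  simp [this]

/-! ### First derivatives of a wave kernel -/

/-- The region `|x| < t < 2π` of the plane. -/
def lightCone : Set (ℝ × ℝ) := {z | |z.1| < z.2 ∧ z.2 < 2 * π}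

theorem isOpen_lightCone : IsOpen lightCone :=
  (isOpen_lt (f := fun z : ℝ × ℝ => |z.1|) (by fun_prop) continuous_snd).inter
    (isOpen_lt (f := fun z : ℝ × ℝ => z.2) (by fun_prop) continuous_const)

/-- The time derivative of a wave kernel. -/
def kernelT (p : ℝ → ℝ) (cp cm : ℝ) (W : ℝ → ℝ → ℝ) (z : ℝ × ℝ) : ℝ :=
  -(1 / 4) * (cp * p ((z.2 + z.1) / 2) + cm * p (-(z.2 - z.1) / 2)) -
    1 / 2 * (forwardChar p (cutKernel W) (z.2 - z.1, z.1) +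
      backwardChar p (cutKernel W) (z.2 + z.1, z.1))

/-- The space derivative of a wave kernel. -/
def kernelX (p : ℝ → ℝ) (cp cm : ℝ) (W : ℝ → ℝ → ℝ) (z : ℝ × ℝ) : ℝ :=
  -(1 / 4) * (cp * p ((z.2 + z.1) / 2) - cm * p (-(z.2 - z.1) / 2)) -
    1 / 2 * (-forwardChar p (cutKernel W) (z.2 - z.1, z.1) +
      backwardChar p (cutKernel W) (z.2 + z.1, z.1))

theorem hasFDerivAt_linear (a b : ℝ) (z : ℝ × ℝ) :
    HasFDerivAt (fun w : ℝ × ℝ => a * w.1 + b * w.2) (gradCLM a b) z := by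
  have := (gradCLM a b).hasFDerivAt (x := z)
  exact this.congr_of_eventuallyEq (Eventually.of_forall fun w => (gradCLM_apply a b w).symm)

theorem hasFDerivAt_comp_linear {g : ℝ → ℝ} {g' a b : ℝ} {z : ℝ × ℝ}
    (hg : HasDerivAt g g' (a * z.1 + b * z.2)) :
    HasFDerivAt (fun w : ℝ × ℝ => g (a * w.1 + b * w.2)) (gradCLM (g' * a) (g' * b)) z := by
  refine (hg.comp_hasFDerivAt z (hasFDerivAt_linear a b z)).congr_fderiv ?_
  ext <;> simp

theorem lightCone_bounds {z : ℝ × ℝ} (hz : z ∈ lightCone) :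
    0 < (z.2 + z.1) / 2 ∧ (z.2 + z.1) / 2 < 2 * π ∧ -(2 * π) < -(z.2 - z.1) / 2 ∧
      -(z.2 - z.1) / 2 < 0 ∧ -(2 * π) < z.1 ∧ z.1 < 2 * π := by
  obtain ⟨h1, h2⟩ := hz
  have := abs_lt.1 h1
  exact ⟨by linarith, by linarith, by linarith, by linarith, by linarith, by linarith⟩

theorem IsLinePotential.contDiffAt_pos {p : ℝ → ℝ} (hp : IsLinePotential p) {x : ℝ} (h : 0 < x)
    (h' : x < 2 * π) : ContDiffAt ℝ 1 p x := hp.smooth x h.ne' (by rwa [abs_of_pos h])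

theorem IsLinePotential.contDiffAt_neg {p : ℝ → ℝ} (hp : IsLinePotential p) {x : ℝ} (h : x < 0)
    (h' : -(2 * π) < x) : ContDiffAt ℝ 1 p x :=
  hp.smooth x h.ne (by rw [abs_of_neg h]; linarith)

theorem hasDerivAt_primitive {p : ℝ → ℝ} (hp : Integrable p) {a x : ℝ} (h : ContinuousAt p x) :
    HasDerivAt (fun b => ∫ y in a..b, p y) (p x) x :=
  intervalIntegral.integral_hasDerivAt_right hp.intervalIntegrable
    hp.aestronglyMeasurable.stronglyMeasurableAtFilter h

theorem hasFDerivAt_freeKernel {p : ℝ → ℝ} (hp : IsLinePotential p) (cp cm : ℝ) {z : ℝ × ℝ}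
    (hz : z ∈ lightCone) :
    HasFDerivAt (fun z : ℝ × ℝ => freeKernel p cp cm z.1 z.2)
      (gradCLM (-(1 / 4) * (cp * p ((z.2 + z.1) / 2) - cm * p (-(z.2 - z.1) / 2)))
        (-(1 / 4) * (cp * p ((z.2 + z.1) / 2) + cm * p (-(z.2 - z.1) / 2)))) z := by
  obtain ⟨h1, h2, h3, h4, -, -⟩ := lightCone_bounds hz
  have e1 : (z.2 + z.1) / 2 = 1 / 2 * z.1 + 1 / 2 * z.2 := by ring
  have e2 : -(z.2 - z.1) / 2 = 1 / 2 * z.1 + (-(1 / 2)) * z.2 := by ring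
  have d1 := hasDerivAt_primitive hp.integrable (a := 0) (hp.contDiffAt_pos h1 h2).continuousAt
  have d2 := hasDerivAt_primitive hp.integrable (a := 0) (hp.contDiffAt_neg h4 h3).continuousAt
  rw [e1] at d1
  rw [e2] at d2
  have f1 := hasFDerivAt_comp_linear d1
  have f2 := hasFDerivAt_comp_linear d2
  have := ((f1.const_mul cp).sub (f2.const_mul cm)).const_mul (-(1 / 2))
  refine (this.congr_of_eventuallyEq (Eventually.of_forall fun w => ?_)).congr_fderiv ?_
  · simp only [freeKernel]
    rw [show (w.2 + w.1) / 2 = 1 / 2 * w.1 + 1 / 2 * w.2 by ring,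
      show -(w.2 - w.1) / 2 = 1 / 2 * w.1 + (-(1 / 2)) * w.2 by ring,
      intervalIntegral.integral_symm 0]
    simp only [Pi.sub_apply]
    ring
  · rw [← e1, ← e2]
    ext <;> simp <;> ring

section Kernel

variable {p : ℝ → ℝ} {cp cm : ℝ} {W : ℝ → ℝ → ℝ}

/-- Varying the endpoint `x` of the two characteristic integrals contributes `p(x)` times the time
primitive of `W` with opposite signs. These terms cancel, so `p(x)` itself does not enter the
gradient. -/
theorem IsWaveKernel.hasFDerivAt (hp : IsLinePotential p) (hW : IsWaveKernel p cp cm W) {z : ℝ × ℝ}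
    (hz : z ∈ lightCone) (h0 : z.1 ≠ 0) :
    HasFDerivAt (fun z : ℝ × ℝ => W z.1 z.2)
      (gradCLM (kernelX p cp cm W z) (kernelT p cp cm W z)) z := by
  obtain ⟨h1, h2, h3, h4, h5, h6⟩ := lightCone_bounds hz
  have hZ := isCausalPrimitive_timePrimitive hW.cont
  have hZc := continuous_timePrimitive hW.cont
  have hpc := hp.eventually_contDiffAt h0 (abs_lt.2 ⟨h5, h6⟩)
  have hF := hasFDerivAt_forwardChar hp.int hZ (z := (z.2 - z.1, z.1)) h5
    (Or.inl (show z.2 - z.1 ≠ 0 by linarith)) (by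
      have := continuousAt_snd (p := (z.2 - z.1, z.1)) |>.tendsto.eventually hpc
      filter_upwards [this] with w hw
      exact (ContinuousAt.comp (f := Prod.snd) hw.continuousAt continuousAt_snd).mul
        (hZc.comp (f := fun w : ℝ × ℝ => (w.2, w.1 + w.2)) (by fun_prop)).continuousAt)
  have hB := hasFDerivAt_backwardChar hp.int hZ (z := (z.2 + z.1, z.1)) h6
    (Or.inl (show z.2 + z.1 ≠ 0 by linarith)) (by
      have := continuousAt_snd (p := (z.2 + z.1, z.1)) |>.tendsto.eventually hpc
      filter_upwards [this] with w hw
      exact (ContinuousAt.comp (f := Prod.snd) hw.continuousAt continuousAt_snd).mul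
        (hZc.comp (f := fun w : ℝ × ℝ => (w.2, w.1 - w.2)) (by fun_prop)).continuousAt)
  have := (hasFDerivAt_freeKernel hp cp cm hz).sub
    (((hasFDerivAt_comp_forward hF).add (hasFDerivAt_comp_backward hB)).const_mul (1 / 2))
  refine (this.congr_of_eventuallyEq (Eventually.of_forall fun w => ?_)).congr_fderiv ?_
  · exact hW.eq_char hp w.1 w.2
  · unfold kernelX kernelT
    ext <;> simp <;> ring

theorem continuousAt_forwardChar_cut (hp : IsLinePotential p) (hW : Continuous (Function.uncurry W))
    {z : ℝ × ℝ} (h : z.1 < z.2) (h' : -(2 * π) < z.1) :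
    ContinuousAt (fun z : ℝ × ℝ => forwardChar p (cutKernel W) (z.2 - z.1, z.1)) z :=
  ContinuousAt.comp (g := forwardChar p (cutKernel W)) (f := fun z : ℝ × ℝ => (z.2 - z.1, z.1))
    (continuousAt_forwardChar hp.int (isCausal_cutKernel hW) h' (Or.inl (sub_pos.2 h).ne'))
    (by fun_prop)

theorem continuousAt_backwardChar_cut (hp : IsLinePotential p)
    (hW : Continuous (Function.uncurry W)) {z : ℝ × ℝ} (h : -z.2 < z.1) (h' : z.1 < 2 * π) :
    ContinuousAt (fun z : ℝ × ℝ => backwardChar p (cutKernel W) (z.2 + z.1, z.1)) z :=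
  ContinuousAt.comp (g := backwardChar p (cutKernel W)) (f := fun z : ℝ × ℝ => (z.2 + z.1, z.1))
    (continuousAt_backwardChar hp.int (isCausal_cutKernel hW) h'
      (Or.inl (show z.2 + z.1 ≠ 0 by linarith))) (by fun_prop)

/-- The axis `x = 0` is included although `p` may be singular there: `p` is evaluated only at `(t +
x) / 2 > 0` and `-(t - x) / 2 < 0`, and otherwise only integrated. -/
theorem continuousOn_kernelT (hp : IsLinePotential p) (hW : Continuous (Function.uncurry W)) :
    ContinuousOn (kernelT p cp cm W) lightCone := by
  intro z hz
  obtain ⟨h1, h2, h3, h4, h5, h6⟩ := lightCone_bounds hz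
  have hF := continuousAt_forwardChar_cut hp hW (z := z) (by linarith) h5
  have hB := continuousAt_backwardChar_cut hp hW (z := z) (by linarith) h6
  have c1 : ContinuousAt (fun z : ℝ × ℝ => p ((z.2 + z.1) / 2)) z :=
    ContinuousAt.comp (f := fun z : ℝ × ℝ => (z.2 + z.1) / 2)
      (hp.contDiffAt_pos h1 h2).continuousAt (by fun_prop)
  have c2 : ContinuousAt (fun z : ℝ × ℝ => p (-(z.2 - z.1) / 2)) z :=
    ContinuousAt.comp (f := fun z : ℝ × ℝ => -(z.2 - z.1) / 2)
      (hp.contDiffAt_neg h4 h3).continuousAt (by fun_prop)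
  exact ((((c1.const_mul cp).add (c2.const_mul cm)).const_mul _).sub
    ((hF.add hB).const_mul _)).continuousWithinAt

theorem continuousOn_kernelX (hp : IsLinePotential p) (hW : Continuous (Function.uncurry W)) :
    ContinuousOn (kernelX p cp cm W) lightCone := by
  intro z hz
  obtain ⟨h1, h2, h3, h4, h5, h6⟩ := lightCone_bounds hz
  have hF := continuousAt_forwardChar_cut hp hW (z := z) (by linarith) h5
  have hB := continuousAt_backwardChar_cut hp hW (z := z) (by linarith) h6
  have c1 : ContinuousAt (fun z : ℝ × ℝ => p ((z.2 + z.1) / 2)) z :=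
    ContinuousAt.comp (f := fun z : ℝ × ℝ => (z.2 + z.1) / 2)
      (hp.contDiffAt_pos h1 h2).continuousAt (by fun_prop)
  have c2 : ContinuousAt (fun z : ℝ × ℝ => p (-(z.2 - z.1) / 2)) z :=
    ContinuousAt.comp (f := fun z : ℝ × ℝ => -(z.2 - z.1) / 2)
      (hp.contDiffAt_neg h4 h3).continuousAt (by fun_prop)
  exact ((((c1.const_mul cp).sub (c2.const_mul cm)).const_mul _).sub
    ((hF.neg.add hB).const_mul _)).continuousWithinAt

end Kernel

/-! ### Differentiating the characteristic integrals of a wave kernel -/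

theorem exists_isLeibnizKernel {p : ℝ → ℝ} (hp : ∀ a b, IntervalIntegrable p volume a b)
    {K K' : ℝ → ℝ → ℝ} {ξ₀ ε a b : ℝ}
    (hK : ContinuousOn (Function.uncurry K) (Metric.closedBall ξ₀ ε ×ˢ Icc a b))
    (hK' : ContinuousOn (Function.uncurry K') (Metric.closedBall ξ₀ ε ×ˢ Icc a b))
    (hd : ∀ᵐ y, y ∈ Ioo a b → ∀ ξ ∈ Metric.ball ξ₀ ε, HasDerivAt (fun ξ => K ξ y) (K' ξ y) ξ) :
    ∃ C, IsLeibnizKernel p K K' (Metric.ball ξ₀ ε) a b C := by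
  have hc := (isCompact_closedBall ξ₀ ε).prod (isCompact_Icc (a := a) (b := b))
  obtain ⟨C₁, h₁⟩ := hc.exists_bound_of_continuousOn hK
  obtain ⟨C₂, h₂⟩ := hc.exists_bound_of_continuousOn hK'
  have hsub : ∀ ξ ∈ Metric.ball ξ₀ ε, ∀ y ∈ Ioo a b, (ξ, y) ∈ Metric.closedBall ξ₀ ε ×ˢ Icc a b :=
    fun ξ hξ y hy => ⟨Metric.ball_subset_closedBall hξ, Ioo_subset_Icc_self hy⟩
  refine ⟨max C₁ C₂, hp, Metric.isOpen_ball, ?_, ?_, ?_, ?_, ?_, ?_⟩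
  · exact fun ξ hξ => (hK.comp (f := fun y : ℝ => (ξ, y)) (by fun_prop)
      fun y hy => hsub ξ hξ y hy).aestronglyMeasurable measurableSet_Ioo
  · exact fun ξ hξ => (hK'.comp (f := fun y : ℝ => (ξ, y)) (by fun_prop)
      fun y hy => hsub ξ hξ y hy).aestronglyMeasurable measurableSet_Ioo
  · exact fun ξ hξ y hy => (h₁ _ (hsub ξ hξ y hy)).trans (le_max_left _ _)
  · exact fun ξ hξ y hy => (h₂ _ (hsub ξ hξ y hy)).trans (le_max_right _ _)
  · filter_upwards [hd] with y hd hy ξ hξ ξ' hξ'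
    exact (convex_ball ξ₀ ε).norm_image_sub_le_of_norm_hasDerivWithin_le (f := fun ξ => K ξ y)
      (f' := fun ξ => K' ξ y) (fun ζ hζ => (hd hy ζ hζ).hasDerivWithinAt)
      (fun ζ hζ => (h₂ _ (hsub ζ hζ y hy)).trans (le_max_right _ _)) hξ' hξ
  · intro ξ hξ
    filter_upwards [hd] with y hd hy
    refine ⟨hd hy ξ hξ, ?_⟩
    have : ContinuousOn (fun ξ => K' ξ y) (Metric.ball ξ₀ ε) :=
      hK'.comp (f := fun ξ : ℝ => (ξ, y)) (by fun_prop) fun ξ hξ => hsub ξ hξ y hy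
    exact this.continuousAt (Metric.isOpen_ball.mem_nhds hξ)

theorem IsLinePotential.continuousAt_deriv {p : ℝ → ℝ} (hp : IsLinePotential p) {x : ℝ} (h : x < 0)
    (h' : -(2 * π) < x) : ContinuousAt (deriv p) x := by
  have : ContDiffOn ℝ 1 p (Ioo (-(2 * π)) 0) := fun y hy =>
    (hp.contDiffAt_neg hy.2 hy.1).contDiffWithinAt
  exact (this.continuousOn_deriv_of_isOpen isOpen_Ioo le_rfl).continuousAt (Ioo_mem_nhds h' h)

section Kernel

variable {p : ℝ → ℝ} {cp cm : ℝ} {W : ℝ → ℝ → ℝ}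

theorem IsWaveKernel.hasDerivAt_comp (hp : IsLinePotential p) (hW : IsWaveKernel p cp cm W)
    {x t : ℝ → ℝ} {x' t' s : ℝ} (hx : HasDerivAt x x' s) (ht : HasDerivAt t t' s)
    (hz : (x s, t s) ∈ lightCone) (h0 : x s ≠ 0) :
    HasDerivAt (fun s => W (x s) (t s))
      (kernelX p cp cm W (x s, t s) * x' + kernelT p cp cm W (x s, t s) * t') s := by
  have h := hW.hasFDerivAt hp hz h0
  have := HasFDerivAt.comp_hasDerivAt (f := fun s => (x s, t s)) s h (hx.prodMk ht)
  simpa using! this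

/-- The derivative in `ξ` of `W (r - ξ / 2) (r + ξ / 2)`. -/
theorem half_kernelT_sub_kernelX (ξ r : ℝ) :
    kernelX p cp cm W (r - ξ / 2, r + ξ / 2) * (-(1 / 2)) +
      kernelT p cp cm W (r - ξ / 2, r + ξ / 2) * (1 / 2) =
      -(1 / 4) * cm * p (-ξ / 2) - 1 / 2 * forwardChar p (cutKernel W) (ξ, r - ξ / 2) := by
  unfold kernelX kernelT
  simp only
  rw [show r + ξ / 2 - (r - ξ / 2) = ξ by ring]
  ring

/-- This is the piece of the characteristic next to the cone, in the variable `r = y + ξ / 2`, which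
fixes the endpoint on the cone at `r = 0`. The parameter now moves the point in the direction
`(-1/2, 1/2)`, along which the term `p((t + x) / 2) = p(r)`, possibly unbounded as `r → 0`, and the
backward integral both drop out of the derivative of `W`. The weight `p(r - ξ / 2)` is
differentiated too, which is allowed because its argument stays inside `(-2π, 0)`. -/
theorem exists_isLeibnizKernel_near (hp : IsLinePotential p) (hW : IsWaveKernel p cp cm W)
    {ξ₀ ε b : ℝ} (hε : ε < ξ₀) (h1 : b < (ξ₀ - ε) / 2) (h2 : (ξ₀ + ε) / 2 + b < 2 * π)
    (h3 : (ξ₀ + ε) / 2 < 2 * π) :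
    ∃ K' C, IsLeibnizKernel (fun _ => 1) (fun ξ r => p (r - ξ / 2) * W (r - ξ / 2) (r + ξ / 2)) K'
      (Metric.ball ξ₀ ε) 0 b C := by
  refine ⟨fun ξ r => (deriv p (r - ξ / 2) * (-(1 / 2))) * W (r - ξ / 2) (r + ξ / 2) +
    p (r - ξ / 2) * (-(1 / 4) * cm * p (-ξ / 2) -
      1 / 2 * forwardChar p (cutKernel W) (ξ, r - ξ / 2)),
    exists_isLeibnizKernel (fun _ _ => intervalIntegrable_const) ?_ ?_ ?_⟩
  · rintro ⟨ξ, r⟩ ⟨hξ, hr⟩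
    rw [Real.closedBall_eq_Icc] at hξ
    have := hξ.1; have := hξ.2; have := hr.1; have := hr.2
    simp only at *
    have c1 : ContinuousAt (fun z : ℝ × ℝ => p (z.2 - z.1 / 2)) (ξ, r) :=
      ContinuousAt.comp (g := p) (f := fun z : ℝ × ℝ => z.2 - z.1 / 2)
        (hp.contDiffAt_neg (by simp only; linarith) (by simp only; linarith)).continuousAt
        (by fun_prop)
    have c2 : Continuous (fun z : ℝ × ℝ => W (z.2 - z.1 / 2) (z.2 + z.1 / 2)) :=
      hW.cont.comp (f := fun z : ℝ × ℝ => (z.2 - z.1 / 2, z.2 + z.1 / 2)) (by fun_prop)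
    exact (c1.mul c2.continuousAt).continuousWithinAt
  · rintro ⟨ξ, r⟩ ⟨hξ, hr⟩
    rw [Real.closedBall_eq_Icc] at hξ
    have := hξ.1; have := hξ.2; have := hr.1; have := hr.2
    simp only at *
    have c1 : ContinuousAt (fun z : ℝ × ℝ => p (z.2 - z.1 / 2)) (ξ, r) :=
      ContinuousAt.comp (g := p) (f := fun z : ℝ × ℝ => z.2 - z.1 / 2)
        (hp.contDiffAt_neg (by simp only; linarith) (by simp only; linarith)).continuousAt
        (by fun_prop)
    have c1' : ContinuousAt (fun z : ℝ × ℝ => deriv p (z.2 - z.1 / 2)) (ξ, r) :=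
      ContinuousAt.comp (g := deriv p) (f := fun z : ℝ × ℝ => z.2 - z.1 / 2)
        (hp.continuousAt_deriv (by simp only; linarith) (by simp only; linarith))
        (by fun_prop)
    have c1'' : ContinuousAt (fun z : ℝ × ℝ => p (-z.1 / 2)) (ξ, r) :=
      ContinuousAt.comp (g := p) (f := fun z : ℝ × ℝ => -z.1 / 2)
        (hp.contDiffAt_neg (by simp only; linarith) (by simp only; linarith)).continuousAt
        (by fun_prop)
    have c2 : Continuous (fun z : ℝ × ℝ => W (z.2 - z.1 / 2) (z.2 + z.1 / 2)) :=
      hW.cont.comp (f := fun z : ℝ × ℝ => (z.2 - z.1 / 2, z.2 + z.1 / 2)) (by fun_prop)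
    have c3 : ContinuousAt
        (fun z : ℝ × ℝ => forwardChar p (cutKernel W) (z.1, z.2 - z.1 / 2)) (ξ, r) :=
      ContinuousAt.comp (g := forwardChar p (cutKernel W))
        (f := fun z : ℝ × ℝ => (z.1, z.2 - z.1 / 2))
        (continuousAt_forwardChar hp.int (isCausal_cutKernel hW.cont)
          (by simp only; linarith) (Or.inl (by simp only; linarith))) (by fun_prop)
    exact (((c1'.mul_const _).mul c2.continuousAt).add
      (c1.mul ((c1''.const_mul _).sub (c3.const_mul _)))).continuousWithinAt
  · refine Eventually.of_forall fun r hr ξ hξ => ?_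
    rw [Real.ball_eq_Ioo] at hξ
    have := hξ.1; have := hξ.2; have := hr.1; have := hr.2
    have hx : HasDerivAt (fun ξ : ℝ => r - ξ / 2) (-(1 / 2)) ξ := by
      simpa using ((hasDerivAt_id ξ).div_const 2).const_sub r
    have ht : HasDerivAt (fun ξ : ℝ => r + ξ / 2) (1 / 2) ξ := by
      simpa using ((hasDerivAt_id ξ).div_const 2).const_add r
    have hneg : r - ξ / 2 < 0 := by linarith
    have dW := hW.hasDerivAt_comp hp hx ht
      ⟨by simp only [abs_of_neg hneg]; linarith, by simp only; linarith⟩ hneg.ne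
    rw [half_kernelT_sub_kernelX] at dW
    have dp : HasDerivAt p (deriv p (r - ξ / 2)) (r - ξ / 2) :=
      ((hp.contDiffAt_neg hneg (by linarith)).differentiableAt (by simp)).hasDerivAt
    exact (HasDerivAt.comp ξ dp hx).mul dW

/-- This is the piece away from the cone. It may cross `y = 0`, where `p` is only integrable, but
here `ξ` enters through the time of `W` alone and `p` need not be differentiated. -/
theorem exists_isLeibnizKernel_far (hp : IsLinePotential p) (hW : IsWaveKernel p cp cm W)
    {ξ₀ ε a b : ℝ} (hε : ε < ξ₀) (h1 : 0 < ξ₀ - ε + 2 * a) (h2 : ξ₀ + ε + b < 2 * π) :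
    ∃ K' C, IsLeibnizKernel p (fun ξ y => W y (ξ + y)) K' (Metric.ball ξ₀ ε) a b C := by
  have hmem : ∀ ξ ∈ Metric.closedBall ξ₀ ε, ∀ y ∈ Icc a b, (y, ξ + y) ∈ lightCone := by
    intro ξ hξ y hy
    rw [Real.closedBall_eq_Icc] at hξ
    have := hξ.1; have := hξ.2; have := hy.1; have := hy.2
    exact ⟨abs_lt.2 ⟨by simp only; linarith, by simp only; linarith⟩, by simp only; linarith⟩
  refine ⟨fun ξ y => kernelT p cp cm W (y, ξ + y), exists_isLeibnizKernel hp.int ?_ ?_ ?_⟩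
  · exact (hW.cont.comp (f := fun z : ℝ × ℝ => (z.2, z.1 + z.2)) (by fun_prop)).continuousOn
  · exact (continuousOn_kernelT hp hW.cont).comp (f := fun z : ℝ × ℝ => (z.2, z.1 + z.2))
      (by fun_prop) fun z hz => hmem z.1 hz.1 z.2 hz.2
  · have : ∀ᵐ y : ℝ, y ≠ 0 := by simp [ae_iff]
    filter_upwards [this] with y hy0 hy ξ hξ
    have := hW.hasDerivAt_comp hp (hasDerivAt_const ξ y) ((hasDerivAt_id ξ).add_const y)
      (hmem ξ (Metric.ball_subset_closedBall hξ) y (Ioo_subset_Icc_self hy)) hy0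
    simpa using this

theorem intervalIntegrable_char (hp : IsLinePotential p) {k : ℝ → ℝ → ℝ} (hk : IsCausal k)
    (ξ : ℝ) (a b : ℝ) : IntervalIntegrable (fun y => p y * k y (ξ + y)) volume a b := by
  obtain ⟨C, hC⟩ := hk.bdd (ξ + max a b)
  refine ((hp.int a b).abs.mul_const C).mono_fun
    ((hp.int a b).def'.aestronglyMeasurable.mul (hk.measurable_char ξ).aestronglyMeasurable) ?_
  refine (ae_restrict_iff' measurableSet_uIoc).2 (Eventually.of_forall fun y hy => ?_)
  have := hC y (ξ + y) (by linarith [hy.2])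
  simp only [norm_mul, Real.norm_eq_abs, abs_abs]
  exact mul_le_mul_of_nonneg_left (this.trans (le_abs_self C)) (abs_nonneg _)

theorem forwardChar_cut_eq (hp : IsLinePotential p) (hW : Continuous (Function.uncurry W))
    {ξ x a : ℝ} (h1 : -ξ / 2 ≤ a) (ha : a ≤ 0) (hax : a ≤ x) (hξ0 : 0 < ξ)
    (hξ : ξ / 2 ≤ 2 * π) :
    forwardChar p (cutKernel W) (ξ, x) =
      (∫ r in (0 : ℝ)..a + ξ / 2, 1 * (p (r - ξ / 2) * W (r - ξ / 2) (r + ξ / 2))) +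
        ∫ y in a..x, p y * W y (ξ + y) := by
  have hi := intervalIntegrable_char hp (isCausal_cutKernel hW) ξ
  have hsplit : forwardChar p (cutKernel W) (ξ, x) =
      -- The characteristic enters the light cone at `y = -ξ / 2`; the first piece vanishes by the
      -- cut, and on the other two the cut has no effect.
      ((∫ y in (-(2 * π))..(-ξ / 2), p y * cutKernel W y (ξ + y)) +
        ∫ y in (-ξ / 2)..a, p y * cutKernel W y (ξ + y)) +
        ∫ y in a..x, p y * cutKernel W y (ξ + y) := by
    rw [intervalIntegral.integral_add_adjacent_intervals (hi _ _) (hi _ _),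
      intervalIntegral.integral_add_adjacent_intervals (hi _ _) (hi _ _)]
    rfl
  have e0 : ∫ y in (-(2 * π))..(-ξ / 2), p y * cutKernel W y (ξ + y) = 0 := by
    rw [intervalIntegral.integral_congr_ae (g := fun _ => 0)]
    · simp
    · refine Eventually.of_forall fun y hy => ?_
      rw [uIoc_of_le (by linarith)] at hy
      rw [cutKernel, if_neg, mul_zero]
      have := neg_le_abs y
      linarith [hy.2]
  have e1 : ∫ y in (-ξ / 2)..a, p y * cutKernel W y (ξ + y) =
      ∫ y in (-ξ / 2)..a, p y * W y (ξ + y) := by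
    refine intervalIntegral.integral_congr_ae (Eventually.of_forall fun y hy => ?_)
    rw [uIoc_of_le h1] at hy
    rw [cutKernel, if_pos]
    rw [abs_of_nonpos (hy.2.trans ha)]
    linarith [hy.1]
  have e2 : ∫ y in a..x, p y * cutKernel W y (ξ + y) = ∫ y in a..x, p y * W y (ξ + y) := by
    refine intervalIntegral.integral_congr_ae (Eventually.of_forall fun y hy => ?_)
    rw [uIoc_of_le hax] at hy
    rw [cutKernel, if_pos]
    rw [abs_lt]
    constructor <;> linarith [hy.1]
  rw [hsplit, e0, e1, e2, zero_add]
  congr 1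
  have := intervalIntegral.integral_comp_sub_right (a := 0) (b := a + ξ / 2)
    (fun y => p y * W y (ξ + y)) (ξ / 2)
  rw [zero_sub, add_sub_cancel_right, ← neg_div] at this
  rw [← this]
  refine intervalIntegral.integral_congr fun r _ => ?_
  simp only [one_mul]
  rw [show ξ + (r - ξ / 2) = r + ξ / 2 by ring]

/-- Regularity of the integral of a wave kernel along a characteristic. -/
theorem contDiffAt_forwardChar_cut (hp : IsLinePotential p) (hW : IsWaveKernel p cp cm W)
    {ξ₀ x₀ : ℝ} (h1 : -ξ₀ / 2 < x₀) (h2 : ξ₀ + x₀ < 2 * π) (h0 : x₀ ≠ 0) (hξ : 0 < ξ₀) :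
    ContDiffAt ℝ 1 (forwardChar p (cutKernel W)) (ξ₀, x₀) := by
  -- The splitting point lies inside the cone and left of the origin, so that `p` is `C¹` on the
  -- near piece and the far piece keeps a distance from the cone.
  obtain ⟨a, ha1, ha2⟩ : ∃ a, -ξ₀ / 2 < a ∧ a < min 0 x₀ :=
    exists_between (lt_min (by linarith) h1)
  obtain ⟨ha0, hax⟩ := lt_min_iff.1 ha2
  -- One `ε` small against all five margins: positivity of `ξ`, the near piece staying left of the
  -- origin, its arguments above `-2π`, times below `2π`, and distance of the far piece from the
  -- cone.
  obtain ⟨ε, hε, h4⟩ : ∃ ε > 0, 4 * ε <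
      min (min ξ₀ (-a)) (min (min (2 * π - ξ₀ / 2) (2 * π - ξ₀ - x₀)) (ξ₀ + 2 * a)) := by
    have : 0 < min (min ξ₀ (-a)) (min (min (2 * π - ξ₀ / 2) (2 * π - ξ₀ - x₀)) (ξ₀ + 2 * a)) := by
      simp only [lt_min_iff]
      exact ⟨⟨hξ, by linarith⟩, ⟨by linarith, by linarith⟩, by linarith⟩
    exact ⟨_, div_pos this (by norm_num : (0 : ℝ) < 8), by linarith⟩
  simp only [lt_min_iff] at h4
  obtain ⟨⟨e1, e2⟩, ⟨e3, e4⟩, e5⟩ := h4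
  obtain ⟨K₁, C₁, hL₁⟩ := exists_isLeibnizKernel_near hp hW (ξ₀ := ξ₀) (ε := ε)
    (b := a + ξ₀ / 2 + ε) (by linarith) (by linarith) (by linarith) (by linarith)
  obtain ⟨K₂, C₂, hL₂⟩ := exists_isLeibnizKernel_far hp hW (ξ₀ := ξ₀) (ε := ε) (a := a)
    (b := x₀ + ε) (by linarith) (by linarith) (by linarith)
  have c1 := hL₁.contDiffAt (z := (ξ₀, a + ξ₀ / 2)) (Metric.mem_ball_self hε)
    ⟨by simp only; linarith, by simp only; linarith⟩ (by
      have hc : ContinuousAt (fun w : ℝ × ℝ => w.2 - w.1 / 2) (ξ₀, a + ξ₀ / 2) := by fun_prop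
      have hpe := hp.eventually_contDiffAt ha0.ne (abs_lt.2 ⟨by linarith, by linarith⟩)
      have hc' : Tendsto (fun w : ℝ × ℝ => w.2 - w.1 / 2) (𝓝 (ξ₀, a + ξ₀ / 2)) (𝓝 a) := by
        simpa [ContinuousAt] using hc
      filter_upwards [hc'.eventually hpe] with w hw
      have c3 : ContinuousAt (fun w : ℝ × ℝ => p (w.2 - w.1 / 2)) w :=
        ContinuousAt.comp (g := p) (f := fun w : ℝ × ℝ => w.2 - w.1 / 2) hw.continuousAt
          (by fun_prop)
      have c4 : Continuous (fun z : ℝ × ℝ => W (z.2 - z.1 / 2) (z.2 + z.1 / 2)) :=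
        hW.cont.comp (f := fun z : ℝ × ℝ => (z.2 - z.1 / 2, z.2 + z.1 / 2)) (by fun_prop)
      exact continuousAt_const.mul (c3.mul c4.continuousAt))
  have c2 := hL₂.contDiffAt (z := (ξ₀, x₀)) (Metric.mem_ball_self hε)
    ⟨hax, by simp only; linarith⟩ (by
      have hpe := hp.eventually_contDiffAt h0 (abs_lt.2 ⟨by linarith, by linarith⟩)
      have hc' : Tendsto (fun w : ℝ × ℝ => w.2) (𝓝 (ξ₀, x₀)) (𝓝 x₀) := continuousAt_snd
      filter_upwards [hc'.eventually hpe] with w hw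
      have c3 : ContinuousAt (fun w : ℝ × ℝ => p w.2) w :=
        ContinuousAt.comp (g := p) (f := fun w : ℝ × ℝ => w.2) hw.continuousAt (by fun_prop)
      have c4 : Continuous (fun z : ℝ × ℝ => W z.2 (z.1 + z.2)) :=
        hW.cont.comp (f := fun z : ℝ × ℝ => (z.2, z.1 + z.2)) (by fun_prop)
      exact c3.mul c4.continuousAt)
  have c1' : ContDiffAt ℝ 1 (fun z : ℝ × ℝ => ∫ r in (0 : ℝ)..a + z.1 / 2,
      1 * (p (r - z.1 / 2) * W (r - z.1 / 2) (r + z.1 / 2))) (ξ₀, x₀) :=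
    ContDiffAt.comp (ξ₀, x₀) (f := fun z : ℝ × ℝ => (z.1, a + z.1 / 2)) c1 (by fun_prop)
  refine (c1'.add c2).congr_of_eventuallyEq ?_
  have hnear : ∀ᶠ z : ℝ × ℝ in 𝓝 (ξ₀, x₀), z.1 ∈ Metric.ball ξ₀ ε ∧ z.2 ∈ Ioo a (x₀ + ε) :=
    (continuousAt_fst.eventually_mem (Metric.ball_mem_nhds _ hε)).and
      (continuousAt_snd.eventually_mem (Ioo_mem_nhds hax (by simp only; linarith)))
  filter_upwards [hnear] with z hz
  have hz1 := hz.1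
  rw [Real.ball_eq_Ioo] at hz1
  have := hz1.1; have := hz1.2
  exact forwardChar_cut_eq hp hW.cont (by linarith) ha0.le hz.2.1.le (by linarith) (by linarith)

theorem contDiffAt_backwardChar_cut (hp : IsLinePotential p) (hW : IsWaveKernel p cp cm W)
    {η₀ x₀ : ℝ} (h1 : x₀ < η₀ / 2) (h2 : η₀ - x₀ < 2 * π) (h0 : x₀ ≠ 0) (hη : 0 < η₀) :
    ContDiffAt ℝ 1 (backwardChar p (cutKernel W)) (η₀, x₀) := by
  have := contDiffAt_forwardChar_cut hp.reflect hW.reflect (ξ₀ := η₀) (x₀ := -x₀) (by linarith)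
    (by linarith) (by simpa using h0) hη
  have hcut : cutKernel (fun x => W (-x)) = fun y => cutKernel W (-y) := by
    ext y τ
    simp [cutKernel]
  rw [hcut] at this
  have h3 : backwardChar p (cutKernel W) =
      forwardChar (fun y => p (-y)) (fun y => cutKernel W (-y)) ∘
        fun z : ℝ × ℝ => (z.1, -z.2) := by
    ext z
    exact backwardChar_eq _ _ z
  rw [h3]
  exact ContDiffAt.comp (η₀, x₀) this (by fun_prop)

end Kernel

/-! ### Second derivatives of a wave kernel and the wave equation -/

section Kernel

variable {p : ℝ → ℝ} {cp cm : ℝ} {W : ℝ → ℝ → ℝ}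

theorem contDiffAt_comp_forward {G : ℝ × ℝ → ℝ} {n : WithTop ℕ∞} {z : ℝ × ℝ}
    (h : ContDiffAt ℝ n G (z.2 - z.1, z.1)) :
    ContDiffAt ℝ n (fun z : ℝ × ℝ => G (z.2 - z.1, z.1)) z :=
  ContDiffAt.comp z (f := fun z : ℝ × ℝ => (z.2 - z.1, z.1)) h (by fun_prop)

theorem contDiffAt_comp_backward {G : ℝ × ℝ → ℝ} {n : WithTop ℕ∞} {z : ℝ × ℝ}
    (h : ContDiffAt ℝ n G (z.2 + z.1, z.1)) :
    ContDiffAt ℝ n (fun z : ℝ × ℝ => G (z.2 + z.1, z.1)) z :=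
  ContDiffAt.comp z (f := fun z : ℝ × ℝ => (z.2 + z.1, z.1)) h (by fun_prop)

theorem IsWaveKernel.contDiffAt_forward (hp : IsLinePotential p) (hW : IsWaveKernel p cp cm W)
    {z : ℝ × ℝ} (hz : z ∈ lightCone) (h0 : z.1 ≠ 0) :
    ContDiffAt ℝ 1 (forwardChar p (cutKernel W)) (z.2 - z.1, z.1) := by
  obtain ⟨h1, h2⟩ := hz
  have := abs_lt.1 h1
  exact contDiffAt_forwardChar_cut hp hW (by linarith) (by linarith) h0 (by linarith)

theorem IsWaveKernel.contDiffAt_backward (hp : IsLinePotential p) (hW : IsWaveKernel p cp cm W)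
    {z : ℝ × ℝ} (hz : z ∈ lightCone) (h0 : z.1 ≠ 0) :
    ContDiffAt ℝ 1 (backwardChar p (cutKernel W)) (z.2 + z.1, z.1) := by
  obtain ⟨h1, h2⟩ := hz
  have := abs_lt.1 h1
  exact contDiffAt_backwardChar_cut hp hW (by linarith) (by linarith) h0 (by linarith)

theorem contDiffAt_kernel (hp : IsLinePotential p) (hW : IsWaveKernel p cp cm W)
    {z : ℝ × ℝ} (hz : z ∈ lightCone) (h0 : z.1 ≠ 0) :
    ContDiffAt ℝ 1 (kernelX p cp cm W) z ∧ ContDiffAt ℝ 1 (kernelT p cp cm W) z := by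
  obtain ⟨h1, h2, h3, h4, h5, h6⟩ := lightCone_bounds hz
  have hF := contDiffAt_comp_forward (hW.contDiffAt_forward hp hz h0)
  have hB := contDiffAt_comp_backward (hW.contDiffAt_backward hp hz h0)
  have c1 : ContDiffAt ℝ 1 (fun z : ℝ × ℝ => p ((z.2 + z.1) / 2)) z :=
    ContDiffAt.comp z (f := fun z : ℝ × ℝ => (z.2 + z.1) / 2)
      (hp.contDiffAt_pos h1 h2) (by fun_prop)
  have c2 : ContDiffAt ℝ 1 (fun z : ℝ × ℝ => p (-(z.2 - z.1) / 2)) z :=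
    ContDiffAt.comp z (f := fun z : ℝ × ℝ => -(z.2 - z.1) / 2)
      (hp.contDiffAt_neg h4 h3) (by fun_prop)
  exact ⟨(contDiffAt_const.mul ((contDiffAt_const.mul c1).sub (contDiffAt_const.mul c2))).sub
      (contDiffAt_const.mul (hF.neg.add hB)),
    (contDiffAt_const.mul ((contDiffAt_const.mul c1).add (contDiffAt_const.mul c2))).sub
      (contDiffAt_const.mul (hF.add hB))⟩

theorem IsWaveKernel.contDiffOn (hp : IsLinePotential p) (hW : IsWaveKernel p cp cm W) :
    ContDiffOn ℝ 2 (fun z : ℝ × ℝ => W z.1 z.2) (lightCone ∩ {z | z.1 ≠ 0}) :=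
  contDiffOn_two_of_hasFDerivAt
    (isOpen_lightCone.inter (isOpen_ne.preimage continuous_fst))
    (fun _ hz => hW.hasFDerivAt hp hz.1 hz.2)
    (fun _ hz => (contDiffAt_kernel hp hW hz.1 hz.2).1.contDiffWithinAt)
    (fun _ hz => (contDiffAt_kernel hp hW hz.1 hz.2).2.contDiffWithinAt)

theorem hasDerivAt_fst_of_hasFDerivAt {G : ℝ × ℝ → ℝ} {a b x t : ℝ}
    (h : HasFDerivAt G (gradCLM a b) (x, t)) : HasDerivAt (fun y => G (y, t)) a x := by
  simpa using! HasFDerivAt.comp_hasDerivAt (f := fun y => (y, t)) x h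
    ((hasDerivAt_id x).prodMk (hasDerivAt_const x t))

theorem hasDerivAt_snd_of_hasFDerivAt {G : ℝ × ℝ → ℝ} {a b x t : ℝ}
    (h : HasFDerivAt G (gradCLM a b) (x, t)) : HasDerivAt (fun s => G (x, s)) b t := by
  simpa using! HasFDerivAt.comp_hasDerivAt (f := fun s => (x, s)) t h
    ((hasDerivAt_const t x).prodMk (hasDerivAt_id t))

theorem exists_hasFDerivAt_gradCLM {G : ℝ × ℝ → ℝ} {z : ℝ × ℝ} (h : DifferentiableAt ℝ G z) :
    ∃ a b, HasFDerivAt G (gradCLM a b) z := by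
  refine ⟨fderiv ℝ G z (1, 0), fderiv ℝ G z (0, 1), h.hasFDerivAt.congr_fderiv ?_⟩
  ext <;> simp

theorem hasDerivAt_forwardChar_cut (hp : IsLinePotential p) (hW : Continuous (Function.uncurry W))
    {ξ x : ℝ} (h1 : -ξ / 2 < x) (h2 : |x| < 2 * π) (h0 : x ≠ 0) (hξ : 0 < ξ) :
    HasDerivAt (fun x => forwardChar p (cutKernel W) (ξ, x)) (p x * W x (ξ + x)) x := by
  have hpos : ∀ y, -ξ / 2 < y → |y| < ξ + y := fun y hy => by
    rw [abs_lt]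
    constructor <;> linarith
  have hc : ContinuousAt (fun y => p y * W y (ξ + y)) x :=
    (hp.smooth x h0 h2).continuousAt.mul
      (hW.comp (f := fun y : ℝ => (y, ξ + y)) (by fun_prop)).continuousAt
  have hev : (fun y => p y * W y (ξ + y)) =ᶠ[𝓝 x] fun y => p y * cutKernel W y (ξ + y) := by
    filter_upwards [eventually_gt_nhds h1] with y hy
    rw [cutKernel, if_pos (hpos y hy)]
  have := intervalIntegral.integral_hasDerivAt_right
    (intervalIntegrable_char hp (isCausal_cutKernel hW) ξ (-(2 * π)) x)
    ((hp.integrable.aestronglyMeasurable.mul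
      ((isCausal_cutKernel hW).measurable_char ξ).aestronglyMeasurable).stronglyMeasurableAtFilter)
    (hc.congr hev)
  rw [show cutKernel W x (ξ + x) = W x (ξ + x) from if_pos (hpos x h1)] at this
  exact this

theorem hasDerivAt_backwardChar_cut (hp : IsLinePotential p) (hW : Continuous (Function.uncurry W))
    {η x : ℝ} (h1 : x < η / 2) (h2 : |x| < 2 * π) (h0 : x ≠ 0) (hη : 0 < η) :
    HasDerivAt (fun x => backwardChar p (cutKernel W) (η, x)) (-(p x * W x (η - x))) x := by
  have hW' : Continuous (Function.uncurry fun x => W (-x)) :=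
    hW.comp (f := fun z : ℝ × ℝ => (-z.1, z.2)) (by fun_prop)
  have := hasDerivAt_forwardChar_cut hp.reflect hW' (ξ := η) (x := -x) (by linarith)
    (by simpa using h2) (by simpa using h0) hη
  have hcut : cutKernel (fun x => W (-x)) = fun y => cutKernel W (-y) := by
    ext y τ
    simp [cutKernel]
  rw [hcut] at this
  have h3 := HasDerivAt.comp x this (hasDerivAt_neg x)
  simp only [neg_neg, mul_neg, mul_one, ← sub_eq_add_neg] at h3
  exact h3.congr_of_eventuallyEq (Eventually.of_forall fun y => backwardChar_eq _ _ _)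

/-- Wave kernels satisfy the wave equation. -/
theorem IsWaveKernel.wave (hp : IsLinePotential p) (hW : IsWaveKernel p cp cm W) {x t : ℝ}
    (hz : (x, t) ∈ lightCone) (h0 : x ≠ 0) :
    deriv (deriv (W x)) t + schrodinger p (fun y => W y t) x = 0 := by
  obtain ⟨h1, h2, h3, h4, h5, h6⟩ := lightCone_bounds hz
  simp only at h1 h2 h3 h4 h5 h6
  obtain ⟨a₁, b₁, hF⟩ := exists_hasFDerivAt_gradCLM
    ((hW.contDiffAt_forward hp hz h0).differentiableAt (by simp))
  obtain ⟨a₂, b₂, hB⟩ := exists_hasFDerivAt_gradCLM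
    ((hW.contDiffAt_backward hp hz h0).differentiableAt (by simp))
  -- Only the partials in the endpoint `x` have to be identified; those in `ξ = t - x` and `η = t +
  -- x` cancel between `W_tt` and `W_xx`.
  have eb₁ : b₁ = p x * W x t := by
    have := hasDerivAt_forwardChar_cut hp hW.cont (ξ := t - x) (x := x) (by linarith)
      (abs_lt.2 ⟨h5, h6⟩) h0 (by linarith)
    rw [sub_add_cancel] at this
    exact (hasDerivAt_snd_of_hasFDerivAt hF).unique this
  have eb₂ : b₂ = -(p x * W x t) := by
    have := hasDerivAt_backwardChar_cut hp hW.cont (η := t + x) (x := x) (by linarith)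
      (abs_lt.2 ⟨h5, h6⟩) h0 (by linarith)
    rw [add_sub_cancel_right] at this
    exact (hasDerivAt_snd_of_hasFDerivAt hB).unique this
  have hF' := hasFDerivAt_comp_forward (z := (x, t)) hF
  have hB' := hasFDerivAt_comp_backward (z := (x, t)) hB
  have d1 := ((hp.contDiffAt_pos h1 h2).differentiableAt (by simp)).hasDerivAt
  have d2 := ((hp.contDiffAt_neg h4 h3).differentiableAt (by simp)).hasDerivAt
  have p1t : HasDerivAt (fun s => p ((s + x) / 2)) (deriv p ((t + x) / 2) * (1 / 2)) t :=
    HasDerivAt.comp t (h := fun s => (s + x) / 2) d1 (((hasDerivAt_id t).add_const x).div_const 2)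
  have p2t : HasDerivAt (fun s => p (-(s - x) / 2)) (deriv p (-(t - x) / 2) * (-1 / 2)) t :=
    HasDerivAt.comp t (h := fun s => -(s - x) / 2) d2
      (((hasDerivAt_id t).sub_const x).neg.div_const 2)
  have p1x : HasDerivAt (fun y => p ((t + y) / 2)) (deriv p ((t + x) / 2) * (1 / 2)) x :=
    HasDerivAt.comp x (h := fun y => (t + y) / 2) d1 (((hasDerivAt_id x).const_add t).div_const 2)
  have p2x : HasDerivAt (fun y => p (-(t - y) / 2)) (deriv p (-(t - x) / 2) * (- -1 / 2)) x :=
    HasDerivAt.comp x (h := fun y => -(t - y) / 2) d2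
      (((hasDerivAt_id x).const_sub t).neg.div_const 2)
  have ht := (((p1t.const_mul cp).add (p2t.const_mul cm)).const_mul (-(1 / 4))).sub
    (((hasDerivAt_snd_of_hasFDerivAt hF').add (hasDerivAt_snd_of_hasFDerivAt hB')).const_mul
      (1 / 2))
  have hx := (((p1x.const_mul cp).sub (p2x.const_mul cm)).const_mul (-(1 / 4))).sub
    (((hasDerivAt_fst_of_hasFDerivAt hF').neg.add (hasDerivAt_fst_of_hasFDerivAt hB')).const_mul
      (1 / 2))
  have hnear : ∀ᶠ w in 𝓝 (x, t), w ∈ lightCone ∧ w.1 ≠ 0 :=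
    (isOpen_lightCone.inter (isOpen_ne.preimage continuous_fst)).mem_nhds ⟨hz, h0⟩
  have et : deriv (W x) =ᶠ[𝓝 t] fun s => kernelT p cp cm W (x, s) := by
    have hc : Tendsto (fun s : ℝ => (x, s)) (𝓝 t) (𝓝 (x, t)) :=
      (by fun_prop : Continuous fun s : ℝ => (x, s)).tendsto t
    filter_upwards [hc.eventually hnear] with s hs
    exact (hasDerivAt_snd_of_hasFDerivAt (hW.hasFDerivAt hp hs.1 hs.2)).deriv
  have ex : deriv (fun y => W y t) =ᶠ[𝓝 x] fun y => kernelX p cp cm W (y, t) := by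
    have hc : Tendsto (fun y : ℝ => (y, t)) (𝓝 x) (𝓝 (x, t)) :=
      (by fun_prop : Continuous fun y : ℝ => (y, t)).tendsto x
    filter_upwards [hc.eventually hnear] with s hs
    exact (hasDerivAt_fst_of_hasFDerivAt (hW.hasFDerivAt hp hs.1 hs.2)).deriv
  have e1 := et.deriv_eq.trans ht.deriv
  have e2 := ex.deriv_eq.trans hx.deriv
  rw [schrodinger, e1, e2, eb₁, eb₂]
  ring

end Kernel

/-! ### The Goursat problem -/

theorem linePotential_of_pos {q : ℝ → ℝ} {x : ℝ} (h : 0 < x) (h' : x < 2 * π) :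
    linePotential q x = q x := if_pos ⟨h, h'⟩

theorem linePotential_of_neg {q : ℝ → ℝ} {x : ℝ} (h : x < 0) (h' : -(2 * π) < x) :
    linePotential q x = q (x + 2 * π) := by
  rw [linePotential, if_neg fun h'' => h''.1.not_gt h, if_pos ⟨h', h⟩]

theorem memLp_linePotential {q : ℝ → ℝ} {r : ENNReal}
    (hq : MemLp q r (volume.restrict (Ioo 0 (2 * π)))) : MemLp (linePotential q) r := by
  have h1 : MemLp ((Ioo 0 (2 * π)).indicator q) r :=
    (memLp_indicator_iff_restrict measurableSet_Ioo).2 hq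
  have h2 : MemLp (fun x => (Ioo 0 (2 * π)).indicator q (x + 2 * π)) r :=
    h1.comp_measurePreserving (measurePreserving_add_right volume (2 * π))
  convert h1.add h2 using 1
  ext x
  simp only [linePotential, Pi.add_apply, indicator, mem_Ioo]
  have := Real.pi_pos
  split_ifs <;> first | (simp; done) | (exfalso; grind)

theorem IsPotential.isLinePotential {q : ℝ → ℝ} (hq : IsPotential q) :
    IsLinePotential (linePotential q) where
  integrable := memLp_one_iff_integrable.1
    (memLp_linePotential (hq.2.mono_exponent (by norm_num)))
  memLp := memLp_linePotential hq.2
  zero x h := by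
    rw [linePotential, if_neg, if_neg]
    · rintro ⟨h1, h2⟩
      rw [abs_of_neg h2] at h
      linarith
    · rintro ⟨h1, h2⟩
      rw [abs_of_pos h1] at h
      linarith
  smooth x h0 h := by
    rcases lt_or_gt_of_ne h0 with h1 | h1
    · have h2 := (abs_lt.1 h).1
      have hc : ContDiffAt ℝ 1 q (x + 2 * π) :=
        ((hq.1.contDiffAt (Ioo_mem_nhds (by linarith) (by linarith))).of_le (by norm_num))
      have : ContDiffAt ℝ 1 (fun x => q (x + 2 * π)) x :=
        ContDiffAt.comp x (f := fun x => x + 2 * π) hc (by fun_prop)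
      refine this.congr_of_eventuallyEq ?_
      filter_upwards [Ioo_mem_nhds h2 h1] with y hy using linePotential_of_neg hy.2 hy.1
    · have h2 := (abs_lt.1 h).2
      refine ((hq.1.contDiffAt (Ioo_mem_nhds h1 h2)).of_le (by norm_num)).congr_of_eventuallyEq ?_
      filter_upwards [Ioo_mem_nhds h1 h2] with y hy using linePotential_of_pos hy.1 hy.2

theorem mem_lightCone_of_pos {x t : ℝ} (h0 : 0 ≤ x) (h : x < t) (ht : t < 2 * π) :
    (x, t) ∈ lightCone := ⟨by simpa [abs_of_nonneg h0] using h, ht⟩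

theorem mem_lightCone_of_neg {x t : ℝ} (h0 : x ≤ 0) (h : -x < t) (ht : t < 2 * π) :
    (x, t) ∈ lightCone := ⟨by simpa [abs_of_nonpos h0] using h, ht⟩

/-- Both kernels are halves of one `W`, so the two matching conditions express that `W` and
`kernelX` are continuous across `x = 0`. The characteristic data come from `freeKernel`, to which
`W` reduces for `t = |x|`; the coefficients `-σ / 2` and `-1 / 2` turn into the slopes `σ q / 4` and
`-q / 4`. -/
theorem IsWaveKernel.isGoursatPair {q : ℝ → ℝ} (hq : IsPotential q) {σ : ℝ} {W : ℝ → ℝ → ℝ}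
    (hW : IsWaveKernel (linePotential q) (-σ / 2) (-(1 / 2)) W) :
    IsGoursatPair q σ W (fun x => W (x - 2 * π)) := by
  have hp := hq.isLinePotential
  have hX : ∀ x t, (x, t) ∈ lightCone → x ≠ 0 → HasDerivAt (fun y => W y t)
      (kernelX (linePotential q) (-σ / 2) (-(1 / 2)) W (x, t)) x := fun x t h h0 =>
    hasDerivAt_fst_of_hasFDerivAt (hW.hasFDerivAt hp h h0)
  have hXc : ∀ s, 0 < s → s < 2 * π → ContinuousAt
      (fun y => kernelX (linePotential q) (-σ / 2) (-(1 / 2)) W (y, s)) 0 := fun s h h' =>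
    ContinuousAt.comp (f := fun y : ℝ => (y, s))
      ((continuousOn_kernelX hp hW.cont).continuousAt
        (isOpen_lightCone.mem_nhds (mem_lightCone_of_pos le_rfl h h'))) (by fun_prop)
  have hWc : ∀ s, Continuous fun y => W y s := fun s =>
    hW.cont.comp (f := fun y : ℝ => (y, s)) (by fun_prop)
  refine ⟨hW.cont.continuousOn, ?_, ?_, ?_, ?_, ?_, ?_, ?_, ?_, ?_, ?_, ?_, ?_⟩
  · exact (hW.cont.comp (f := fun z : ℝ × ℝ => (z.1 - 2 * π, z.2)) (by fun_prop)).continuousOn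
  · exact (hW.contDiffOn hp).mono fun z hz =>
      ⟨mem_lightCone_of_pos hz.1.le hz.2.1 hz.2.2, hz.1.ne'⟩
  · refine (hW.contDiffOn hp).comp (f := fun z : ℝ × ℝ => (z.1 - 2 * π, z.2))
      (by fun_prop) fun z hz => ?_
    obtain ⟨h1, h2, h3⟩ := hz
    exact ⟨mem_lightCone_of_neg (by linarith) (by linarith) h3, (by linarith : z.1 - 2 * π ≠ 0)⟩
  · intro x t h0 h h'
    have := hW.wave hp (mem_lightCone_of_pos h0.le h h') h0.ne'
    rwa [schrodinger, linePotential_of_pos h0 (h.trans h')] at this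
  · intro x t h0 h h'
    have := hW.wave hp (x := x - 2 * π) (t := t)
      (mem_lightCone_of_neg (by linarith) (by linarith) h') (by linarith)
    rw [schrodinger, linePotential_of_neg (by linarith) (by linarith), sub_add_cancel] at this
    rw [schrodinger]
    have e1 : deriv (fun y => W (y - 2 * π) t) = fun y => deriv (fun y => W y t) (y - 2 * π) := by
      ext y
      exact deriv_comp_sub_const (f := fun y => W y t) (2 * π) y
    rw [e1, deriv_comp_sub_const]
    exact this
  · intro x hx
    have e : ∀ y, W y y = σ / 4 * ∫ s in (0 : ℝ)..y, linePotential q s := fun y => by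
      rw [hW.eq_freeKernel (le_abs_self y), freeKernel]
      simp
      ring
    simp only [e]
    have := (hasDerivAt_primitive hp.integrable (a := 0)
      (hp.contDiffAt_pos hx.1 hx.2).continuousAt).const_mul (σ / 4)
    rw [linePotential_of_pos hx.1 hx.2] at this
    exact this.congr_deriv (by ring)
  · intro x hx
    have e : ∀ y, W (y - 2 * π) (2 * π - y) =
        -(1 / 4) * ∫ s in (0 : ℝ)..y - 2 * π, linePotential q s := fun y => by
      rw [hW.eq_freeKernel (by rw [← neg_sub]; exact neg_le_abs _), freeKernel]
      rw [show -(2 * π - y - (y - 2 * π)) / 2 = y - 2 * π by ring, intervalIntegral.integral_symm 0]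
      simp
      ring
    simp only [e]
    have h1 := hasDerivAt_primitive hp.integrable (a := 0) (x := x - 2 * π)
      (hp.contDiffAt_neg (by linarith [hx.2]) (by linarith [hx.1])).continuousAt
    rw [linePotential_of_neg (by linarith [hx.2]) (by linarith [hx.1]), sub_add_cancel] at h1
    exact ((h1.comp_sub_const x (2 * π)).const_mul (-(1 / 4))).congr_deriv (by ring)
  · rw [hW.eq_freeKernel (by simp), freeKernel]
    simp
  · refine ⟨kernelX (linePotential q) (-σ / 2) (-(1 / 2)) W,
      (continuousOn_kernelX hp hW.cont).mono fun z hz => ?_, fun z hz => ?_⟩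
    · exact mem_lightCone_of_pos hz.1 hz.2.1 hz.2.2
    · exact (hX z.1 z.2 (mem_lightCone_of_pos hz.1.le hz.2.1 hz.2.2) hz.1.ne').deriv.symm
  · refine ⟨fun z => kernelX (linePotential q) (-σ / 2) (-(1 / 2)) W (z.1 - 2 * π, z.2),
      (continuousOn_kernelX hp hW.cont).comp (f := fun z : ℝ × ℝ => (z.1 - 2 * π, z.2))
        (by fun_prop) fun z hz => ?_, fun z hz => ?_⟩
    · exact mem_lightCone_of_neg (by linarith [hz.1]) (by linarith [hz.2.1]) hz.2.2
    · have := hX (z.1 - 2 * π) z.2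
        (mem_lightCone_of_neg (by linarith [hz.1]) (by linarith [hz.2.1]) hz.2.2)
        (by linarith [hz.1])
      exact (this.comp_sub_const z.1 (2 * π)).deriv.symm
  · intro s _
    simp
  · intro s hs
    have hev : Ioo 0 s ∈ 𝓝[>] (0 : ℝ) := Ioo_mem_nhdsGT hs.1
    have hev' : Ioo (2 * π - s) (2 * π) ∈ 𝓝[<] (2 * π) := Ioo_mem_nhdsLT (by linarith [hs.1])
    refine ⟨kernelX (linePotential q) (-σ / 2) (-(1 / 2)) W (0, s), ?_, ?_⟩
    · have hd : ∀ y ∈ Ioo 0 s, HasDerivAt (fun y => W y s) _ y := fun y hy =>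
        hX y s (mem_lightCone_of_pos hy.1.le hy.2 hs.2) hy.1.ne'
      -- Differentiability of `W` was proved only off the axis, so the one-sided derivative is
      -- obtained as the limit of the nearby ones.
      refine hasDerivWithinAt_Ici_of_tendsto_deriv (s := Ioo 0 s)
        (fun y hy => (hd y hy).differentiableAt.differentiableWithinAt)
        (hWc s).continuousWithinAt hev ?_
      refine (((hXc s hs.1 hs.2).tendsto).mono_left nhdsWithin_le_nhds).congr' ?_
      filter_upwards [hev] with y hy using (hd y hy).deriv.symm
    · have hd : ∀ y ∈ Ioo (2 * π - s) (2 * π), HasDerivAt (fun y => W (y - 2 * π) s)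
          (kernelX (linePotential q) (-σ / 2) (-(1 / 2)) W (y - 2 * π, s)) y := fun y hy =>
        (hX (y - 2 * π) s (mem_lightCone_of_neg (by linarith [hy.2]) (by linarith [hy.1]) hs.2)
          (by linarith [hy.2])).comp_sub_const y (2 * π)
      refine hasDerivWithinAt_Iic_of_tendsto_deriv (s := Ioo (2 * π - s) (2 * π))
        (fun y hy => (hd y hy).differentiableAt.differentiableWithinAt)
        ((hWc s).comp (f := fun y : ℝ => y - 2 * π) (by fun_prop)).continuousWithinAt hev' ?_
      have hc : ContinuousAt (fun y => kernelX (linePotential q) (-σ / 2) (-(1 / 2)) W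
          (y - 2 * π, s)) (2 * π) :=
        ContinuousAt.comp (f := fun y : ℝ => y - 2 * π)
          (g := fun y => kernelX (linePotential q) (-σ / 2) (-(1 / 2)) W (y, s))
          (by simpa using hXc s hs.1 hs.2) (by fun_prop)
      have hc' := hc.tendsto
      rw [sub_self] at hc'
      refine (hc'.mono_left nhdsWithin_le_nhds).congr' ?_
      filter_upwards [hev'] with y hy using (hd y hy).deriv.symm

/-! ### Signals and the waves they generate -/

/-- Smooth scalar controls vanishing for `t ≤ 0`. -/
structure IsSignal (f : ℝ → ℝ) : Prop where
  smooth : ContDiff ℝ ∞ f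
  zero : ∀ t ≤ 0, f t = 0

theorem IsSignal.continuous {f : ℝ → ℝ} (hf : IsSignal f) : Continuous f := hf.smooth.continuous

theorem IsSignal.hasDerivAt {f : ℝ → ℝ} (hf : IsSignal f) (t : ℝ) :
    HasDerivAt f (deriv f t) t :=
  (hf.smooth.differentiable (by simp) t).hasDerivAt

theorem IsSignal.deriv {f : ℝ → ℝ} (hf : IsSignal f) : IsSignal (deriv f) := by
  have hs : ContDiff ℝ ∞ (_root_.deriv f) := (contDiff_infty_iff_deriv.1 hf.smooth).2
  refine ⟨hs, ?_⟩
  have h1 : ∀ t < 0, _root_.deriv f t = 0 := fun t ht => by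
    have : f =ᶠ[𝓝 t] fun _ => 0 := by
      filter_upwards [eventually_lt_nhds ht] with s hs using hf.zero s hs.le
    rw [this.deriv_eq, deriv_const]
  have h2 : EqOn (_root_.deriv f) (fun _ => 0) (closure (Iio 0)) :=
    EqOn.closure (fun t ht => h1 t ht) hs.continuous continuous_const
  intro t ht
  exact h2 (by rwa [closure_Iio])

/-- The Duhamel equation of a wave is stated for controls of the form `deriv g`; by this lemma it
covers all signals. -/
theorem IsSignal.exists_primitive {f : ℝ → ℝ} (hf : IsSignal f) :
    ∃ g, IsSignal g ∧ _root_.deriv g = f := by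
  have hd : ∀ t, HasDerivAt (fun t => ∫ s in (0 : ℝ)..t, f s) (f t) t := fun t =>
    (hf.continuous.integral_hasStrictDerivAt 0 t).hasDerivAt
  have hd' : _root_.deriv (fun t => ∫ s in (0 : ℝ)..t, f s) = f := funext fun t => (hd t).deriv
  refine ⟨fun t => ∫ s in (0 : ℝ)..t, f s, ⟨?_, fun t ht => ?_⟩, hd'⟩
  · refine contDiff_infty_iff_deriv.2 ⟨fun t => (hd t).differentiableAt, ?_⟩
    rw [hd']
    exact hf.smooth
  · rw [intervalIntegral.integral_congr (g := fun _ => 0)]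
    · simp
    · intro s hs
      rw [uIcc_of_ge ht] at hs
      exact hf.zero s hs.2

/-- The convolution in time of a kernel with a signal. -/
def kernelConv (W : ℝ → ℝ → ℝ) (f : ℝ → ℝ) (x t : ℝ) : ℝ := ∫ s in |x|..t, W x s * f (t - s)

/-- The coefficient of the singular part of a wave. -/
def jump (cp cm x : ℝ) : ℝ := if 0 < x then cp else cm

/-- The solution on the line with scalar control `f`. -/
def lineWave (cp cm : ℝ) (W : ℝ → ℝ → ℝ) (f : ℝ → ℝ) (x t : ℝ) : ℝ :=
  jump cp cm x * f (t - |x|) + kernelConv W f x t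

theorem measurable_jump (cp cm : ℝ) : Measurable (jump cp cm) :=
  Measurable.ite measurableSet_Ioi measurable_const measurable_const

theorem abs_jump_le (cp cm x : ℝ) : |jump cp cm x| ≤ |cp| + |cm| := by
  unfold jump
  split_ifs
  · linarith [abs_nonneg cm]
  · linarith [abs_nonneg cp]

section Conv

variable {W : ℝ → ℝ → ℝ} {f g : ℝ → ℝ}

theorem continuous_kernelConv (hW : Continuous (Function.uncurry W)) (hf : Continuous f) :
    Continuous (Function.uncurry (kernelConv W f)) := by
  have h' : Continuous (Function.uncurry fun (z : ℝ × ℝ) s => W z.1 s * f (z.2 - s)) :=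
    (hW.comp (f := fun w : (ℝ × ℝ) × ℝ => (w.1.1, w.2)) (by fun_prop)).mul
      (hf.comp (f := fun w : (ℝ × ℝ) × ℝ => w.1.2 - w.2) (by fun_prop))
  have hi : ∀ (z : ℝ × ℝ) a b, IntervalIntegrable (fun s => W z.1 s * f (z.2 - s)) volume a b :=
    fun z a b => (h'.comp (f := fun s : ℝ => (z, s)) (by fun_prop)).intervalIntegrable a b
  have : Function.uncurry (kernelConv W f) = fun z : ℝ × ℝ =>
      (∫ s in (0 : ℝ)..z.2, W z.1 s * f (z.2 - s)) -
        ∫ s in (0 : ℝ)..|z.1|, W z.1 s * f (z.2 - s) := by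
    ext z
    exact (intervalIntegral.integral_interval_sub_left (hi _ _ _) (hi _ _ _)).symm
  rw [this]
  exact (intervalIntegral.continuous_parametric_intervalIntegral_of_continuous h'
    (by fun_prop)).sub
    (intervalIntegral.continuous_parametric_intervalIntegral_of_continuous h' (by fun_prop))

theorem kernelConv_of_le (hf : ∀ t ≤ 0, f t = 0) {x t : ℝ} (h : t ≤ |x|) :
    kernelConv W f x t = 0 := by
  rw [kernelConv, intervalIntegral.integral_congr (g := fun _ => 0)]
  · simp
  · intro s hs
    rw [uIcc_of_ge h] at hs
    simp only [hf (t - s) (by linarith [hs.1]), mul_zero]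

/-- As `f(t - s)` vanishes for `s ≥ t`, the upper limit can be frozen at any `b ≥ t`, and
differentiation in `t` then meets no moving endpoint. -/
theorem kernelConv_eq (hW : Continuous (Function.uncurry W)) (hf : Continuous f)
    (hf0 : ∀ t ≤ 0, f t = 0) {x t b : ℝ} (h : t ≤ b) :
    kernelConv W f x t = ∫ s in |x|..b, W x s * f (t - s) := by
  have hc : Continuous fun s => W x s * f (t - s) :=
    (hW.comp (f := fun s : ℝ => (x, s)) (by fun_prop)).mul (by fun_prop)
  have h0 : ∫ s in t..b, W x s * f (t - s) = 0 := by
    rw [intervalIntegral.integral_congr (g := fun _ => 0)]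
    · simp
    · intro s hs
      rw [uIcc_of_le h] at hs
      simp only [hf0 (t - s) (by linarith [hs.1]), mul_zero]
  rw [kernelConv, ← intervalIntegral.integral_add_adjacent_intervals
    (hc.intervalIntegrable |x| t) (hc.intervalIntegrable t b), h0, add_zero]

theorem hasDerivAt_kernelConv (hW : Continuous (Function.uncurry W)) (hf : IsSignal f) (x t : ℝ) :
    HasDerivAt (kernelConv W f x) (kernelConv W (deriv f) x t) t := by
  have hxs : Continuous (W x) := hW.comp (f := fun s : ℝ => (x, s)) (by fun_prop)
  have hf' := hf.deriv
  have hc : Continuous (Function.uncurry fun ξ y => W x y * f (ξ - y)) :=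
    (hxs.comp continuous_snd).mul (hf.continuous.comp (f := fun z : ℝ × ℝ => z.1 - z.2)
      (by fun_prop))
  have hc' : Continuous (Function.uncurry fun ξ y => W x y * deriv f (ξ - y)) :=
    (hxs.comp continuous_snd).mul (hf'.continuous.comp (f := fun z : ℝ × ℝ => z.1 - z.2)
      (by fun_prop))
  set b := max |x| t + 1 with hb
  have hb1 : |x| < b := (le_max_left _ _).trans_lt (lt_add_one _)
  have hb2 : t < b := (le_max_right _ _).trans_lt (lt_add_one _)
  obtain ⟨C, hL⟩ := exists_isLeibnizKernel (p := fun _ => 1) (fun _ _ => intervalIntegrable_const)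
    (K := fun ξ y => W x y * f (ξ - y)) (K' := fun ξ y => W x y * deriv f (ξ - y)) (ξ₀ := t)
    (ε := 1) (a := |x|) (b := b + 1) hc.continuousOn hc'.continuousOn
    (Eventually.of_forall fun y _ ξ _ => by
      exact ((hf.hasDerivAt (ξ - y)).comp_sub_const ξ y).const_mul _)
  have := hasDerivAt_fst_of_hasFDerivAt (hL.hasFDerivAt (z := (t, b))
    (Metric.mem_ball_self one_pos) ⟨hb1, by simp⟩
    (Eventually.of_forall fun w => (continuous_const.mul hc).continuousAt))
  simp only [one_mul] at this
  rw [kernelConv_eq hW hf'.continuous hf'.zero hb2.le]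
  refine this.congr_of_eventuallyEq ?_
  filter_upwards [eventually_lt_nhds hb2] with s hs using
    kernelConv_eq hW hf.continuous hf.zero hs.le

variable (cp cm : ℝ)

theorem lineWave_of_le (hf : ∀ t ≤ 0, f t = 0) {x t : ℝ} (h : t ≤ |x|) :
    lineWave cp cm W f x t = 0 := by
  rw [lineWave, kernelConv_of_le hf h, hf _ (by linarith), mul_zero, add_zero]

theorem continuous_lineWave (hW : Continuous (Function.uncurry W)) (hf : Continuous f) (x : ℝ) :
    Continuous (lineWave cp cm W f x) := by
  have := (continuous_kernelConv hW hf).comp (f := fun s : ℝ => (x, s)) (by fun_prop)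
  exact (by fun_prop : Continuous fun t => jump cp cm x * f (t - |x|)).add this

theorem hasDerivAt_lineWave (hW : Continuous (Function.uncurry W)) (hf : IsSignal f) (x t : ℝ) :
    HasDerivAt (lineWave cp cm W f x) (lineWave cp cm W (deriv f) x t) t :=
  (((hf.hasDerivAt (t - |x|)).comp_sub_const t |x|).const_mul _).add
    (hasDerivAt_kernelConv hW hf x t)

/-- Sums of a jump times a continuous causal kernel and a continuous causal kernel are causal. -/
theorem isCausal_jump {k₁ k₂ : ℝ → ℝ → ℝ} (h₁ : Continuous (Function.uncurry k₁))
    (h₂ : Continuous (Function.uncurry k₂)) (z₁ : ∀ y τ, τ ≤ |y| → k₁ y τ = 0)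
    (z₂ : ∀ y τ, τ ≤ |y| → k₂ y τ = 0) :
    IsCausal (fun y τ => jump cp cm y * k₁ y τ + k₂ y τ) where
  meas := (((measurable_jump cp cm).comp measurable_fst).mul h₁.measurable).add h₂.measurable
  zero y τ h := by simp [z₁ y τ h, z₂ y τ h]
  bdd R := by
    obtain ⟨C₁, hC₁⟩ := (isCausal_of_continuous h₁ z₁).bdd R
    obtain ⟨C₂, hC₂⟩ := (isCausal_of_continuous h₂ z₂).bdd R
    refine ⟨(|cp| + |cm|) * C₁ + C₂, fun y τ h => (abs_add_le _ _).trans ?_⟩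
    rw [abs_mul]
    exact add_le_add (mul_le_mul (abs_jump_le _ _ _) (hC₁ y τ h) (abs_nonneg _)
      (by positivity)) (hC₂ y τ h)
  cont y τ _ := by
    have c₁ : Continuous (k₁ y) := h₁.comp (f := fun s : ℝ => (y, s)) (by fun_prop)
    have c₂ : Continuous (k₂ y) := h₂.comp (f := fun s : ℝ => (y, s)) (by fun_prop)
    exact ((c₁.const_mul _).add c₂).continuousAt

theorem isCausal_lineWave (hW : Continuous (Function.uncurry W)) (hf : Continuous f)
    (hf0 : ∀ t ≤ 0, f t = 0) : IsCausal (lineWave cp cm W f) :=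
  isCausal_jump cp cm (k₁ := fun y τ => f (τ - |y|)) (k₂ := kernelConv W f)
    (hf.comp (f := fun z : ℝ × ℝ => z.2 - |z.1|) (by fun_prop)) (continuous_kernelConv hW hf)
    (fun _ _ h => hf0 _ (by linarith)) fun _ _ => kernelConv_of_le hf0

theorem isCausalPrimitive_lineWave (hW : Continuous (Function.uncurry W)) (hg : IsSignal g) :
    IsCausalPrimitive (lineWave cp cm W g) (lineWave cp cm W (deriv g)) where
  left := isCausal_lineWave cp cm hW hg.continuous hg.zero
  right := isCausal_lineWave cp cm hW hg.deriv.continuous hg.deriv.zero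
  deriv y τ _ := hasDerivAt_lineWave cp cm hW hg y τ
  lip R := by
    obtain ⟨C, hC⟩ := (isCausal_lineWave cp cm hW hg.deriv.continuous hg.deriv.zero).bdd R
    refine ⟨C, fun y τ τ' h h' => ?_⟩
    exact (convex_Iic R).norm_image_sub_le_of_norm_hasDerivWithin_le
      (fun s _ => (hasDerivAt_lineWave cp cm hW hg y s).hasDerivWithinAt) (fun s hs => hC y s hs)
      h' h

end Conv

/-! ### The Duhamel equation for waves -/

section Duhamel

variable {p : ℝ → ℝ} {cp cm : ℝ} {W : ℝ → ℝ → ℝ}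

/-- The response to the step function. -/
def stepWave (cp cm : ℝ) (W : ℝ → ℝ → ℝ) (y τ : ℝ) : ℝ :=
  jump cp cm y * (if |y| < τ then 1 else 0) + timePrimitive W y τ

theorem isCausal_stepWave (hW : Continuous (Function.uncurry W)) :
    IsCausal (stepWave cp cm W) := by
  have h1 : IsCausal (cutKernel fun _ _ => 1) := isCausal_cutKernel continuous_const
  have h2 := (isCausalPrimitive_timePrimitive hW).left
  refine ⟨(((measurable_jump cp cm).comp measurable_fst).mul h1.meas).add h2.meas,
    fun y τ h => ?_, fun R => ?_, fun y τ h => ?_⟩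
  · rw [stepWave, if_neg h.not_gt, h2.zero _ _ h]
    simp
  · obtain ⟨C₁, hC₁⟩ := h1.bdd R
    obtain ⟨C₂, hC₂⟩ := h2.bdd R
    refine ⟨(|cp| + |cm|) * C₁ + C₂, fun y τ h => (abs_add_le _ _).trans ?_⟩
    rw [abs_mul]
    exact add_le_add (mul_le_mul (abs_jump_le _ _ _) (hC₁ y τ h) (abs_nonneg _)
      (by positivity)) (hC₂ y τ h)
  · exact ((h1.cont y τ h).const_mul _).add (h2.cont y τ h)

/-- The forward cone of the origin and the backward cone of `(x, s)` intersect in a rectangle with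
characteristic sides; this is its projection to the `y` axis. -/
theorem abs_add_abs_sub_lt_iff {x y s : ℝ} (h : |x| < s) :
    |y| < s - |x - y| ↔ y ∈ Ioo (-(s - x) / 2) ((s + x) / 2) := by
  have := abs_lt.1 h
  constructor
  · intro h'
    rcases abs_cases y with h1 | h1 <;> rcases abs_cases (x - y) with h2 | h2 <;>
      constructor <;> linarith
  · intro h'
    obtain ⟨h1, h2⟩ := h'
    rcases abs_cases y with h3 | h3 <;> rcases abs_cases (x - y) with h4 | h4 <;> linarith

/-- For a step control the singular part is `jump` times the indicator of `|y| < τ`; its Duhamel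
integral is the free kernel. -/
theorem freeKernel_eq_integral (hp : Integrable p) {x s : ℝ} (h : |x| < s) :
    freeKernel p cp cm x s =
      -(1 / 2) * ∫ y, p y * (jump cp cm y * if |y| < s - |x - y| then 1 else 0) := by
  have h' := abs_lt.1 h
  have hl : -(s - x) / 2 < 0 := by linarith
  have hr : 0 < (s + x) / 2 := by linarith
  have e : (fun y => p y * (jump cp cm y * if |y| < s - |x - y| then 1 else 0)) =
      (Ioo (-(s - x) / 2) ((s + x) / 2)).indicator fun y => p y * jump cp cm y := by
    ext y
    by_cases hy : y ∈ Ioo (-(s - x) / 2) ((s + x) / 2)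
    · rw [indicator_of_mem hy, if_pos ((abs_add_abs_sub_lt_iff h).2 hy), mul_one]
    · rw [indicator_of_notMem hy, if_neg fun h1 => hy ((abs_add_abs_sub_lt_iff h).1 h1), mul_zero,
        mul_zero]
  have hi : Integrable fun y => p y * jump cp cm y :=
    hp.mul_bdd (c := |cp| + |cm|) (measurable_jump cp cm).aestronglyMeasurable
      (Eventually.of_forall fun y => abs_jump_le cp cm y)
  rw [e, integral_indicator measurableSet_Ioo, ← integral_Ioc_eq_integral_Ioo,
    ← intervalIntegral.integral_of_le (hl.trans hr).le,
    ← intervalIntegral.integral_add_adjacent_intervals (b := 0) hi.intervalIntegrable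
      hi.intervalIntegrable, freeKernel]
  have e1 : ∫ y in (-(s - x) / 2)..0, p y * jump cp cm y = cm * ∫ y in (-(s - x) / 2)..0, p y := by
    rw [← intervalIntegral.integral_const_mul]
    refine intervalIntegral.integral_congr fun y hy => ?_
    rw [uIcc_of_le hl.le] at hy
    simp only [jump, if_neg hy.2.not_gt]
    ring
  have e2 : ∫ y in (0 : ℝ)..(s + x) / 2, p y * jump cp cm y =
      cp * ∫ y in (0 : ℝ)..(s + x) / 2, p y := by
    rw [← intervalIntegral.integral_const_mul]
    refine intervalIntegral.integral_congr_ae (Eventually.of_forall fun y hy => ?_)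
    rw [uIoc_of_le hr.le] at hy
    simp only [jump, if_pos hy.1]
    ring
  rw [e1, e2]
  ring

theorem integrable_mul_causal (hp : Integrable p) {k : ℝ → ℝ → ℝ} (hk : IsCausal k) (x t : ℝ) :
    Integrable fun y => p y * k y (t - |x - y|) := by
  obtain ⟨C, hC⟩ := hk.bdd t
  refine hp.mul_bdd (c := C) ?_ (Eventually.of_forall fun y => hC _ _ (sub_abs_le _ _))
  exact (hk.meas.comp (f := fun y : ℝ => (y, t - |x - y|)) (by fun_prop)).aestronglyMeasurable

theorem IsWaveKernel.eq_integral_stepWave (hp : Integrable p) (hW : IsWaveKernel p cp cm W)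
    {x s : ℝ} (h : |x| < s) :
    W x s = -(1 / 2) * ∫ y, p y * stepWave cp cm W y (s - |x - y|) := by
  have h1 := integrable_mul_causal hp (isCausal_stepWave (cp := cp) (cm := cm) hW.cont) x s
  have h2 := integrable_mul_causal hp (isCausalPrimitive_timePrimitive hW.cont).left x s
  have h3 : Integrable fun y => p y * (jump cp cm y * if |y| < s - |x - y| then 1 else 0) := by
    convert h1.sub h2 using 1
    ext y
    simp only [stepWave, Pi.sub_apply]
    ring
  rw [hW.eq, freeKernel_eq_integral hp h, duhamel, ← mul_add, ← integral_add h3 h2]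
  simp only [stepWave, mul_add]

/-- Superposing step responses with density `deriv g` gives the response to `g`; the proof is an
integration by parts in time. -/
theorem integral_stepWave_mul (hW : Continuous (Function.uncurry W)) {g : ℝ → ℝ}
    (hg : IsSignal g) (x y t : ℝ) :
    ∫ s in |x|..t, stepWave cp cm W y (s - |x - y|) * deriv g (t - s) =
      lineWave cp cm W g y (t - |x - y|) := by
  have hf := hg.deriv
  have hE := isCausal_stepWave (cp := cp) (cm := cm) hW
  have htri : |x| ≤ |y| + |x - y| := by
    have := abs_sub_abs_le_abs_sub x y
    linarith
  rcases le_or_gt t (|y| + |x - y|) with h | h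
  · rw [lineWave_of_le cp cm hg.zero (by linarith),
      intervalIntegral.integral_congr (g := fun _ => 0)]
    · simp
    · intro s hs
      have : s ≤ |y| + |x - y| := by
        rcases le_total |x| t with h' | h'
        · rw [uIcc_of_le h'] at hs
          exact hs.2.trans h
        · rw [uIcc_of_ge h'] at hs
          exact hs.2.trans htri
      simp only [hE.zero y (s - |x - y|) (by linarith), zero_mul]
  · set τ := t - |x - y| with hτ
    have hyτ : |y| < τ := by linarith
    have hZc : Continuous (timePrimitive W y) :=
      (continuous_timePrimitive hW).comp (f := fun s : ℝ => (y, s)) (by fun_prop)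
    have hWc : Continuous (W y) := hW.comp (f := fun s : ℝ => (y, s)) (by fun_prop)
    have hfc := hf.continuous
    have hgc := hg.continuous
    have hcF : Continuous fun s => (jump cp cm y + timePrimitive W y (s - |x - y|)) *
        deriv g (t - s) := by fun_prop
    -- The step response vanishes up to `s = |y| + |x - y|`, which is at least `|x|` by the triangle
    -- inequality.
    have e1 : ∫ s in |x|..t, stepWave cp cm W y (s - |x - y|) * deriv g (t - s) =
        ∫ s in (|y| + |x - y|)..t, (jump cp cm y + timePrimitive W y (s - |x - y|)) *
          deriv g (t - s) := by
      have e2 : ∀ s, stepWave cp cm W y (s - |x - y|) * deriv g (t - s) =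
          (Ioi (|y| + |x - y|)).indicator (fun s =>
            (jump cp cm y + timePrimitive W y (s - |x - y|)) * deriv g (t - s)) s := fun s => by
        by_cases hs : |y| + |x - y| < s
        · rw [indicator_of_mem (show s ∈ Ioi _ from hs), stepWave, if_pos (by linarith), mul_one]
        · rw [indicator_of_notMem (show s ∉ Ioi _ from hs),
            hE.zero y (s - |x - y|) (by linarith), zero_mul]
      simp only [e2]
      rw [intervalIntegral.integral_of_le (htri.trans h.le),
        setIntegral_indicator measurableSet_Ioi, intervalIntegral.integral_of_le h.le,
        Ioc_inter_Ioi, max_eq_right htri]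
    have e3 : ∫ s in (|y| + |x - y|)..t, (jump cp cm y + timePrimitive W y (s - |x - y|)) *
          deriv g (t - s) =
        ∫ s in |y|..τ, (jump cp cm y + timePrimitive W y s) * deriv g (τ - s) := by
      have := intervalIntegral.integral_comp_sub_right (a := |y| + |x - y|) (b := t)
        (fun s => (jump cp cm y + timePrimitive W y s) * deriv g (τ - s)) |x - y|
      rw [add_sub_cancel_right] at this
      rw [← this]
      refine intervalIntegral.integral_congr fun s _ => ?_
      simp only [hτ]
      rw [show t - |x - y| - (s - |x - y|) = t - s by ring]
    have hparts := intervalIntegral.integral_mul_deriv_eq_deriv_mul_of_hasDerivAt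
      (a := |y|) (b := τ) (u := fun s => jump cp cm y + timePrimitive W y s) (u' := W y)
      (v := fun s => -g (τ - s)) (v' := fun s => deriv g (τ - s))
      (by fun_prop) (by fun_prop)
      (fun s hs => by
        rw [min_eq_left hyτ.le, max_eq_right hyτ.le] at hs
        have := (isCausalPrimitive_timePrimitive hW).deriv y s hs.1.ne'
        rw [cutKernel, if_pos hs.1] at this
        exact this.const_add _)
      (fun s _ => by
        have h1 := HasDerivAt.comp_const_sub τ s (hg.hasDerivAt (τ - s))
        exact h1.neg.congr_deriv (by simp))
      (hWc.intervalIntegrable _ _) ((by fun_prop : Continuous fun s =>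
        deriv g (τ - s)).intervalIntegrable _ _)
    -- The boundary term at `τ` vanishes because `g 0 = 0`; the one at `|y|` leaves the singular
    -- part `jump * g (τ - |y|)`.
    rw [e1, e3, hparts, lineWave, kernelConv, sub_self, hg.zero 0 le_rfl,
      timePrimitive_of_le le_rfl]
    simp

/-- Waves solve the Duhamel integral equation. -/
theorem IsWaveKernel.kernelConv_eq_integral (hp : IsLinePotential p) (hW : IsWaveKernel p cp cm W)
    {g : ℝ → ℝ} (hg : IsSignal g) (x t : ℝ) :
    kernelConv W (deriv g) x t = -(1 / 2) * ∫ y, p y * lineWave cp cm W g y (t - |x - y|) := by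
  have hf := hg.deriv
  have hE := isCausal_stepWave (cp := cp) (cm := cm) hW.cont
  rcases le_or_gt t |x| with h | h
  · rw [kernelConv_of_le hf.zero h]
    have : ∀ y, lineWave cp cm W g y (t - |x - y|) = 0 := fun y =>
      lineWave_of_le cp cm hg.zero (by
        have := abs_sub_abs_le_abs_sub x y
        linarith)
    simp [this]
  · have e1 : kernelConv W (deriv g) x t = ∫ s in |x|..t, -(1 / 2) *
        ∫ y, p y * (stepWave cp cm W y (s - |x - y|) * deriv g (t - s)) := by
      refine intervalIntegral.integral_congr_ae (Eventually.of_forall fun s hs => ?_)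
      rw [uIoc_of_le h.le] at hs
      rw [hW.eq_integral_stepWave hp.integrable hs.1, mul_assoc, ← integral_mul_const]
      simp only [mul_assoc]
    -- By Fubini the time integral is taken first, where `integral_stepWave_mul` evaluates it.
    rw [e1, intervalIntegral.integral_const_mul, intervalIntegral.integral_of_le h.le,
      integral_integral_swap]
    · congr 2
      ext y
      rw [← intervalIntegral.integral_of_le h.le, intervalIntegral.integral_const_mul,
        integral_stepWave_mul hW.cont hg]
    · obtain ⟨C₁, hC₁⟩ := hE.bdd t
      obtain ⟨C₂, hC₂⟩ := (isCompact_Icc (a := |x|) (b := t)).exists_bound_of_continuousOn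
        (f := fun s => deriv g (t - s))
        (hf.continuous.comp (by fun_prop : Continuous fun s => t - s)).continuousOn
      have hconst : Integrable (fun _ : ℝ => |C₁| * |C₂|) (volume.restrict (Ioc |x| t)) :=
        integrable_const _
      refine (hconst.mul_prod hp.integrable.abs).mono' ?_ ?_
      · refine (hp.integrable.aestronglyMeasurable.comp_snd).mul (Measurable.aestronglyMeasurable ?_)
        refine (hE.meas.comp (f := fun z : ℝ × ℝ => (z.2, z.1 - |x - z.2|)) (by fun_prop)).mul ?_
        exact hf.continuous.measurable.comp (by fun_prop : Measurable fun z : ℝ × ℝ => t - z.1)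
      · have hae : ∀ᵐ z : ℝ × ℝ ∂((volume.restrict (Ioc |x| t)).prod volume), z.1 ∈ Ioc |x| t :=
          Measure.quasiMeasurePreserving_fst.ae (ae_restrict_mem measurableSet_Ioc)
        filter_upwards [hae] with z hz
        simp only [Function.uncurry, norm_mul, Real.norm_eq_abs]
        rw [mul_comm]
        refine mul_le_mul_of_nonneg_right (mul_le_mul ?_ ?_ (abs_nonneg _) (abs_nonneg _))
          (abs_nonneg _)
        · exact (hC₁ _ _ ((sub_abs_le _ _).trans hz.2)).trans (le_abs_self _)
        · exact (hC₂ z.1 (Ioc_subset_Icc_self hz)).trans (le_abs_self _)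

/-- The wave for `g` is the time primitive of the wave for `deriv g`, so the right side is the
Duhamel formula with its time integration already carried out. Its two characteristic integrals can
be differentiated with no derivative of `p`. -/
theorem IsWaveKernel.lineWave_eq (hp : IsLinePotential p) (hW : IsWaveKernel p cp cm W)
    {g : ℝ → ℝ} (hg : IsSignal g) (x t : ℝ) :
    lineWave cp cm W (deriv g) x t = jump cp cm x * deriv g (t - |x|) -
      1 / 2 * (forwardChar p (lineWave cp cm W g) (t - x, x) +
        backwardChar p (lineWave cp cm W g) (t + x, x)) := by
  rw [lineWave, hW.kernelConv_eq_integral hp hg, integral_eq_forwardChar_add_backwardChar hp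
    (isCausal_lineWave cp cm hW.cont hg.continuous hg.zero)]
  ring

end Duhamel

/-! ### Derivatives and square integrability of waves -/

section Derivatives

variable {p : ℝ → ℝ} {cp cm : ℝ} {W : ℝ → ℝ → ℝ} {f g : ℝ → ℝ}

theorem hasFDerivAt_jump (hf : IsSignal f) {z : ℝ × ℝ} (h : z.1 ≠ 0) :
    HasFDerivAt (fun z : ℝ × ℝ => jump cp cm z.1 * f (z.2 - |z.1|))
      (gradCLM (jump (-cp) cm z.1 * deriv f (z.2 - |z.1|))
        (jump cp cm z.1 * deriv f (z.2 - |z.1|))) z := by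
  have hd := hf.hasDerivAt (z.2 - |z.1|)
  have hfst : Tendsto (fun w : ℝ × ℝ => w.1) (𝓝 z) (𝓝 z.1) := continuousAt_fst
  rcases lt_or_gt_of_ne h with h | h
  · rw [show z.2 - |z.1| = 1 * z.1 + 1 * z.2 by rw [abs_of_neg h]; ring] at hd
    refine (((hasFDerivAt_comp_linear hd).const_mul cm).congr_of_eventuallyEq ?_).congr_fderiv ?_
    · filter_upwards [hfst.eventually (eventually_lt_nhds h)] with w hw
      rw [jump, if_neg hw.not_gt, abs_of_neg hw]
      ring_nf
    · rw [show z.2 - |z.1| = 1 * z.1 + 1 * z.2 by rw [abs_of_neg h]; ring]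
      ext <;> simp [jump, h.not_gt]
  · rw [show z.2 - |z.1| = (-1) * z.1 + 1 * z.2 by rw [abs_of_pos h]; ring] at hd
    refine (((hasFDerivAt_comp_linear hd).const_mul cp).congr_of_eventuallyEq ?_).congr_fderiv ?_
    · filter_upwards [hfst.eventually (eventually_gt_nhds h)] with w hw
      rw [jump, if_pos hw, abs_of_pos hw]
      ring_nf
    · rw [show z.2 - |z.1| = (-1) * z.1 + 1 * z.2 by rw [abs_of_pos h]; ring]
      ext <;> simp [jump, h]

theorem continuousAt_lineWave (hW : Continuous (Function.uncurry W)) (hf : IsSignal f) {z : ℝ × ℝ}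
    (h : z.1 ≠ 0) : ContinuousAt (fun z : ℝ × ℝ => lineWave cp cm W f z.1 z.2) z :=
  (hasFDerivAt_jump hf h).continuousAt.add (continuous_kernelConv hW hf.continuous).continuousAt

theorem forwardChar_of_le (hp : IsLinePotential p) {k : ℝ → ℝ → ℝ} (hk : IsCausal k) {x t : ℝ}
    (h : t ≤ |x|) : forwardChar p k (t - x, x) = 0 := by
  rw [forwardChar, intervalIntegral.integral_congr (g := fun _ => 0)]
  · simp
  · intro y hy
    simp only
    rcases le_total (-(2 * π)) x with hx | hx
    · rw [uIcc_of_le hx] at hy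
      rw [hk.zero, mul_zero]
      have := hy.2
      rcases abs_cases x with h1 | h1 <;> rcases abs_cases y with h2 | h2 <;> linarith
    · rw [uIcc_of_ge hx] at hy
      have := Real.pi_pos
      rw [hp.zero y, zero_mul]
      rw [abs_of_nonpos (by linarith [hy.2])]
      linarith [hy.2]

theorem backwardChar_of_le (hp : IsLinePotential p) {k : ℝ → ℝ → ℝ} (hk : IsCausal k) {x t : ℝ}
    (h : t ≤ |x|) : backwardChar p k (t + x, x) = 0 := by
  rw [backwardChar_eq]
  simpa using forwardChar_of_le hp.reflect hk.reflect (x := -x) (t := t) (by simpa using h)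

/-- The regular part of the space derivative of a wave. -/
def charDiff (p : ℝ → ℝ) (k : ℝ → ℝ → ℝ) (z : ℝ × ℝ) : ℝ :=
  -(1 / 2) * (-forwardChar p k (z.2 - z.1, z.1) + backwardChar p k (z.2 + z.1, z.1))

theorem charDiff_of_le (hp : IsLinePotential p) {k : ℝ → ℝ → ℝ} (hk : IsCausal k) {z : ℝ × ℝ}
    (h : z.2 ≤ |z.1|) : charDiff p k z = 0 := by
  simp [charDiff, forwardChar_of_le hp hk h, backwardChar_of_le hp hk h]

theorem eventually_lt_abs {z : ℝ × ℝ} (h : z.2 < |z.1|) : ∀ᶠ w : ℝ × ℝ in 𝓝 z, w.2 < |w.1| :=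
  (isOpen_lt continuous_snd (by fun_prop : Continuous fun w : ℝ × ℝ => |w.1|)).mem_nhds h

theorem continuousAt_charDiff (hp : IsLinePotential p) {k : ℝ → ℝ → ℝ} (hk : IsCausal k)
    (hc : ∀ y, Continuous (k y)) {z : ℝ × ℝ} (h : z.2 < 2 * π) :
    ContinuousAt (charDiff p k) z := by
  rcases lt_or_ge |z.1| (2 * π) with h' | h'
  · have h1 : ContinuousAt (fun z : ℝ × ℝ => forwardChar p k (z.2 - z.1, z.1)) z :=
      ContinuousAt.comp (g := forwardChar p k) (f := fun z : ℝ × ℝ => (z.2 - z.1, z.1))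
        (continuousAt_forwardChar hp.int hk (abs_lt.1 h').1 (Or.inr hc)) (by fun_prop)
    have h2 : ContinuousAt (fun z : ℝ × ℝ => backwardChar p k (z.2 + z.1, z.1)) z :=
      ContinuousAt.comp (g := backwardChar p k) (f := fun z : ℝ × ℝ => (z.2 + z.1, z.1))
        (continuousAt_backwardChar hp.int hk (abs_lt.1 h').2 (Or.inr hc)) (by fun_prop)
    exact (h1.neg.add h2).const_mul _
  · refine (continuousAt_const (y := (0 : ℝ))).congr ?_
    filter_upwards [eventually_lt_abs (h.trans_le h')] with w hw using
      (charDiff_of_le hp hk hw.le).symm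

variable (p cp cm W) in
/-- The space derivative of a wave. -/
def lineWaveX (f : ℝ → ℝ) (z : ℝ × ℝ) : ℝ :=
  jump (-cp) cm z.1 * deriv f (z.2 - |z.1|) + charDiff p (lineWave cp cm W f) z

theorem lineWaveX_of_le (hp : IsLinePotential p) (hW : Continuous (Function.uncurry W))
    (hf : IsSignal f) {z : ℝ × ℝ} (h : z.2 ≤ |z.1|) : lineWaveX p cp cm W f z = 0 := by
  rw [lineWaveX, charDiff_of_le hp (isCausal_lineWave cp cm hW hf.continuous hf.zero) h,
    hf.deriv.zero _ (by linarith)]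
  simp

theorem hasFDerivAt_char_lineWave (hp : IsLinePotential p) (hW : Continuous (Function.uncurry W))
    (hg : IsSignal g) {z : ℝ × ℝ} (h : z.1 ≠ 0) (h' : |z.1| < 2 * π) :
    HasFDerivAt (forwardChar p (lineWave cp cm W g))
      (gradCLM (forwardChar p (lineWave cp cm W (deriv g)) (z.2 - z.1, z.1))
        (p z.1 * lineWave cp cm W g z.1 z.2)) (z.2 - z.1, z.1) ∧
    HasFDerivAt (backwardChar p (lineWave cp cm W g))
      (gradCLM (backwardChar p (lineWave cp cm W (deriv g)) (z.2 + z.1, z.1))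
        (-(p z.1 * lineWave cp cm W g z.1 z.2))) (z.2 + z.1, z.1) := by
  have hk := isCausalPrimitive_lineWave cp cm hW hg
  -- Unlike cut kernels, waves with smooth controls are smooth in time across the cone, so the
  -- second alternative applies and `ξ = 0` is allowed.
  have hd : ∀ y τ, HasDerivAt (lineWave cp cm W g y) (lineWave cp cm W (deriv g) y τ) τ ∧
      ContinuousAt (lineWave cp cm W (deriv g) y) τ := fun y τ =>
    ⟨hasDerivAt_lineWave cp cm hW hg y τ,
      (continuous_lineWave cp cm hW hg.deriv.continuous y).continuousAt⟩
  have hpc := (hp.eventually_contDiffAt h h').and (eventually_ne_nhds h)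
  have h1 := hasFDerivAt_forwardChar hp.int hk (z := (z.2 - z.1, z.1)) (abs_lt.1 h').1
    (Or.inr hd) (by
      have := continuousAt_snd (p := (z.2 - z.1, z.1)) |>.tendsto.eventually hpc
      filter_upwards [this] with w hw
      exact (ContinuousAt.comp (f := Prod.snd) hw.1.continuousAt continuousAt_snd).mul
        (ContinuousAt.comp (f := fun w : ℝ × ℝ => (w.2, w.1 + w.2))
          (continuousAt_lineWave hW hg (z := (w.2, w.1 + w.2)) hw.2) (by fun_prop)))
  have h2 := hasFDerivAt_backwardChar hp.int hk (z := (z.2 + z.1, z.1)) (abs_lt.1 h').2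
    (Or.inr hd) (by
      have := continuousAt_snd (p := (z.2 + z.1, z.1)) |>.tendsto.eventually hpc
      filter_upwards [this] with w hw
      exact (ContinuousAt.comp (f := Prod.snd) hw.1.continuousAt continuousAt_snd).mul
        (ContinuousAt.comp (f := fun w : ℝ × ℝ => (w.2, w.1 - w.2))
          (continuousAt_lineWave hW hg (z := (w.2, w.1 - w.2)) hw.2) (by fun_prop)))
  simp only [sub_add_cancel, add_sub_cancel_right] at h1 h2
  exact ⟨h1, h2⟩

theorem hasFDerivAt_zero_of_lt {G : ℝ × ℝ → ℝ} (hG : ∀ z : ℝ × ℝ, z.2 ≤ |z.1| → G z = 0)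
    {z : ℝ × ℝ} (h : z.2 < |z.1|) : HasFDerivAt G (gradCLM 0 0) z := by
  refine ((hasFDerivAt_const (0 : ℝ) z).congr_of_eventuallyEq ?_).congr_fderiv ?_
  · filter_upwards [eventually_lt_abs h] with w hw using hG w hw.le
  · ext <;> simp

theorem IsWaveKernel.hasFDerivAt_lineWave (hp : IsLinePotential p) (hW : IsWaveKernel p cp cm W)
    (hf : IsSignal f) {z : ℝ × ℝ} (h : z.1 ≠ 0) (hz : z.2 < 2 * π) :
    HasFDerivAt (fun z : ℝ × ℝ => lineWave cp cm W f z.1 z.2)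
      (gradCLM (lineWaveX p cp cm W f z) (lineWave cp cm W (deriv f) z.1 z.2)) z := by
  rcases lt_or_ge |z.1| (2 * π) with h' | h'
  · obtain ⟨g, hg, rfl⟩ := hf.exists_primitive
    obtain ⟨h1, h2⟩ := hasFDerivAt_char_lineWave (cp := cp) (cm := cm) hp hW.cont hg h h'
    have := (hasFDerivAt_jump (cp := cp) (cm := cm) hf h).sub
      (((hasFDerivAt_comp_forward h1).add (hasFDerivAt_comp_backward h2)).const_mul (1 / 2))
    refine (this.congr_of_eventuallyEq
      (Eventually.of_forall fun w => hW.lineWave_eq hp hg w.1 w.2)).congr_fderiv ?_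
    rw [hW.lineWave_eq hp hg.deriv z.1 z.2]
    unfold lineWaveX charDiff
    ext <;> simp <;> ring
  · have hlt := hz.trans_le h'
    rw [lineWaveX_of_le hp hW.cont hf hlt.le, lineWave_of_le cp cm hf.deriv.zero hlt.le]
    exact hasFDerivAt_zero_of_lt (fun w hw => lineWave_of_le cp cm hf.zero hw) hlt

/-- The endpoint terms `p v` of the two characteristic integrals cancel in the first derivative, but
they add up here, because the forward integral enters `charDiff` with the opposite sign. This
produces `v_xx = v_tt + p v`. -/
theorem IsWaveKernel.hasFDerivAt_lineWaveX (hp : IsLinePotential p) (hW : IsWaveKernel p cp cm W)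
    (hf : IsSignal f) {z : ℝ × ℝ} (h : z.1 ≠ 0) (hz : z.2 < 2 * π) :
    HasFDerivAt (lineWaveX p cp cm W f)
      (gradCLM (lineWave cp cm W (deriv (deriv f)) z.1 z.2 +
        p z.1 * lineWave cp cm W f z.1 z.2) (lineWaveX p cp cm W (deriv f) z)) z := by
  rcases lt_or_ge |z.1| (2 * π) with h' | h'
  · obtain ⟨h1, h2⟩ := hasFDerivAt_char_lineWave (cp := cp) (cm := cm) hp hW.cont hf h h'
    have := (hasFDerivAt_jump (cp := -cp) (cm := cm) hf.deriv h).add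
      (((hasFDerivAt_comp_forward h1).neg.add (hasFDerivAt_comp_backward h2)).const_mul (-(1 / 2)))
    refine this.congr_fderiv ?_
    rw [hW.lineWave_eq hp hf.deriv z.1 z.2]
    unfold lineWaveX charDiff
    rw [neg_neg]
    ext <;> simp <;> ring
  · have hlt := hz.trans_le h'
    rw [lineWaveX_of_le hp hW.cont hf.deriv hlt.le,
      lineWave_of_le cp cm hf.deriv.deriv.zero hlt.le, lineWave_of_le cp cm hf.zero hlt.le,
      mul_zero, add_zero]
    exact hasFDerivAt_zero_of_lt (fun w hw => lineWaveX_of_le hp hW.cont hf hw) hlt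

theorem IsCausal.memLp {k : ℝ → ℝ → ℝ} (hk : IsCausal k) (t : ℝ) : MemLp (fun x => k x t) 2 := by
  obtain ⟨C, hC⟩ := hk.bdd t
  have h1 : MemLp ((Icc (-t) t).indicator fun _ => C) 2 :=
    memLp_indicator_const 2 measurableSet_Icc C (Or.inr (by simp))
  refine h1.of_le_mul (c := 1)
    (hk.meas.comp (f := fun x : ℝ => (x, t)) (by fun_prop)).aestronglyMeasurable
    (Eventually.of_forall fun x => ?_)
  rw [one_mul]
  by_cases hx : x ∈ Icc (-t) t
  · rw [indicator_of_mem hx]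
    exact (hC x t le_rfl).trans (le_abs_self C)
  · rw [hk.zero x t, norm_zero]
    · positivity
    · by_contra! h
      exact hx (abs_le.1 h.le)

theorem memLp_lineWaveX (hp : IsLinePotential p) (hW : Continuous (Function.uncurry W))
    (hf : IsSignal f) {t : ℝ} (ht : t < 2 * π) :
    MemLp (fun x => lineWaveX p cp cm W f (x, t)) 2 := by
  have h1 : IsCausal fun y τ => jump (-cp) cm y * deriv f (τ - |y|) + 0 :=
    isCausal_jump (-cp) cm (k₁ := fun y τ => deriv f (τ - |y|)) (k₂ := fun _ _ => 0)
      (hf.deriv.continuous.comp (f := fun z : ℝ × ℝ => z.2 - |z.1|) (by fun_prop))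
      continuous_const (fun _ _ h => hf.deriv.zero _ (by linarith)) fun _ _ _ => rfl
  have hk := isCausal_lineWave cp cm hW hf.continuous hf.zero
  have h2 : Continuous fun x : ℝ => charDiff p (lineWave cp cm W f) (x, t) :=
    continuous_iff_continuousAt.2 fun x => ContinuousAt.comp (f := fun x : ℝ => (x, t))
      (continuousAt_charDiff hp hk (continuous_lineWave cp cm hW hf.continuous) ht) (by fun_prop)
  have h3 : MemLp (fun x : ℝ => charDiff p (lineWave cp cm W f) (x, t)) 2 := by
    refine h2.memLp_of_hasCompactSupport (HasCompactSupport.intro (isCompact_Icc (a := -t) (b := t))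
      fun x hx => charDiff_of_le hp hk ?_)
    by_contra! h
    exact hx (abs_le.1 h.le)
  have h1' := h1.memLp t
  simp only [add_zero] at h1'
  exact h1'.add h3

theorem memLp_mul_lineWave (hp : IsLinePotential p) (hW : Continuous (Function.uncurry W))
    (hf : IsSignal f) (t : ℝ) : MemLp (fun x => p x * lineWave cp cm W f x t) 2 := by
  have hk := isCausal_lineWave cp cm hW hf.continuous hf.zero
  obtain ⟨C, hC⟩ := hk.bdd t
  refine hp.memLp.of_le_mul (c := C) (hp.memLp.aestronglyMeasurable.mul
    (hk.meas.comp (f := fun x : ℝ => (x, t)) (by fun_prop)).aestronglyMeasurable)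
    (Eventually.of_forall fun x => ?_)
  rw [norm_mul, mul_comm]
  exact mul_le_mul_of_nonneg_right (hC x t le_rfl) (norm_nonneg _)

end Derivatives

/-! ### Traces at the origin and classical solutions on the line -/

/-- For `t < 2π`, `g` extends continuously to the line `x = 0` from both sides, with jump `j`. -/
def HasTraces (g : ℝ × ℝ → ℝ) (j : ℝ → ℝ) : Prop :=
  ∃ R L : ℝ × ℝ → ℝ, (∀ z, z.2 < 2 * π → ContinuousAt R z) ∧
    (∀ z, z.2 < 2 * π → ContinuousAt L z) ∧ (∀ z, 0 < z.1 → g z = R z) ∧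
    (∀ z, z.1 < 0 → g z = L z) ∧ ∀ t, R (0, t) - L (0, t) = j t

theorem HasTraces.add {g g' : ℝ × ℝ → ℝ} {j j' : ℝ → ℝ} (h : HasTraces g j)
    (h' : HasTraces g' j') : HasTraces (fun z => g z + g' z) (fun t => j t + j' t) := by
  obtain ⟨R, L, h1, h2, h3, h4, h5⟩ := h
  obtain ⟨R', L', h1', h2', h3', h4', h5'⟩ := h'
  refine ⟨fun z => R z + R' z, fun z => L z + L' z, fun z hz => (h1 z hz).add (h1' z hz),
    fun z hz => (h2 z hz).add (h2' z hz), fun z hz => ?_, fun z hz => ?_, fun t => ?_⟩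
  · simp only [h3 z hz, h3' z hz]
  · simp only [h4 z hz, h4' z hz]
  · simp only [← h5, ← h5']
    ring

theorem HasTraces.continuousAt {g : ℝ × ℝ → ℝ} {j : ℝ → ℝ} (h : HasTraces g j) {z : ℝ × ℝ}
    (hz : z.1 ≠ 0) (hz' : z.2 < 2 * π) : ContinuousAt g z := by
  obtain ⟨R, L, h1, h2, h3, h4, -⟩ := h
  have hfst : Tendsto (fun w : ℝ × ℝ => w.1) (𝓝 z) (𝓝 z.1) := continuousAt_fst
  rcases lt_or_gt_of_ne hz with h | h
  · exact (h2 z hz').congr (by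
      filter_upwards [hfst.eventually (eventually_lt_nhds h)] with w hw using (h4 w hw).symm)
  · exact (h1 z hz').congr (by
      filter_upwards [hfst.eventually (eventually_gt_nhds h)] with w hw using (h3 w hw).symm)

theorem HasTraces.extends {g g' : ℝ × ℝ → ℝ} {j : ℝ → ℝ} (h : HasTraces g j)
    (he : ∀ z, z.1 ≠ 0 → z.2 < 2 * π → g' z = g z) :
    ExtendsContinuously g' (Iio 0 ×ˢ Ioo 0 (2 * π)) (closure (Iio 0) ×ˢ Ico 0 (2 * π)) ∧
    ExtendsContinuously g' (Ioi 0 ×ˢ Ioo 0 (2 * π)) (closure (Ioi 0) ×ˢ Ico 0 (2 * π)) := by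
  obtain ⟨R, L, h1, h2, h3, h4, -⟩ := h
  refine ⟨⟨L, fun z hz => (h2 z hz.2.2).continuousWithinAt, fun z hz => ?_⟩,
    ⟨R, fun z hz => (h1 z hz.2.2).continuousWithinAt, fun z hz => ?_⟩⟩
  · rw [he z (ne_of_lt hz.1) hz.2.2, h4 z hz.1]
  · rw [he z (ne_of_gt hz.1) hz.2.2, h3 z hz.1]

theorem HasTraces.exists_tendsto {g : ℝ × ℝ → ℝ} {j : ℝ → ℝ} (h : HasTraces g j) {t : ℝ}
    (ht : t < 2 * π) : ∃ r l : ℝ, Tendsto (fun x => g (x, t)) (𝓝[>] 0) (𝓝 r) ∧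
      Tendsto (fun x => g (x, t)) (𝓝[<] 0) (𝓝 l) ∧ r - l = j t := by
  obtain ⟨R, L, h1, h2, h3, h4, h5⟩ := h
  have hc : Continuous fun x : ℝ => (x, t) := by fun_prop
  refine ⟨R (0, t), L (0, t), ?_, ?_, h5 t⟩
  · refine ((ContinuousAt.comp (f := fun x : ℝ => (x, t)) (h1 (0, t) ht) hc.continuousAt).tendsto.mono_left
      nhdsWithin_le_nhds).congr' ?_
    filter_upwards [self_mem_nhdsWithin] with x hx using (h3 (x, t) hx).symm
  · refine ((ContinuousAt.comp (f := fun x : ℝ => (x, t)) (h2 (0, t) ht) hc.continuousAt).tendsto.mono_left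
      nhdsWithin_le_nhds).congr' ?_
    filter_upwards [self_mem_nhdsWithin] with x hx using (h4 (x, t) hx).symm

section LineWave

variable {p : ℝ → ℝ} {cp cm : ℝ} {W : ℝ → ℝ → ℝ} {f : ℝ → ℝ}

theorem hasTraces_lineWave (hW : Continuous (Function.uncurry W)) (hf : Continuous f) :
    HasTraces (fun z => lineWave cp cm W f z.1 z.2) fun t => (cp - cm) * f t := by
  have hk := continuous_kernelConv hW hf
  refine ⟨fun z => cp * f (z.2 - z.1) + Function.uncurry (kernelConv W f) z,
    fun z => cm * f (z.2 + z.1) + Function.uncurry (kernelConv W f) z,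
    fun z _ => Continuous.continuousAt (by fun_prop),
    fun z _ => Continuous.continuousAt (by fun_prop), fun z hz => ?_, fun z hz => ?_, fun t => ?_⟩
  · simp [lineWave, jump, hz, abs_of_pos hz, Function.uncurry]
  · simp [lineWave, jump, hz.not_gt, abs_of_neg hz, Function.uncurry]
  · simp only [sub_zero, add_zero]
    ring

theorem hasTraces_lineWaveX (hp : IsLinePotential p) (hW : Continuous (Function.uncurry W))
    (hf : IsSignal f) :
    HasTraces (lineWaveX p cp cm W f) fun t => -(cp + cm) * deriv f t := by
  have hk := isCausal_lineWave cp cm hW hf.continuous hf.zero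
  have hc : ∀ z : ℝ × ℝ, z.2 < 2 * π → ContinuousAt (charDiff p (lineWave cp cm W f)) z :=
    fun z hz => continuousAt_charDiff hp hk (continuous_lineWave cp cm hW hf.continuous) hz
  have hd := hf.deriv.continuous
  refine ⟨fun z => -cp * deriv f (z.2 - z.1) + charDiff p (lineWave cp cm W f) z,
    fun z => cm * deriv f (z.2 + z.1) + charDiff p (lineWave cp cm W f) z,
    fun z hz => (Continuous.continuousAt (by fun_prop)).add (hc z hz),
    fun z hz => (Continuous.continuousAt (by fun_prop)).add (hc z hz),
    fun z hz => ?_, fun z hz => ?_, fun t => ?_⟩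
  · simp [lineWaveX, jump, hz, abs_of_pos hz]
  · simp [lineWaveX, jump, hz.not_gt, abs_of_neg hz]
  · simp only [sub_zero, add_zero]
    ring

end LineWave

/-- A classical wave on the punctured line, at rest outside the light cone of the origin, with its
derivatives up to the second order and its jumps at the origin. -/
structure IsLineWave (p : ℝ → ℝ) (j j' : ℝ → ℝ) (v vx vt vxt vtt : ℝ × ℝ → ℝ) : Prop where
  d : ∀ z : ℝ × ℝ, z.1 ≠ 0 → z.2 < 2 * π → HasFDerivAt v (gradCLM (vx z) (vt z)) z
  dx : ∀ z : ℝ × ℝ, z.1 ≠ 0 → z.2 < 2 * π →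
    HasFDerivAt vx (gradCLM (vtt z + p z.1 * v z) (vxt z)) z
  dt : ∀ z : ℝ × ℝ, z.1 ≠ 0 → z.2 < 2 * π → HasFDerivAt vt (gradCLM (vxt z) (vtt z)) z
  tr : HasTraces v j
  trx : HasTraces vx j'
  trt : ∃ k, HasTraces vt k
  trxt : ∃ k, HasTraces vxt k
  trtt : ∃ k, HasTraces vtt k
  zero : ∀ z : ℝ × ℝ, z.2 ≤ |z.1| → v z = 0
  zero_t : ∀ z : ℝ × ℝ, z.2 ≤ |z.1| → vt z = 0
  memLp : ∀ t < 2 * π, MemLp (fun x => v (x, t)) 2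
  memLp_x : ∀ t < 2 * π, MemLp (fun x => vx (x, t)) 2
  memLp_xx : ∀ t < 2 * π, MemLp (fun x => vtt (x, t) + p x * v (x, t)) 2

theorem gradCLM_add (a b a' b' : ℝ) : gradCLM a b + gradCLM a' b' = gradCLM (a + a') (b + b') := by
  ext <;> simp

theorem IsWaveKernel.isLineWave {p : ℝ → ℝ} {cp cm : ℝ} {W : ℝ → ℝ → ℝ} {f : ℝ → ℝ}
    (hp : IsLinePotential p) (hW : IsWaveKernel p cp cm W) (hf : IsSignal f) :
    IsLineWave p (fun t => (cp - cm) * f t) (fun t => -(cp + cm) * deriv f t)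
      (fun z => lineWave cp cm W f z.1 z.2) (lineWaveX p cp cm W f)
      (fun z => lineWave cp cm W (deriv f) z.1 z.2) (lineWaveX p cp cm W (deriv f))
      (fun z => lineWave cp cm W (deriv (deriv f)) z.1 z.2) where
  d _ h h' := hW.hasFDerivAt_lineWave hp hf h h'
  dx _ h h' := hW.hasFDerivAt_lineWaveX hp hf h h'
  dt _ h h' := hW.hasFDerivAt_lineWave hp hf.deriv h h'
  tr := hasTraces_lineWave hW.cont hf.continuous
  trx := hasTraces_lineWaveX hp hW.cont hf
  trt := ⟨_, hasTraces_lineWave hW.cont hf.deriv.continuous⟩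
  trxt := ⟨_, hasTraces_lineWaveX hp hW.cont hf.deriv⟩
  trtt := ⟨_, hasTraces_lineWave hW.cont hf.deriv.deriv.continuous⟩
  zero _ h := lineWave_of_le cp cm hf.zero h
  zero_t _ h := lineWave_of_le cp cm hf.deriv.zero h
  memLp t _ := (isCausal_lineWave cp cm hW.cont hf.continuous hf.zero).memLp t
  memLp_x _ ht := memLp_lineWaveX hp hW.cont hf ht
  memLp_xx t _ := ((isCausal_lineWave cp cm hW.cont hf.deriv.deriv.continuous
    hf.deriv.deriv.zero).memLp t).add (memLp_mul_lineWave hp hW.cont hf t)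

section Solution

variable {p j j' k k' : ℝ → ℝ} {v vx vt vxt vtt w wx wt wxt wtt : ℝ × ℝ → ℝ}

theorem IsLineWave.add (hv : IsLineWave p j j' v vx vt vxt vtt)
    (hw : IsLineWave p k k' w wx wt wxt wtt) :
    IsLineWave p (fun t => j t + k t) (fun t => j' t + k' t) (fun z => v z + w z)
      (fun z => vx z + wx z) (fun z => vt z + wt z) (fun z => vxt z + wxt z)
      (fun z => vtt z + wtt z) where
  d z h h' := ((hv.d z h h').add (hw.d z h h')).congr_fderiv (gradCLM_add ..)
  dx z h h' := by
    refine ((hv.dx z h h').add (hw.dx z h h')).congr_fderiv ?_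
    rw [gradCLM_add]
    congr 1
    ring
  dt z h h' := ((hv.dt z h h').add (hw.dt z h h')).congr_fderiv (gradCLM_add ..)
  tr := hv.tr.add hw.tr
  trx := hv.trx.add hw.trx
  trt := ⟨_, hv.trt.choose_spec.add hw.trt.choose_spec⟩
  trxt := ⟨_, hv.trxt.choose_spec.add hw.trxt.choose_spec⟩
  trtt := ⟨_, hv.trtt.choose_spec.add hw.trtt.choose_spec⟩
  zero z h := by simp only [hv.zero z h, hw.zero z h, add_zero]
  zero_t z h := by simp only [hv.zero_t z h, hw.zero_t z h, add_zero]
  memLp t ht := (hv.memLp t ht).add (hw.memLp t ht)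
  memLp_x t ht := (hv.memLp_x t ht).add (hw.memLp_x t ht)
  memLp_xx t ht := by
    refine ((hv.memLp_xx t ht).add (hw.memLp_xx t ht)).ae_eq (Eventually.of_forall fun x => ?_)
    simp only [Pi.add_apply]
    ring

theorem IsLineWave.continuousAt_potential_mul (hp : IsLinePotential p)
    (hv : IsLineWave p j j' v vx vt vxt vtt) {z : ℝ × ℝ} (h : z.1 ≠ 0) (h' : z.2 < 2 * π) :
    ContinuousAt (fun z : ℝ × ℝ => p z.1 * v z) z := by
  rcases lt_or_ge |z.1| (2 * π) with hz | hz
  · exact (ContinuousAt.comp (f := Prod.fst)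
      (hp.eventually_contDiffAt h hz).self_of_nhds.continuousAt continuousAt_fst).mul
      (hv.tr.continuousAt h h')
  -- Here `|x| ≥ 2π > t`, outside the light cone: the wave vanishes nearby, and the possible
  -- singularity of `p` at `±2π` does no harm.
  · refine (continuousAt_const (y := (0 : ℝ))).congr ?_
    filter_upwards [eventually_lt_abs (h'.trans_le hz)] with w hw
    rw [hv.zero w hw.le, mul_zero]

theorem isOpen_punctured : IsOpen {z : ℝ × ℝ | z.1 ≠ 0 ∧ z.2 < 2 * π} :=
  (isOpen_ne_fun continuous_fst continuous_const).inter (isOpen_lt continuous_snd continuous_const)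

theorem IsLineWave.contDiffOn (hp : IsLinePotential p) (hv : IsLineWave p j j' v vx vt vxt vtt) :
    ContDiffOn ℝ 2 v {z : ℝ × ℝ | z.1 ≠ 0 ∧ z.2 < 2 * π} := by
  obtain ⟨k₁, h₁⟩ := hv.trxt
  obtain ⟨k₂, h₂⟩ := hv.trtt
  have c₁ : ContinuousOn vxt {z : ℝ × ℝ | z.1 ≠ 0 ∧ z.2 < 2 * π} := fun z hz =>
    (h₁.continuousAt hz.1 hz.2).continuousWithinAt
  have c₂ : ContinuousOn vtt {z : ℝ × ℝ | z.1 ≠ 0 ∧ z.2 < 2 * π} := fun z hz =>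
    (h₂.continuousAt hz.1 hz.2).continuousWithinAt
  refine contDiffOn_two_of_hasFDerivAt isOpen_punctured (fun z hz => hv.d z hz.1 hz.2)
    (contDiffOn_one_of_hasFDerivAt isOpen_punctured (fun z hz => hv.dx z hz.1 hz.2) ?_ c₁)
    (contDiffOn_one_of_hasFDerivAt isOpen_punctured (fun z hz => hv.dt z hz.1 hz.2) c₁ c₂)
  exact c₂.add fun z hz => (hv.continuousAt_potential_mul hp hz.1 hz.2).continuousWithinAt

theorem IsLineWave.hasDerivAt_x (hv : IsLineWave p j j' v vx vt vxt vtt) {x t : ℝ} (h : x ≠ 0)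
    (h' : t < 2 * π) : HasDerivAt (fun y => v (y, t)) (vx (x, t)) x :=
  hasDerivAt_fst_of_hasFDerivAt (hv.d (x, t) h h')

theorem IsLineWave.hasDerivAt_t (hv : IsLineWave p j j' v vx vt vxt vtt) {x t : ℝ} (h : x ≠ 0)
    (h' : t < 2 * π) : HasDerivAt (fun s => v (x, s)) (vt (x, t)) t :=
  hasDerivAt_snd_of_hasFDerivAt (hv.d (x, t) h h')

theorem IsLineWave.hasDerivAt_xx (hv : IsLineWave p j j' v vx vt vxt vtt) {x t : ℝ} (h : x ≠ 0)
    (h' : t < 2 * π) :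
    HasDerivAt (deriv fun y => v (y, t)) (vtt (x, t) + p x * v (x, t)) x := by
  refine (hasDerivAt_fst_of_hasFDerivAt (hv.dx (x, t) h h')).congr_of_eventuallyEq ?_
  filter_upwards [eventually_ne_nhds h] with y hy using (hv.hasDerivAt_x hy h').deriv

theorem IsLineWave.hasDerivAt_tt (hv : IsLineWave p j j' v vx vt vxt vtt) {x t : ℝ} (h : x ≠ 0)
    (h' : t < 2 * π) : HasDerivAt (deriv fun s => v (x, s)) (vtt (x, t)) t := by
  refine (hasDerivAt_snd_of_hasFDerivAt (hv.dt (x, t) h h')).congr_of_eventuallyEq ?_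
  filter_upwards [eventually_lt_nhds h'] with s hs using (hv.hasDerivAt_t h hs).deriv

theorem MemC2H2.of_hasDerivAt {f f' f'' : ℝ → ℝ} {s : Set ℝ} (hs : IsOpen s)
    (hc : ContDiffOn ℝ 2 f s) (h : ∀ x ∈ s, HasDerivAt f (f' x) x)
    (h' : ∀ x ∈ s, HasDerivAt (deriv f) (f'' x) x) (m : MemLp f 2 (volume.restrict s))
    (m' : MemLp f' 2 (volume.restrict s)) (m'' : MemLp f'' 2 (volume.restrict s)) :
    MemC2H2 f s := by
  refine ⟨hc, m, m'.ae_eq ?_, m''.ae_eq ?_⟩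
  · filter_upwards [ae_restrict_mem hs.measurableSet] with x hx using (h x hx).deriv.symm
  · filter_upwards [ae_restrict_mem hs.measurableSet] with x hx using (h' x hx).deriv.symm

theorem IsLineWave.isLineSolution (hp : IsLinePotential p)
    (hv : IsLineWave p j j' v vx vt vxt vtt) {F : ℝ → ℝ × ℝ} (h1 : ∀ t, j t = (F t).1)
    (h2 : ∀ t, j' t = deriv (fun s => (F s).2) t) :
    IsLineSolution p (2 * π) F fun x t => v (x, t) := by
  have hx : ∀ z : ℝ × ℝ, z.1 ≠ 0 → z.2 < 2 * π → deriv (fun x => v (x, z.2)) z.1 = vx z :=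
    fun z h h' => (hv.hasDerivAt_x h h').deriv
  have ht : ∀ z : ℝ × ℝ, z.1 ≠ 0 → z.2 < 2 * π → deriv (fun s => v (z.1, s)) z.2 = vt z :=
    fun z h h' => (hv.hasDerivAt_t h h').deriv
  obtain ⟨k, hk⟩ := hv.trt
  have mem : ∀ s : Set ℝ, IsOpen s → (∀ x ∈ s, x ≠ 0) → ∀ t ∈ Ioo 0 (2 * π),
      MemC2H2 (fun x => v (x, t)) s := fun s hs h0 t ht =>
    .of_hasDerivAt hs ((hv.contDiffOn hp).comp (f := fun x : ℝ => (x, t))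
      (by fun_prop) fun x hx => ⟨h0 x hx, ht.2⟩)
      (fun x hx => hv.hasDerivAt_x (h0 x hx) ht.2) (fun x hx => hv.hasDerivAt_xx (h0 x hx) ht.2)
      ((hv.memLp t ht.2).restrict s) ((hv.memLp_x t ht.2).restrict s)
      ((hv.memLp_xx t ht.2).restrict s)
  have et := hv.tr.extends (g' := fun z => v (z.1, z.2)) fun _ _ _ => rfl
  have ex := hv.trx.extends hx
  have ett := hk.extends ht
  refine ⟨(hv.contDiffOn hp).mono fun z hz => ⟨hz.1, hz.2.2⟩, ⟨et.1, ex.1, ett.1⟩,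
    ⟨et.2, ex.2, ett.2⟩, fun t ht => ⟨mem _ isOpen_Iio (fun x hx => ne_of_lt hx) t ht,
      mem _ isOpen_Ioi (fun x hx => ne_of_gt hx) t ht⟩, fun x h t ht => ?_, fun t ht => ?_,
    fun x h => ⟨?_, ?_⟩⟩
  · rw [schrodinger, (hv.hasDerivAt_tt h ht.2).deriv, (hv.hasDerivAt_xx h ht.2).deriv]
    ring
  · obtain ⟨r, l, hr, hl, e⟩ := hv.tr.exists_tendsto ht.2
    obtain ⟨r', l', hr', hl', e'⟩ := hv.trx.exists_tendsto ht.2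
    have hr'' : Tendsto (deriv fun x => v (x, t)) (𝓝[>] 0) (𝓝 r') := hr'.congr' (by
      filter_upwards [self_mem_nhdsWithin] with x h0 using (hx (x, t) (ne_of_gt h0) ht.2).symm)
    have hl'' : Tendsto (deriv fun x => v (x, t)) (𝓝[<] 0) (𝓝 l') := hl'.congr' (by
      filter_upwards [self_mem_nhdsWithin] with x h0 using (hx (x, t) (ne_of_lt h0) ht.2).symm)
    rw [lineGamma0, traceRight, traceRight, traceLeft, traceLeft, hr.limUnder_eq, hl.limUnder_eq,
      hr''.limUnder_eq, hl''.limUnder_eq, e, e', h1, h2]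
  · refine tendsto_const_nhds.congr' ?_
    filter_upwards [mem_nhdsWithin_of_mem_nhds (eventually_lt_nhds (abs_pos.2 h))] with t ht
    exact (hv.zero (x, t) (le_of_lt ht)).symm
  · refine tendsto_const_nhds.congr' ?_
    filter_upwards [mem_nhdsWithin_of_mem_nhds (eventually_lt_nhds (abs_pos.2 h)),
      mem_nhdsWithin_of_mem_nhds (eventually_lt_nhds Real.two_pi_pos)] with t ht ht'
    rw [ht' |> (hv.hasDerivAt_t h ·) |>.deriv, hv.zero_t (x, t) (le_of_lt ht)]

end Solution

/-! ### Superposition over a period -/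

section Periodic

variable {q j j' : ℝ → ℝ} {v vx vt vxt vtt : ℝ × ℝ → ℝ}

/-- The superposition of a function on the line and its translate by the period. -/
def wrap (v : ℝ × ℝ → ℝ) (x t : ℝ) : ℝ := v (x, t) + v (x - 2 * π, t)

theorem tendsto_sub_period : Tendsto (fun x => x - 2 * π) (𝓝[<] (2 * π)) (𝓝[<] 0) := by
  refine tendsto_nhdsWithin_of_tendsto_nhds_of_eventually_within _ ?_ ?_
  · have : ContinuousAt (fun x => x - 2 * π) (2 * π) := by fun_prop
    simpa [ContinuousAt] using this.tendsto.mono_left nhdsWithin_le_nhds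
  · filter_upwards [self_mem_nhdsWithin] with x hx
    simp only [mem_Iio] at hx ⊢
    linarith

/-- Finite speed of propagation: at a time `t < 2π` the translated wave has not reached a
neighbourhood of `x = 0`. -/
theorem eventually_wrap_right {g : ℝ × ℝ → ℝ} (hg : ∀ z : ℝ × ℝ, z.2 < |z.1| → g z = 0) {t : ℝ}
    (ht : t < 2 * π) : ∀ᶠ x in 𝓝[>] 0, wrap g x t = g (x, t) := by
  filter_upwards [mem_nhdsWithin_of_mem_nhds (eventually_lt_nhds (sub_pos.2 ht))] with x hx
  rw [wrap, hg (x - 2 * π, t), add_zero]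
  simp only [lt_abs]
  right
  linarith

theorem eventually_wrap_left {g : ℝ × ℝ → ℝ} (hg : ∀ z : ℝ × ℝ, z.2 < |z.1| → g z = 0) {t : ℝ}
    (ht : t < 2 * π) : ∀ᶠ x in 𝓝[<] (2 * π), wrap g x t = g (x - 2 * π, t) := by
  filter_upwards [mem_nhdsWithin_of_mem_nhds (eventually_gt_nhds ht)] with x hx
  rw [wrap, hg (x, t), zero_add]
  exact lt_abs.2 (Or.inl hx)

theorem IsLineWave.zero_x (hv : IsLineWave (linePotential q) j j' v vx vt vxt vtt) {z : ℝ × ℝ}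
    (h : z.2 < |z.1|) (h' : z.2 < 2 * π) (h0 : z.1 ≠ 0) : vx z = 0 := by
  have e := hasFDerivAt_zero_of_lt hv.zero h
  have := (hv.d z h0 h').unique e
  simpa using congrArg (fun L : ℝ × ℝ →L[ℝ] ℝ => L (1, 0)) this

theorem IsLineWave.hasDerivAt_wrap_x (hv : IsLineWave (linePotential q) j j' v vx vt vxt vtt)
    {x t : ℝ} (h : x ∈ Ioo 0 (2 * π)) (h' : t < 2 * π) :
    HasDerivAt (fun y => wrap v y t) (wrap vx x t) x :=
  (hv.hasDerivAt_x h.1.ne' h').add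
    ((hv.hasDerivAt_x (sub_neg.2 h.2).ne h').comp_sub_const x (2 * π))

/-- The heart of the reduction: the superposition inherits at `0⁺` and `2π⁻` the traces of `v` at
`0⁺` and `0⁻`, so both boundary operators agree. The functions `u` need agree with the waves only
off the origin or inside the period, since uniqueness gives no more. -/
theorem IsLineWave.exists_traces (hv : IsLineWave (linePotential q) j j' v vx vt vxt vtt) {t : ℝ}
    (ht : t < 2 * π) : ∃ r l r' l' : ℝ, r - l = j t ∧ r' - l' = j' t ∧
      (∀ u : ℝ → ℝ, EqOn u (fun x => v (x, t)) {0}ᶜ →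
        lineGamma1 u = ((r' + l') / 2, (-r - l) / 2)) ∧
      ∀ u : ℝ → ℝ, EqOn u (fun x => wrap v x t) (Ioo 0 (2 * π)) →
        Gamma0 u = (r - l, r' - l') ∧ Gamma1 u = ((r' + l') / 2, (-r - l) / 2) := by
  obtain ⟨r, l, hr, hl, e⟩ := hv.tr.exists_tendsto ht
  obtain ⟨r', l', hr', hl', e'⟩ := hv.trx.exists_tendsto ht
  refine ⟨r, l, r', l', e, e', fun u hu => ?_, fun u hu => ?_⟩
  · have hu' : ∀ x ≠ 0, deriv u x = vx (x, t) := fun x hx => by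
      rw [hu.deriv isOpen_compl_singleton hx, (hv.hasDerivAt_x hx ht).deriv]
    have h1 : Tendsto u (𝓝[>] 0) (𝓝 r) := hr.congr' (by
      filter_upwards [self_mem_nhdsWithin] with x h0 using (hu (ne_of_gt h0)).symm)
    have h2 : Tendsto u (𝓝[<] 0) (𝓝 l) := hl.congr' (by
      filter_upwards [self_mem_nhdsWithin] with x h0 using (hu (ne_of_lt h0)).symm)
    have h3 : Tendsto (deriv u) (𝓝[>] 0) (𝓝 r') := hr'.congr' (by
      filter_upwards [self_mem_nhdsWithin] with x h0 using (hu' x (ne_of_gt h0)).symm)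
    have h4 : Tendsto (deriv u) (𝓝[<] 0) (𝓝 l') := hl'.congr' (by
      filter_upwards [self_mem_nhdsWithin] with x h0 using (hu' x (ne_of_lt h0)).symm)
    rw [lineGamma1, traceRight, traceRight, traceLeft, traceLeft, h1.limUnder_eq, h2.limUnder_eq,
      h3.limUnder_eq, h4.limUnder_eq]
  · have hu' : ∀ x ∈ Ioo 0 (2 * π), deriv u x = wrap vx x t := fun x hx => by
      rw [hu.deriv isOpen_Ioo hx, (hv.hasDerivAt_wrap_x hx ht).deriv]
    have hR : ∀ᶠ x in 𝓝[>] (0 : ℝ), x ∈ Ioo 0 (2 * π) := Ioo_mem_nhdsGT Real.two_pi_pos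
    have hL : ∀ᶠ x in 𝓝[<] (2 * π), x ∈ Ioo 0 (2 * π) := Ioo_mem_nhdsLT Real.two_pi_pos
    have h1 : Tendsto u (𝓝[>] 0) (𝓝 r) := hr.congr' (by
      filter_upwards [hR, eventually_wrap_right (fun z hz => hv.zero z hz.le) ht] with x hx hx'
      exact ((hu hx).trans hx').symm)
    have h2 : Tendsto u (𝓝[<] (2 * π)) (𝓝 l) := (hl.comp tendsto_sub_period).congr' (by
      filter_upwards [hL, eventually_wrap_left (fun z hz => hv.zero z hz.le) ht] with x hx hx'
      exact ((hu hx).trans hx').symm)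
    have h3 : Tendsto (deriv u) (𝓝[>] 0) (𝓝 r') := hr'.congr' (by
      filter_upwards [hR, mem_nhdsWithin_of_mem_nhds (eventually_lt_nhds (sub_pos.2 ht))]
        with x hx hx'
      rw [hu' x hx, wrap, hv.zero_x (z := (x - 2 * π, t)) (lt_abs.2 (Or.inr ?_)) ht
        (sub_neg.2 hx.2).ne, add_zero]
      simp only
      linarith)
    have h4 : Tendsto (deriv u) (𝓝[<] (2 * π)) (𝓝 l') := (hl'.comp tendsto_sub_period).congr' (by
      filter_upwards [hL, mem_nhdsWithin_of_mem_nhds (eventually_gt_nhds ht)] with x hx hx'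
      rw [hu' x hx, wrap, hv.zero_x (z := (x, t)) (lt_abs.2 (Or.inl hx')) ht hx.1.ne', zero_add,
        Function.comp_apply])
    rw [Gamma0, Gamma1, traceRight, traceRight, traceLeft, traceLeft, h1.limUnder_eq,
      h2.limUnder_eq, h3.limUnder_eq, h4.limUnder_eq]
    exact ⟨rfl, rfl⟩

theorem HasTraces.extends_wrap {g g' : ℝ × ℝ → ℝ} {k : ℝ → ℝ} (h : HasTraces g k)
    (he : ∀ x ∈ Ioo 0 (2 * π), ∀ t < 2 * π, g' (x, t) = wrap g x t) :
    ExtendsContinuously g' (Ioo 0 (2 * π) ×ˢ Ioo 0 (2 * π))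
      (closure (Ioo 0 (2 * π)) ×ˢ Ico 0 (2 * π)) := by
  obtain ⟨R, L, h1, h2, h3, h4, -⟩ := h
  refine ⟨fun z => R z + L (z.1 - 2 * π, z.2), fun z hz => ContinuousAt.continuousWithinAt ?_,
    fun z hz => ?_⟩
  · exact (h1 z hz.2.2).add (ContinuousAt.comp (f := fun z : ℝ × ℝ => (z.1 - 2 * π, z.2))
      (h2 _ hz.2.2) (by fun_prop))
  · obtain ⟨x, t⟩ := z
    rw [he x hz.1 t hz.2.2, wrap, h3 (x, t) hz.1.1, h4 (x - 2 * π, t) (sub_neg.2 hz.1.2)]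

theorem memLp_wrap {g : ℝ × ℝ → ℝ} {t : ℝ} (h : MemLp (fun x => g (x, t)) 2) :
    MemLp (fun x => wrap g x t) 2 :=
  h.add (h.comp_measurePreserving (measurePreserving_sub_right volume (2 * π)))

theorem linePotential_sub_period {x : ℝ} (h : x ∈ Ioo 0 (2 * π)) :
    linePotential q (x - 2 * π) = q x := by
  rw [linePotential, if_neg fun h' => by linarith [h'.1, h.2],
    if_pos ⟨by linarith [h.1], by linarith [h.2]⟩, sub_add_cancel]

theorem IsLineWave.hasDerivAt_wrap_xx (hv : IsLineWave (linePotential q) j j' v vx vt vxt vtt)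
    {x t : ℝ} (h : x ∈ Ioo 0 (2 * π)) (h' : t < 2 * π) :
    HasDerivAt (deriv fun y => wrap v y t) (wrap vtt x t + q x * wrap v x t) x := by
  have h0 := (sub_neg.2 h.2).ne
  have h1 := ((hasDerivAt_fst_of_hasFDerivAt (hv.dx (x, t) h.1.ne' h')).add
    ((hasDerivAt_fst_of_hasFDerivAt (hv.dx (x - 2 * π, t) h0 h')).comp_sub_const x (2 * π)))
  have h2 : HasDerivAt (fun y => wrap vx y t) (wrap vtt x t + q x * wrap v x t) x := by
    refine h1.congr_deriv ?_
    simp only [linePotential_sub_period h, linePotential_of_pos h.1 h.2, wrap]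
    ring
  refine h2.congr_of_eventuallyEq ?_
  filter_upwards [Ioo_mem_nhds h.1 h.2] with y hy using (hv.hasDerivAt_wrap_x hy h').deriv

theorem IsLineWave.isPeriodicSolution (hq : IsPotential q)
    (hv : IsLineWave (linePotential q) j j' v vx vt vxt vtt) {F : ℝ → ℝ × ℝ}
    (h1 : ∀ t, j t = (F t).1) (h2 : ∀ t, j' t = deriv (fun s => (F s).2) t) :
    IsPeriodicSolution q (2 * π) F (wrap v) := by
  have hp := hq.isLinePotential
  have hd : ContDiffOn ℝ 2 (fun z : ℝ × ℝ => wrap v z.1 z.2)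
      (Ioo 0 (2 * π) ×ˢ Iio (2 * π)) := by
    refine ((hv.contDiffOn hp).mono ?_).add ((hv.contDiffOn hp).comp
      (f := fun z : ℝ × ℝ => (z.1 - 2 * π, z.2)) (by fun_prop) ?_)
    · exact fun z hz => ⟨hz.1.1.ne', hz.2⟩
    · exact fun z hz => ⟨(sub_neg.2 hz.1.2).ne, hz.2⟩
  have ht : ∀ x ∈ Ioo 0 (2 * π), ∀ t < 2 * π, HasDerivAt (wrap v x) (wrap vt x t) t :=
    fun x hx t ht => (hv.hasDerivAt_t hx.1.ne' ht).add (hv.hasDerivAt_t (sub_neg.2 hx.2).ne ht)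
  have htt : ∀ x ∈ Ioo 0 (2 * π), ∀ t < 2 * π,
      HasDerivAt (deriv (wrap v x)) (wrap vtt x t) t := fun x hx t h => by
    have : HasDerivAt (wrap vt x) (wrap vtt x t) t :=
      (hasDerivAt_snd_of_hasFDerivAt (hv.dt (x, t) hx.1.ne' h)).add
        (hasDerivAt_snd_of_hasFDerivAt (hv.dt (x - 2 * π, t) (sub_neg.2 hx.2).ne h))
    refine this.congr_of_eventuallyEq ?_
    filter_upwards [eventually_lt_nhds h] with s hs using (ht x hx s hs).deriv
  obtain ⟨k, hk⟩ := hv.trt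
  refine ⟨hd.mono fun z hz => ⟨hz.1, hz.2.2⟩, ⟨hv.tr.extends_wrap fun _ _ _ _ => rfl,
    hv.trx.extends_wrap fun x hx t h => (hv.hasDerivAt_wrap_x hx h).deriv,
    hk.extends_wrap fun x hx t h => (ht x hx t h).deriv⟩, fun t h => ?_, fun x hx t h => ?_,
    fun t h => ?_, fun x hx => ⟨?_, ?_⟩⟩
  · refine .of_hasDerivAt isOpen_Ioo (hd.comp (f := fun x : ℝ => (x, t)) (by fun_prop)
      fun x hx => ⟨hx, h.2⟩) (fun x hx => hv.hasDerivAt_wrap_x hx h.2)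
      (fun x hx => hv.hasDerivAt_wrap_xx hx h.2) ((memLp_wrap (hv.memLp t h.2)).restrict _)
      ((memLp_wrap (hv.memLp_x t h.2)).restrict _) ?_
    refine ((memLp_wrap (g := fun z => vtt z + linePotential q z.1 * v z)
      (hv.memLp_xx t h.2)).restrict _).ae_eq ?_
    filter_upwards [ae_restrict_mem measurableSet_Ioo] with x hx
    simp only [wrap, linePotential_sub_period hx, linePotential_of_pos hx.1 hx.2]
    ring
  · rw [schrodinger, (htt x hx t h.2).deriv, (hv.hasDerivAt_wrap_xx hx h.2).deriv]
    ring
  · obtain ⟨r, l, r', l', e, e', -, h3⟩ := hv.exists_traces h.2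
    rw [(h3 _ fun _ _ => rfl).1, e, e', h1, h2]
  · refine tendsto_const_nhds.congr' ?_
    filter_upwards [mem_nhdsWithin_of_mem_nhds (eventually_lt_nhds hx.1),
      mem_nhdsWithin_of_mem_nhds (eventually_lt_nhds (sub_pos.2 hx.2))] with t h3 h4
    rw [wrap, hv.zero (x, t) (le_of_lt (lt_abs.2 (Or.inl h3))),
      hv.zero (x - 2 * π, t) (le_of_lt (lt_abs.2 (Or.inr (by simpa using h4)))), add_zero]
  · refine tendsto_const_nhds.congr' ?_
    filter_upwards [mem_nhdsWithin_of_mem_nhds (eventually_lt_nhds hx.1),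
      mem_nhdsWithin_of_mem_nhds (eventually_lt_nhds (sub_pos.2 hx.2)),
      mem_nhdsWithin_of_mem_nhds (eventually_lt_nhds Real.two_pi_pos)] with t h3 h4 h5
    rw [(ht x hx t h5).deriv, wrap, hv.zero_t (x, t) (le_of_lt (lt_abs.2 (Or.inl h3))),
      hv.zero_t (x - 2 * π, t) (le_of_lt (lt_abs.2 (Or.inr (by simpa using h4)))), add_zero]

end Periodic

/-! ### The explicit formulas for vector controls -/

section Formula

variable {q : ℝ → ℝ} {W₁ W₂ : ℝ → ℝ → ℝ} {F : ℝ → ℝ × ℝ}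

/-- The wave on the line with control `F`. -/
def controlWave (W₁ W₂ : ℝ → ℝ → ℝ) (F : ℝ → ℝ × ℝ) (z : ℝ × ℝ) : ℝ :=
  jump (1 / 2) (-(1 / 2)) z.1 * (F (z.2 - |z.1|)).1 - 1 / 2 * (F (z.2 - |z.1|)).2 +
    ∫ s in |z.1|..z.2, (W₁ z.1 s * (F (z.2 - s)).1 + W₂ z.1 s * (F (z.2 - s)).2)

theorem controlWave_of_pos {x t : ℝ} (h : 0 < x) :
    controlWave W₁ W₂ F (x, t) = waveFromZero W₁ W₂ F x t := by
  simp only [controlWave, jump, h, abs_of_pos h, if_pos, waveFromZero]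

theorem controlWave_of_neg {x t : ℝ} (h : x < 0) :
    controlWave W₁ W₂ F (x, t) =
      waveFromTwoPi (fun x => W₁ (x - 2 * π)) (fun x => W₂ (x - 2 * π)) F (x + 2 * π) t := by
  simp only [controlWave, jump, h.not_gt, abs_of_neg h, if_false, waveFromTwoPi]
  rw [show t - -x = t + (x + 2 * π) - 2 * π by ring, show 2 * π - (x + 2 * π) = -x by ring,
    add_sub_cancel_right]

theorem wrap_controlWave {x t : ℝ} (h : x ∈ Ioo 0 (2 * π)) :
    wrap (controlWave W₁ W₂ F) x t = waveFromZero W₁ W₂ F x t +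
      waveFromTwoPi (fun x => W₁ (x - 2 * π)) (fun x => W₂ (x - 2 * π)) F x t := by
  rw [wrap, controlWave_of_pos h.1, controlWave_of_neg (sub_neg.2 h.2), sub_add_cancel]

theorem IsSmoothControl.zero (hF : IsSmoothControl F) {t : ℝ} (ht : t ≤ 0) : F t = 0 :=
  image_eq_zero_of_notMem_tsupport fun h => (hF.2.2 h).not_ge ht

theorem IsSmoothControl.isSignal_fst (hF : IsSmoothControl F) : IsSignal fun t => (F t).1 :=
  ⟨contDiff_fst.comp hF.1, fun t ht => by rw [hF.zero ht]; rfl⟩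

theorem IsSmoothControl.isSignal_snd (hF : IsSmoothControl F) : IsSignal fun t => (F t).2 :=
  ⟨contDiff_snd.comp hF.1, fun t ht => by rw [hF.zero ht]; rfl⟩

theorem controlWave_eq (h₁ : Continuous (Function.uncurry W₁))
    (h₂ : Continuous (Function.uncurry W₂)) (hF : IsSmoothControl F) (z : ℝ × ℝ) :
    controlWave W₁ W₂ F z = lineWave (1 / 2) (-(1 / 2)) W₁ (fun t => (F t).1) z.1 z.2 +
      lineWave (-(1 / 2)) (-(1 / 2)) W₂ (fun t => (F t).2) z.1 z.2 := by
  have c : ∀ {W : ℝ → ℝ → ℝ} {f : ℝ → ℝ}, Continuous (Function.uncurry W) → Continuous f →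
      ∀ a b, IntervalIntegrable (fun s => W z.1 s * f (z.2 - s)) volume a b :=
    fun hW hf a b => ((hW.comp (f := fun s : ℝ => (z.1, s)) (by fun_prop)).mul
      (hf.comp (f := fun s : ℝ => z.2 - s) (by fun_prop))).intervalIntegrable a b
  rw [controlWave, lineWave, lineWave, kernelConv, kernelConv, intervalIntegral.integral_add
    (c h₁ hF.isSignal_fst.continuous _ _) (c h₂ hF.isSignal_snd.continuous _ _)]
  simp only [jump, ite_self]
  ring

/-- A scalar wave jumps by `(cp - cm) f` in value and by `-(cp + cm) f'` in slope. The pair `(1/2,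
-1/2)` puts `f₁` into the value only, the pair `(-1/2, -1/2)` puts `f₂'` into the slope only. -/
theorem exists_isLineWave (hq : IsPotential q)
    (h₁ : IsWaveKernel (linePotential q) (1 / 2) (-(1 / 2)) W₁)
    (h₂ : IsWaveKernel (linePotential q) (-(1 / 2)) (-(1 / 2)) W₂) (hF : IsSmoothControl F) :
    ∃ vx vt vxt vtt, IsLineWave (linePotential q) (fun t => (F t).1)
      (fun t => deriv (fun s => (F s).2) t) (controlWave W₁ W₂ F) vx vt vxt vtt := by
  have h := (h₁.isLineWave hq.isLinePotential hF.isSignal_fst).add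
    (h₂.isLineWave hq.isLinePotential hF.isSignal_snd)
  rw [← funext (controlWave_eq h₁.cont h₂.cont hF)] at h
  have e₁ : (fun t => (1 / 2 - -(1 / 2)) * (F t).1 + (-(1 / 2) - -(1 / 2)) * (F t).2) =
      fun t => (F t).1 := by
    ext t
    ring
  have e₂ : (fun t => -(1 / 2 + -(1 / 2)) * deriv (fun s => (F s).1) t +
      -(-(1 / 2) + -(1 / 2)) * deriv (fun s => (F s).2) t) =
      fun t => deriv (fun s => (F s).2) t := by
    ext t
    ring
  rw [e₁, e₂] at h
  exact ⟨_, _, _, _, h⟩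

theorem isPeriodicSolution_wrap_controlWave (hq : IsPotential q)
    (h₁ : IsWaveKernel (linePotential q) (1 / 2) (-(1 / 2)) W₁)
    (h₂ : IsWaveKernel (linePotential q) (-(1 / 2)) (-(1 / 2)) W₂) (hF : IsSmoothControl F) :
    IsPeriodicSolution q (2 * π) F (wrap (controlWave W₁ W₂ F)) := by
  obtain ⟨vx, vt, vxt, vtt, h⟩ := exists_isLineWave hq h₁ h₂ hF
  exact h.isPeriodicSolution hq (fun _ => rfl) fun _ => rfl

theorem isLineSolution_controlWave (hq : IsPotential q)
    (h₁ : IsWaveKernel (linePotential q) (1 / 2) (-(1 / 2)) W₁)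
    (h₂ : IsWaveKernel (linePotential q) (-(1 / 2)) (-(1 / 2)) W₂) (hF : IsSmoothControl F) :
    IsLineSolution (linePotential q) (2 * π) F fun x t => controlWave W₁ W₂ F (x, t) := by
  obtain ⟨vx, vt, vxt, vtt, h⟩ := exists_isLineWave hq h₁ h₂ hF
  exact h.isLineSolution hq.isLinePotential (fun _ => rfl) fun _ => rfl

end Formula

/-! ### Uniqueness in the cone of dependence -/

section Characteristics

/-- `U` has the gradient `(Ux, Ut)` and solves `U_tt - U_xx + p U = 0` at `z`. -/
def IsWaveAt (p : ℝ → ℝ) (U Ux Ut : ℝ × ℝ → ℝ) (z : ℝ × ℝ) : Prop :=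
  HasFDerivAt U (gradCLM (Ux z) (Ut z)) z ∧ ∃ a b c, HasFDerivAt Ux (gradCLM a b) z ∧
    HasFDerivAt Ut (gradCLM b c) z ∧ c - a + p z.1 * U z = 0

variable {p : ℝ → ℝ} {N : Set ℝ} {x₀ R : ℝ} {U Ux Ut : ℝ × ℝ → ℝ}

theorem integrable_comp_char (hp : Integrable p) {ε : ℝ} (hε : ε = 1 ∨ ε = -1) (x t : ℝ) :
    Integrable (fun τ => p (x + ε * (t - τ))) ∧
      ∫ τ, |p (x + ε * (t - τ))| = ∫ y, |p y| := by
  rcases hε with rfl | rfl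
  · have e : ∀ τ : ℝ, x + 1 * (t - τ) = (x + t) - τ := fun τ => by ring
    simp only [e]
    exact ⟨hp.comp_sub_left (x + t), integral_sub_left_eq_self (fun y => |p y|) volume (x + t)⟩
  · have e : ∀ τ : ℝ, x + -1 * (t - τ) = τ + (x - t) := fun τ => by ring
    simp only [e]
    exact ⟨hp.comp_add_right (x - t), integral_add_right_eq_self (fun y => |p y|) (x - t)⟩

/-- Along `x + ε (t - τ)` the combination `U_t + ε U_x` has derivative `U_tt - U_xx = -p U`, and it
vanishes initially. Integration bounds it by `sup |U|` times the total mass of `p`, whatever the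
local size of `p`. -/
theorem abs_char_le (hN : N.Countable) (hp : Integrable p) (cU : Continuous U)
    (cX : Continuous Ux) (cT : Continuous Ut)
    (hd : ∀ z : ℝ × ℝ, 0 < z.2 → |z.1 - x₀| + z.2 < R → z.1 ∉ N → IsWaveAt p U Ux Ut z)
    (h0 : ∀ x, |x - x₀| < R → U (x, 0) = 0 ∧ Ux (x, 0) = 0 ∧ Ut (x, 0) = 0) {ε : ℝ}
    (hε : ε = 1 ∨ ε = -1) {x t B : ℝ} (ht : 0 ≤ t) (hx : |x - x₀| + t < R)
    (hB : ∀ y τ, y ∉ N → 0 ≤ τ → τ ≤ t → |y - x₀| + τ < R → |U (y, τ)| ≤ B) :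
    |Ut (x, t) + ε * Ux (x, t)| ≤ B * ∫ y, |p y| := by
  have hε' : |ε| = 1 := by rcases hε with rfl | rfl <;> simp
  have hεε : ε * ε = 1 := by rcases hε with rfl | rfl <;> norm_num
  have hε0 : ε ≠ 0 := by rcases hε with rfl | rfl <;> norm_num
  set γ : ℝ → ℝ × ℝ := fun τ => (x + ε * (t - τ), τ) with hγ
  have cγ : Continuous γ := by fun_prop
  have hcone : ∀ τ ≤ t, |(γ τ).1 - x₀| + τ < R := fun τ h => by
    have h1 : |x + ε * (t - τ) - x₀| ≤ |x - x₀| + (t - τ) := by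
      rw [show x + ε * (t - τ) - x₀ = (x - x₀) + ε * (t - τ) by ring]
      refine (abs_add_le _ _).trans ?_
      rw [abs_mul, hε', one_mul, abs_of_nonneg (sub_nonneg.2 h)]
    simp only [hγ]
    linarith
  set S : Set ℝ := {τ | x + ε * (t - τ) ∈ N} with hS
  -- The characteristic crosses the exceptional vertical lines at countably many times, which the
  -- fundamental theorem of calculus may ignore.
  have hSc : S.Countable := hN.preimage_of_injOn (f := fun τ => x + ε * (t - τ))
    fun a _ b _ hab => by
      have : ε * (t - a) = ε * (t - b) := by simpa using hab
      have := mul_left_cancel₀ hε0 this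
      linarith
  obtain ⟨hi, hI⟩ := integrable_comp_char hp hε x t
  have hbd : ∀ᵐ τ, τ ∈ Ioc 0 t → ‖-(p (x + ε * (t - τ)) * U (γ τ))‖ ≤
      B * |p (x + ε * (t - τ))| := by
    filter_upwards [hSc.ae_notMem volume] with τ hτ hτ'
    rw [norm_neg, norm_mul, mul_comm]
    exact mul_le_mul_of_nonneg_right (hB _ _ hτ hτ'.1.le hτ'.2 (hcone τ hτ'.2)) (norm_nonneg _)
  -- The bound is assumed off `N` only, but the complement of a countable set meets the base of the
  -- cone.
  have hB0 : 0 ≤ B := by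
    obtain ⟨y, hy, hy'⟩ : ∃ y ∈ Nᶜ, y ∈ Ioo (x₀ - R) (x₀ + R) := by
      have hR : 0 < R := lt_of_le_of_lt (add_nonneg (abs_nonneg _) ht) hx
      exact ((hN.dense_compl ℝ).inter_open_nonempty _ isOpen_Ioo ⟨x₀, by constructor <;> linarith⟩)
        |>.imp fun y hy => ⟨hy.2, hy.1⟩
    exact (abs_nonneg _).trans (hB y 0 hy le_rfl ht
      (by rw [add_zero, abs_lt]; constructor <;> linarith [hy'.1, hy'.2]))
  have hint : IntervalIntegrable (fun τ => -(p (x + ε * (t - τ)) * U (γ τ))) volume 0 t := by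
    have := hi.intervalIntegrable (a := 0) (b := t)
    exact (this.mul_continuousOn (cU.comp cγ).continuousOn).neg
  have ftc := integral_eq_of_hasDerivAt_off_countable_of_le
    (fun τ => Ut (γ τ) + ε * Ux (γ τ)) (fun τ => -(p (x + ε * (t - τ)) * U (γ τ))) ht hSc
    ((by fun_prop : Continuous fun τ => Ut (γ τ) + ε * Ux (γ τ)).continuousOn)
    (fun τ hτ => by
      obtain ⟨-, a, b, c, h1, h2, h3⟩ := hd (γ τ) hτ.1.1 (hcone τ hτ.1.2.le) hτ.2
      have dγ : HasDerivAt γ (-ε, 1) τ := by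
        have : HasDerivAt (fun τ => x + ε * (t - τ)) (-ε) τ := by
          simpa using (((hasDerivAt_id τ).const_sub t).const_mul ε).const_add x
        exact this.prodMk (hasDerivAt_id τ)
      refine ((h2.comp_hasDerivAt τ dγ).add ((h1.comp_hasDerivAt τ dγ).const_mul ε)).congr_deriv ?_
      simp only [gradCLM_apply]
      linear_combination h3 - a * hεε) hint
  have e1 : γ t = (x, t) := by simp [hγ]
  have e0 : Ut (γ 0) + ε * Ux (γ 0) = 0 := by
    obtain ⟨-, h2, h3⟩ := h0 (γ 0).1 (by simpa using hcone 0 ht)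
    simp only [hγ] at h2 h3 ⊢
    rw [h2, h3]
    ring
  simp only [e1, e0, sub_zero] at ftc
  rw [← ftc]
  have hi' : IntervalIntegrable (fun τ => B * |p (x + ε * (t - τ))|) volume 0 t :=
    (hi.abs.const_mul B).intervalIntegrable
  refine (intervalIntegral.norm_integral_le_of_norm_le ht hbd hi').trans ?_
  rw [intervalIntegral.integral_const_mul, intervalIntegral.integral_of_le ht]
  refine mul_le_mul_of_nonneg_left ?_ hB0
  rw [← hI]
  exact setIntegral_le_integral hi.abs (Eventually.of_forall fun _ => abs_nonneg _)

/-- Uniqueness in the cone of dependence. -/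
theorem eq_zero_of_isWaveAt (hN : N.Countable) (hp : Integrable p) (cU : Continuous U)
    (cX : Continuous Ux) (cT : Continuous Ut)
    (hd : ∀ z : ℝ × ℝ, 0 < z.2 → |z.1 - x₀| + z.2 < R → z.1 ∉ N → IsWaveAt p U Ux Ut z)
    (h0 : ∀ x, |x - x₀| < R → U (x, 0) = 0 ∧ Ux (x, 0) = 0 ∧ Ut (x, 0) = 0) {t : ℝ}
    (ht : 0 ≤ t) (htR : t < R) (hx : x₀ ∉ N) : U (x₀, t) = 0 := by
  set κ := ∫ y, |p y| with hκ
  have hκ0 : 0 ≤ κ := integral_nonneg fun _ => abs_nonneg _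
  obtain ⟨C, hC⟩ := ((isCompact_Icc (a := x₀ - R) (b := x₀ + R)).prod
    (isCompact_Icc (a := 0) (b := R))).exists_bound_of_continuousOn cU.continuousOn
  -- Picard iteration: each step integrates the previous bound once in time and multiplies it by
  -- `κ`.
  have key : ∀ n : ℕ, ∀ x t, x ∉ N → 0 ≤ t → |x - x₀| + t < R →
      |U (x, t)| ≤ C * (κ ^ n * t ^ n / n.factorial) := by
    intro n
    induction n with
    | zero =>
      intro x t _ ht h
      have h1 := abs_nonneg (x - x₀)
      have h2 := abs_le.1 (by linarith : |x - x₀| ≤ R)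
      simpa using hC (x, t) ⟨⟨by linarith [h2.1], by linarith [h2.2]⟩, ht, by linarith⟩
    | succ n ih =>
      intro x t hx ht h
      have hC0 : 0 ≤ C := by
        have h1 := abs_nonneg (x - x₀)
        exact (norm_nonneg _).trans (hC (x₀, 0) ⟨⟨by linarith, by linarith⟩, le_rfl, by linarith⟩)
      have hb : ∀ τ ∈ Icc 0 t, |Ut (x, τ)| ≤ C * (κ ^ n * τ ^ n / n.factorial) * κ := by
        intro τ hτ
        have hB : ∀ y s, y ∉ N → 0 ≤ s → s ≤ τ → |y - x₀| + s < R →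
            |U (y, s)| ≤ C * (κ ^ n * τ ^ n / n.factorial) := fun y s hy hs hsτ hys =>
          (ih y s hy hs hys).trans (by gcongr)
        -- `U_t` is the mean of `U_t + U_x` and `U_t - U_x`, so it obeys their common bound.
        have h1 := abs_char_le hN hp cU cX cT hd h0 (Or.inl rfl) hτ.1
          (by linarith [hτ.2] : |x - x₀| + τ < R) hB
        have h2 := abs_char_le hN hp cU cX cT hd h0 (Or.inr rfl) hτ.1
          (by linarith [hτ.2] : |x - x₀| + τ < R) hB
        rw [abs_le] at h1 h2 ⊢
        constructor <;> linarith [h1.1, h1.2, h2.1, h2.2]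
      have cTx : Continuous fun τ => Ut (x, τ) := by fun_prop
      have ftc := intervalIntegral.integral_eq_sub_of_hasDerivAt_of_le ht
        (f := fun τ => U (x, τ)) (f' := fun τ => Ut (x, τ)) (by fun_prop)
        (fun τ hτ => hasDerivAt_snd_of_hasFDerivAt (hd (x, τ) hτ.1
          (by simp only; linarith [hτ.2]) hx).1) (cTx.intervalIntegrable _ _)
      rw [(h0 x (by linarith)).1, sub_zero] at ftc
      rw [← ftc]
      have cb : Continuous fun τ : ℝ => C * (κ ^ n * τ ^ n / n.factorial) * κ := by fun_prop
      refine (intervalIntegral.norm_integral_le_of_norm_le (f := fun τ => Ut (x, τ)) ht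
        (Eventually.of_forall fun τ hτ => hb τ ⟨hτ.1.le, hτ.2⟩) (cb.intervalIntegrable _ _)).trans (le_of_eq ?_)
      have e : (fun τ : ℝ => C * (κ ^ n * τ ^ n / n.factorial) * κ) =
          fun τ => C * κ ^ (n + 1) / n.factorial * τ ^ n := by
        ext τ
        ring
      rw [e, intervalIntegral.integral_const_mul, integral_pow, Nat.factorial_succ]
      push_cast
      have := n.cast_add_one_ne_zero (R := ℝ)
      have := n.factorial_ne_zero
      field_simp
      simp
  have lim : Tendsto (fun n : ℕ => C * (κ ^ n * t ^ n / n.factorial)) atTop (𝓝 0) := by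
    have := (FloorSemiring.tendsto_pow_div_factorial_atTop (κ * t)).const_mul C
    simpa [mul_pow] using this
  have := ge_of_tendsto' lim fun n => key n x₀ t hx ht (by simpa using htR)
  exact abs_eq_zero.1 (le_antisymm this (abs_nonneg _))

end Characteristics

/-! ### Waves at rest, continuous up to the boundary -/

theorem hasDerivAt_of_mem_closure {G H : ℝ × ℝ → ℝ} (cG : Continuous G) (cH : Continuous H)
    {D : Set ℝ} {a b : ℝ}
    (h : ∀ x ∈ D, ∀ t ∈ Ioo a b, HasDerivAt (fun t => G (x, t)) (H (x, t)) t) {x t : ℝ}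
    (hx : x ∈ closure D) (ht : t ∈ Ioo a b) :
    HasDerivAt (fun t => G (x, t)) (H (x, t)) t := by
  have cI : ∀ s, Continuous fun x => ∫ τ in t..s, H (x, τ) := fun s =>
    intervalIntegral.continuous_parametric_intervalIntegral_of_continuous' (by fun_prop) t s
  -- The relation is integrated because the integrated form, unlike the derivative, passes to limits
  -- in `x`.
  have e : ∀ s ∈ Ioo a b, G (x, s) = G (x, t) + ∫ τ in t..s, H (x, τ) := fun s hs => by
    have : EqOn (fun x => G (x, s)) (fun x => G (x, t) + ∫ τ in t..s, H (x, τ)) (closure D) := by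
      refine EqOn.closure (fun y hy => ?_) (by fun_prop) (Continuous.add (by fun_prop) (cI s))
      have := intervalIntegral.integral_eq_sub_of_hasDerivAt (a := t) (b := s)
        (f := fun τ => G (y, τ)) (f' := fun τ => H (y, τ))
        (fun τ hτ => h y hy τ (ordConnected_Ioo.uIcc_subset ht hs hτ))
        (Continuous.intervalIntegrable (by fun_prop) _ _)
      simp only [this]
      ring
    exact this hx
  have d : HasDerivAt (fun s => G (x, t) + ∫ τ in t..s, H (x, τ)) (H (x, t)) t := by
    have c : Continuous fun τ => H (x, τ) := by fun_prop
    simpa using ((c.integral_hasStrictDerivAt t t).hasDerivAt).const_add (G (x, t))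
  refine d.congr_of_eventuallyEq ?_
  filter_upwards [Ioo_mem_nhds ht.1 ht.2] with s hs using e s hs

theorem eq_gradCLM (L : ℝ × ℝ →L[ℝ] ℝ) : L = gradCLM (L (1, 0)) (L (0, 1)) := by
  ext <;> simp

theorem IsWaveAt.congr {p p' : ℝ → ℝ} {U Ux Ut V Vx Vt : ℝ × ℝ → ℝ} {z : ℝ × ℝ}
    (h : IsWaveAt p U Ux Ut z) (hp : p' z.1 = p z.1) (h0 : V =ᶠ[𝓝 z] U) (h1 : Vx =ᶠ[𝓝 z] Ux)
    (h2 : Vt =ᶠ[𝓝 z] Ut) : IsWaveAt p' V Vx Vt z := by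
  obtain ⟨d0, a, b, c, d1, d2, e⟩ := h
  refine ⟨?_, a, b, c, d1.congr_of_eventuallyEq h1, d2.congr_of_eventuallyEq h2, ?_⟩
  · rw [h1.eq_of_nhds, h2.eq_of_nhds]
    exact d0.congr_of_eventuallyEq h0
  · rw [h0.eq_of_nhds, hp, e]

theorem IsWaveAt.sub {p : ℝ → ℝ} {U Ux Ut V Vx Vt : ℝ × ℝ → ℝ} {z : ℝ × ℝ}
    (h : IsWaveAt p U Ux Ut z) (h' : IsWaveAt p V Vx Vt z) :
    IsWaveAt p (fun z => U z - V z) (fun z => Ux z - Vx z) (fun z => Ut z - Vt z) z := by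
  have g : ∀ a b a' b' : ℝ, gradCLM a b - gradCLM a' b' = gradCLM (a - a') (b - b') :=
    fun a b a' b' => by ext <;> simp
  obtain ⟨d0, a, b, c, d1, d2, e⟩ := h
  obtain ⟨d0', a', b', c', d1', d2', e'⟩ := h'
  exact ⟨(d0.sub d0').congr_fderiv (g _ _ _ _), a - a', b - b', c - c',
    (d1.sub d1').congr_fderiv (g _ _ _ _), (d2.sub d2').congr_fderiv (g _ _ _ _), by
      linear_combination e - e'⟩

theorem IsWaveAt.translate {p : ℝ → ℝ} {U Ux Ut : ℝ × ℝ → ℝ} {x t h : ℝ}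
    (H : IsWaveAt p U Ux Ut (x + h, t)) :
    IsWaveAt (fun y => p (y + h)) (fun z => U (z.1 + h, z.2)) (fun z => Ux (z.1 + h, z.2))
      (fun z => Ut (z.1 + h, z.2)) (x, t) := by
  have k : ∀ {G : ℝ × ℝ → ℝ} {L : ℝ × ℝ →L[ℝ] ℝ}, HasFDerivAt G L (x + h, t) →
      HasFDerivAt (fun z : ℝ × ℝ => G (z.1 + h, z.2)) L (x, t) := fun {G L} hG => by
    have e : ∀ z : ℝ × ℝ, (z.1 + h, z.2) = z + (h, 0) := fun z => by ext <;> simp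
    simp only [e]
    rw [hasFDerivAt_comp_add_right]
    simpa using hG
  obtain ⟨d0, a, b, c, d1, d2, e⟩ := H
  exact ⟨k d0, a, b, c, k d1, k d2, e⟩

/-- A wave at rest at `t = 0`, continuous together with its gradient. -/
structure IsRestWave (p : ℝ → ℝ) (s : Set ℝ) (R : ℝ) (U Ux Ut : ℝ × ℝ → ℝ) : Prop where
  cont : Continuous U
  cont_x : Continuous Ux
  cont_t : Continuous Ut
  wave : ∀ x ∈ s, ∀ t ∈ Ioo 0 R, IsWaveAt p U Ux Ut (x, t)
  init : ∀ x ∈ s, U (x, 0) = 0 ∧ Ut (x, 0) = 0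

section RestWave

variable {p : ℝ → ℝ} {s : Set ℝ} {R : ℝ} {U Ux Ut V Vx Vt : ℝ × ℝ → ℝ}

theorem IsRestWave.sub (h : IsRestWave p s R U Ux Ut) (h' : IsRestWave p s R V Vx Vt) :
    IsRestWave p s R (fun z => U z - V z) (fun z => Ux z - Vx z) (fun z => Ut z - Vt z) where
  cont := h.cont.sub h'.cont
  cont_x := h.cont_x.sub h'.cont_x
  cont_t := h.cont_t.sub h'.cont_t
  wave x hx t ht := (h.wave x hx t ht).sub (h'.wave x hx t ht)
  init x hx := by simp [h.init x hx, h'.init x hx]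

theorem IsRestWave.hasDerivAt_t (h : IsRestWave p s R U Ux Ut) {x t : ℝ} (hx : x ∈ closure s)
    (ht : t ∈ Ioo 0 R) : HasDerivAt (fun t => U (x, t)) (Ut (x, t)) t :=
  hasDerivAt_of_mem_closure h.cont h.cont_t
    (fun y hy τ hτ => hasDerivAt_snd_of_hasFDerivAt (h.wave y hy τ hτ).1) hx ht

/-- The vanishing of `U_x` at `t = 0` is not among the hypotheses. Continuity up to `t = 0` makes
`U_x(·, 0)` the derivative of `U(·, 0) = 0`; `hasDerivAt_of_mem_closure` is used with space and time
exchanged. -/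
theorem IsRestWave.init_closure (h : IsRestWave p s R U Ux Ut) (hs : IsOpen s) (hR : 0 < R)
    {x : ℝ} (hx : x ∈ closure s) : U (x, 0) = 0 ∧ Ux (x, 0) = 0 ∧ Ut (x, 0) = 0 := by
  have c0 := h.cont
  have c1 := h.cont_x
  have c2 := h.cont_t
  have e0 : EqOn (fun x => U (x, 0)) (fun _ => 0) (closure s) :=
    EqOn.closure (fun y hy => (h.init y hy).1) (by fun_prop) continuous_const
  have e2 : EqOn (fun x => Ut (x, 0)) (fun _ => 0) (closure s) :=
    EqOn.closure (fun y hy => (h.init y hy).2) (by fun_prop) continuous_const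
  have e1 : EqOn (fun x => Ux (x, 0)) (fun _ => 0) (closure s) := by
    refine EqOn.closure (fun y hy => ?_) (by fun_prop) continuous_const
    obtain ⟨a, b, hab, hsub⟩ := mem_nhds_iff_exists_Ioo_subset.1 (hs.mem_nhds hy)
    have hd : HasDerivAt (fun y => U (y, 0)) (Ux (y, 0)) y :=
      hasDerivAt_of_mem_closure (G := fun z => U (z.2, z.1)) (H := fun z => Ux (z.2, z.1))
        (D := Ioo 0 R) (by fun_prop) (by fun_prop) (fun t ht y hy =>
          hasDerivAt_fst_of_hasFDerivAt (h.wave y (hsub hy) t ht).1)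
        (by rw [closure_Ioo hR.ne]; exact ⟨le_rfl, hR.le⟩) hab
    refine hd.unique ((hasDerivAt_const y (0 : ℝ)).congr_of_eventuallyEq ?_)
    filter_upwards [hs.mem_nhds hy] with w hw using (h.init w hw).1
  exact ⟨e0 hx, e1 hx, e2 hx⟩

/-- Equal boundary values may be differentiated in time, so gluing requires matching of `U` and
`U_x` only. -/
theorem IsRestWave.matching_t {s' : Set ℝ} (h : IsRestWave p s R U Ux Ut)
    (h' : IsRestWave p s' R V Vx Vt) {a b : ℝ} (ha : a ∈ closure s) (hb : b ∈ closure s')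
    (e : ∀ t ∈ Ioo 0 R, U (a, t) = V (b, t)) {t : ℝ} (ht : t ∈ Ioo 0 R) :
    Ut (a, t) = Vt (b, t) := by
  refine (h.hasDerivAt_t ha ht).unique ((h'.hasDerivAt_t hb ht).congr_of_eventuallyEq ?_)
  filter_upwards [Ioo_mem_nhds ht.1 ht.2] with τ hτ using e τ hτ

theorem exists_isRestWave {u : ℝ → ℝ → ℝ} (hs : IsOpen s) {r : ℝ → ℝ} (hr : Continuous r)
    (hrs : ∀ x, r x ∈ closure s) (hrid : ∀ x ∈ closure s, r x = x) {T : ℝ} (hR : 0 < R)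
    (hRT : R < T) (hc : ContDiffOn ℝ 2 (fun z : ℝ × ℝ => u z.1 z.2) (s ×ˢ Ioo 0 T))
    (hb : C1UpToBoundary u s T)
    (hw : ∀ x ∈ s, ∀ t ∈ Ioo 0 T, deriv (deriv (u x)) t + schrodinger p (fun y => u y t) x = 0)
    (hi : ∀ x ∈ s, Tendsto (u x) (𝓝[>] 0) (𝓝 0) ∧ Tendsto (deriv (u x)) (𝓝[>] 0) (𝓝 0)) :
    ∃ U Ux Ut, IsRestWave p s R U Ux Ut ∧ ∀ x ∈ s, ∀ t ∈ Ioo 0 R,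
      U (x, t) = u x t ∧ Ux (x, t) = deriv (fun y => u y t) x := by
  have ext : ∀ {g : ℝ × ℝ → ℝ}, ExtendsContinuously g (s ×ˢ Ioo 0 T) (closure s ×ˢ Ico 0 T) →
      ∃ G : ℝ × ℝ → ℝ, Continuous G ∧ ∀ x ∈ s, ∀ t ∈ Ioo 0 R, G (x, t) = g (x, t) := by
    rintro g ⟨G, cG, eG⟩
    -- Composition with the retractions onto `closure s` and `[0, R]` makes the extension continuous
    -- on the plane. The bound `R < T` is needed because nothing is known at `t = T`.
    refine ⟨fun z => G (r z.1, max 0 (min z.2 R)), cG.comp_continuous (by fun_prop)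
      fun z => ⟨hrs _, le_max_left _ _, max_lt (hR.trans hRT) ((min_le_right _ _).trans_lt hRT)⟩,
      fun x hx t ht => ?_⟩
    simp only [hrid x (subset_closure hx), min_eq_left ht.2.le, max_eq_right ht.1.le]
    exact eG ⟨hx, ht.1, ht.2.trans hRT⟩
  obtain ⟨U, cU, eU⟩ := ext hb.1
  obtain ⟨Ux, cX, eX⟩ := ext hb.2.1
  obtain ⟨Ut, cT, eT⟩ := ext hb.2.2
  simp only at eU eX eT
  have hO : IsOpen (s ×ˢ Ioo 0 R) := hs.prod isOpen_Ioo
  set w : ℝ × ℝ → ℝ := fun z => u z.1 z.2 with hwdef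
  have hcw : ∀ z ∈ s ×ˢ Ioo 0 R, ContDiffAt ℝ 2 w z := fun z hz =>
    hc.contDiffAt ((hs.prod isOpen_Ioo).mem_nhds ⟨hz.1, hz.2.1, hz.2.2.trans hRT⟩)
  have hdw : ∀ z ∈ s ×ˢ Ioo 0 R, HasFDerivAt w (fderiv ℝ w z) z := fun z hz =>
    ((hcw z hz).differentiableAt (by norm_num)).hasFDerivAt
  have fx : ∀ z ∈ s ×ˢ Ioo 0 R, HasDerivAt (fun y => u y z.2) (fderiv ℝ w z (1, 0)) z.1 :=
    fun z hz => hasDerivAt_fst_of_hasFDerivAt (G := w) (by rw [← eq_gradCLM]; exact hdw z hz)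
  have ft : ∀ z ∈ s ×ˢ Ioo 0 R, HasDerivAt (u z.1) (fderiv ℝ w z (0, 1)) z.2 :=
    fun z hz => hasDerivAt_snd_of_hasFDerivAt (G := w) (by rw [← eq_gradCLM]; exact hdw z hz)
  refine ⟨U, Ux, Ut, ⟨cU, cX, cT, fun x hx t ht => ?_, fun x hx => ?_⟩,
    fun x hx t ht => ⟨eU x hx t ht, eX x hx t ht⟩⟩
  · set z : ℝ × ℝ := (x, t) with hz
    have hzm : z ∈ s ×ˢ Ioo 0 R := ⟨hx, ht⟩
    have hd2 : HasFDerivAt (fderiv ℝ w) (fderiv ℝ (fderiv ℝ w) z) z :=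
      (((hcw z hzm).fderiv_right (m := 1) (by norm_num)).differentiableAt
        (by norm_num)).hasFDerivAt
    have happ : ∀ e : ℝ × ℝ, HasFDerivAt (fun z => fderiv ℝ w z e)
        (gradCLM (fderiv ℝ (fderiv ℝ w) z (1, 0) e) (fderiv ℝ (fderiv ℝ w) z (0, 1) e)) z := by
      intro e
      refine (((ContinuousLinearMap.apply ℝ ℝ e).hasFDerivAt (x := fderiv ℝ w z)).comp z
        hd2).congr_fderiv ?_
      rw [eq_gradCLM (((ContinuousLinearMap.apply ℝ ℝ e)).comp _)]
      rfl
    have hsymm : fderiv ℝ (fderiv ℝ w) z (1, 0) (0, 1) = fderiv ℝ (fderiv ℝ w) z (0, 1) (1, 0) :=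
      ((hcw z hzm).isSymmSndFDerivAt (by simp)).eq (1, 0) (0, 1)
    have hev := hO.mem_nhds hzm
    have h1 : Ux =ᶠ[𝓝 z] fun z => fderiv ℝ w z (1, 0) := by
      filter_upwards [hev] with y hy
      rw [← (fx y hy).deriv]
      exact eX y.1 hy.1 y.2 hy.2
    have h2 : Ut =ᶠ[𝓝 z] fun z => fderiv ℝ w z (0, 1) := by
      filter_upwards [hev] with y hy
      rw [← (ft y hy).deriv]
      exact eT y.1 hy.1 y.2 hy.2
    have h0 : U =ᶠ[𝓝 z] w := by
      filter_upwards [hev] with y hy using eU y.1 hy.1 y.2 hy.2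
    refine IsWaveAt.congr (p := p) ⟨?_, _, _,
      fderiv ℝ (fderiv ℝ w) z (0, 1) (0, 1), happ (1, 0), ?_, ?_⟩ rfl h0 h1 h2
    · rw [← eq_gradCLM]
      exact hdw z hzm
    · rw [← hsymm]
      exact happ (0, 1)
    · have hxx : deriv (deriv fun y => u y t) x = fderiv ℝ (fderiv ℝ w) z (1, 0) (1, 0) := by
        refine ((hasDerivAt_fst_of_hasFDerivAt (happ (1, 0))).congr_of_eventuallyEq ?_).deriv
        filter_upwards [hs.mem_nhds hx] with y hy using (fx (y, t) ⟨hy, ht⟩).deriv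
      have htt : deriv (deriv (u x)) t = fderiv ℝ (fderiv ℝ w) z (0, 1) (0, 1) := by
        refine ((hasDerivAt_snd_of_hasFDerivAt (happ (0, 1))).congr_of_eventuallyEq ?_).deriv
        filter_upwards [Ioo_mem_nhds ht.1 ht.2] with τ hτ using (ft (x, τ) ⟨hx, hτ⟩).deriv
      have := hw x hx t ⟨ht.1, ht.2.trans hRT⟩
      rw [schrodinger, hxx, htt] at this
      linear_combination this
  · have lim : ∀ {G : ℝ × ℝ → ℝ} {g : ℝ → ℝ}, Continuous G →
        (∀ t ∈ Ioo 0 R, G (x, t) = g t) → Tendsto g (𝓝[>] 0) (𝓝 0) → G (x, 0) = 0 := by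
      intro G g cG eG hg
      have h1 : Tendsto (fun t => G (x, t)) (𝓝[>] 0) (𝓝 (G (x, 0))) :=
        ((by fun_prop : Continuous fun t => G (x, t)).tendsto 0).mono_left nhdsWithin_le_nhds
      refine tendsto_nhds_unique h1 (hg.congr' ?_)
      filter_upwards [Ioo_mem_nhdsGT hR] with t ht using (eG t ht).symm
    exact ⟨lim cU (fun t ht => eU x hx t ht) (hi x hx).1,
      lim cT (fun t ht => eT x hx t ht) (hi x hx).2⟩

end RestWave

/-! ### Gluing across the origin and across the ends of the period -/

section Gluing

variable {p q : ℝ → ℝ} {R : ℝ} {U Ux Ut V Vx Vt : ℝ × ℝ → ℝ}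

/-- Two functions on half-lines glued at the origin. -/
def glueAtZero (U V : ℝ × ℝ → ℝ) (z : ℝ × ℝ) : ℝ :=
  U (min z.1 0, z.2) + V (max z.1 0, z.2) - V (0, z.2)

theorem continuous_glueAtZero (hU : Continuous U) (hV : Continuous V) :
    Continuous (glueAtZero U V) := by
  unfold glueAtZero
  fun_prop

theorem glueAtZero_of_nonneg {x t : ℝ} (h : U (0, t) = V (0, t)) (hx : 0 ≤ x) :
    glueAtZero U V (x, t) = V (x, t) := by
  simp [glueAtZero, hx, h]

theorem glueAtZero_of_nonpos {x t : ℝ} (hx : x ≤ 0) : glueAtZero U V (x, t) = U (x, t) := by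
  simp [glueAtZero, hx]

/-- With matching values and slopes the glued function and its gradient are continuous, and the
equation fails at most on the line `x = 0`, which is an admissible exceptional set. -/
theorem eq_zero_of_glueAtZero (hp : Integrable p) (hU : IsRestWave p (Iio 0) R U Ux Ut)
    (hV : IsRestWave p (Ioi 0) R V Vx Vt) (h0 : ∀ t ∈ Ioo 0 R, U (0, t) = V (0, t))
    (h1 : ∀ t ∈ Ioo 0 R, Ux (0, t) = Vx (0, t)) {x t : ℝ} (hx : x ≠ 0) (ht : t ∈ Ioo 0 R) :
    glueAtZero U V (x, t) = 0 := by
  have hR : 0 < R := ht.1.trans ht.2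
  have cL : ∀ {y : ℝ}, y ≤ 0 → y ∈ closure (Iio (0 : ℝ)) := fun h => by rwa [closure_Iio]
  have cR : ∀ {y : ℝ}, 0 ≤ y → y ∈ closure (Ioi (0 : ℝ)) := fun h => by rwa [closure_Ioi]
  have h2 : ∀ t ∈ Ioo 0 R, Ut (0, t) = Vt (0, t) := fun t ht =>
    hU.matching_t hV (cL le_rfl) (cR le_rfl) h0 ht
  refine eq_zero_of_isWaveAt (N := {0}) (x₀ := x) (countable_singleton 0) hp
    (continuous_glueAtZero hU.cont hV.cont) (continuous_glueAtZero hU.cont_x hV.cont_x)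
    (continuous_glueAtZero hU.cont_t hV.cont_t) (fun z hz hz' hz0 => ?_) (fun y _ => ?_)
    ht.1.le ht.2 hx
  · obtain ⟨y, τ⟩ := z
    have hτ : τ ∈ Ioo 0 R := ⟨hz, by linarith [abs_nonneg (y - x)]⟩
    rcases lt_or_gt_of_ne (show y ≠ 0 from hz0) with hy | hy
    · have hev : ∀ᶠ w : ℝ × ℝ in 𝓝 (y, τ), w.1 ≤ 0 :=
        (continuousAt_fst.tendsto.eventually (eventually_lt_nhds hy)).mono fun _ h => h.le
      exact (hU.wave y hy τ hτ).congr rfl (hev.mono fun w hw => glueAtZero_of_nonpos hw)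
        (hev.mono fun w hw => glueAtZero_of_nonpos hw)
        (hev.mono fun w hw => glueAtZero_of_nonpos hw)
    · have hev : ∀ᶠ w : ℝ × ℝ in 𝓝 (y, τ), 0 ≤ w.1 ∧ w.2 ∈ Ioo 0 R :=
        ((continuousAt_fst.tendsto.eventually (eventually_gt_nhds hy)).mono fun _ h =>
          h.le).and (continuousAt_snd.tendsto.eventually (Ioo_mem_nhds hτ.1 hτ.2))
      exact (hV.wave y hy τ hτ).congr rfl
        (hev.mono fun w hw => glueAtZero_of_nonneg (h0 _ hw.2) hw.1)
        (hev.mono fun w hw => glueAtZero_of_nonneg (h1 _ hw.2) hw.1)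
        (hev.mono fun w hw => glueAtZero_of_nonneg (h2 _ hw.2) hw.1)
  · have a := hU.init_closure isOpen_Iio hR (cL (min_le_right y 0))
    have b := hV.init_closure isOpen_Ioi hR (cR (le_max_right y 0))
    have c := hV.init_closure isOpen_Ioi hR (cR le_rfl)
    simp [glueAtZero, a, b, c]

/-- The projection onto a period. -/
def clampPeriod (x : ℝ) : ℝ := max 0 (min x (2 * π))

theorem continuous_clampPeriod : Continuous clampPeriod := by
  unfold clampPeriod
  fun_prop

theorem clampPeriod_of_nonpos {x : ℝ} (h : x ≤ 0) : clampPeriod x = 0 := by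
  simp [clampPeriod, h]

theorem clampPeriod_of_ge {x : ℝ} (h : 2 * π ≤ x) : clampPeriod x = 2 * π := by
  simp [clampPeriod, h, Real.pi_pos.le]

theorem clampPeriod_of_mem {x : ℝ} (h : x ∈ Icc 0 (2 * π)) : clampPeriod x = x := by
  simp [clampPeriod, h.1, h.2]

theorem clampPeriod_mem (x : ℝ) : clampPeriod x ∈ Icc 0 (2 * π) :=
  ⟨le_max_left _ _, max_le Real.two_pi_pos.le (min_le_right _ _)⟩

/-- A function on a period, continued periodically to the two neighbouring periods. -/
def gluePeriods (U : ℝ × ℝ → ℝ) (z : ℝ × ℝ) : ℝ :=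
  U (clampPeriod (z.1 + 2 * π), z.2) + U (clampPeriod z.1, z.2) +
    U (clampPeriod (z.1 + -(2 * π)), z.2) - U (0, z.2) - U (2 * π, z.2)

theorem continuous_gluePeriods (hU : Continuous U) : Continuous (gluePeriods U) := by
  have := continuous_clampPeriod
  unfold gluePeriods
  fun_prop

theorem gluePeriods_eq {x t : ℝ} (h : U (0, t) = U (2 * π, t)) :
    (x ∈ Icc (-(2 * π)) 0 → gluePeriods U (x, t) = U (x + 2 * π, t)) ∧
    (x ∈ Icc 0 (2 * π) → gluePeriods U (x, t) = U (x, t)) ∧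
    (x ∈ Icc (2 * π) (4 * π) → gluePeriods U (x, t) = U (x + -(2 * π), t)) := by
  have hπ := Real.pi_pos
  refine ⟨fun hx => ?_, fun hx => ?_, fun hx => ?_⟩ <;> obtain ⟨h1, h2⟩ := hx <;>
    simp only [gluePeriods]
  · rw [clampPeriod_of_mem (x := x + 2 * π) ⟨by linarith, by linarith⟩, clampPeriod_of_nonpos h2,
      clampPeriod_of_nonpos (by linarith), h]
    ring
  · rw [clampPeriod_of_ge (x := x + 2 * π) (by linarith), clampPeriod_of_mem ⟨h1, h2⟩,
      clampPeriod_of_nonpos (by linarith), h]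
    ring
  · rw [clampPeriod_of_ge (x := x + 2 * π) (by linarith), clampPeriod_of_ge h1,
      clampPeriod_of_mem (x := x + -(2 * π)) ⟨by linarith, by linarith⟩, h]
    ring

/-- The periodic continuation of the potential to the two neighbouring periods. -/
def periodsPotential (q : ℝ → ℝ) (x : ℝ) : ℝ :=
  (Ioo 0 (2 * π)).indicator q (x + 2 * π) + (Ioo 0 (2 * π)).indicator q x +
    (Ioo 0 (2 * π)).indicator q (x + -(2 * π))

theorem IsPotential.integrable_periodsPotential (hq : IsPotential q) :
    Integrable (periodsPotential q) := by
  have h : Integrable ((Ioo 0 (2 * π)).indicator q) :=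
    (integrable_indicator_iff measurableSet_Ioo).2
      (memLp_one_iff_integrable.1 (hq.2.mono_exponent (by norm_num)))
  exact ((h.comp_add_right _).add h).add (h.comp_add_right _)

theorem periodsPotential_eq (x : ℝ) :
    (x ∈ Ioo (-(2 * π)) 0 → periodsPotential q x = q (x + 2 * π)) ∧
    (x ∈ Ioo 0 (2 * π) → periodsPotential q x = q x) ∧
    (x ∈ Ioo (2 * π) (4 * π) → periodsPotential q x = q (x + -(2 * π))) := by
  have hπ := Real.pi_pos
  refine ⟨fun hx => ?_, fun hx => ?_, fun hx => ?_⟩ <;> obtain ⟨h1, h2⟩ := hx <;>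
    rw [periodsPotential]
  · rw [indicator_of_mem (show x + 2 * π ∈ Ioo 0 (2 * π) from ⟨by linarith, by linarith⟩),
      indicator_of_notMem (fun h => by linarith [h.1]),
      indicator_of_notMem (fun h => by linarith [h.1]), add_zero, add_zero]
  · rw [indicator_of_notMem (fun h => by linarith [h.2]), indicator_of_mem (show x ∈ Ioo 0 (2 * π) from ⟨h1, h2⟩),
      indicator_of_notMem (fun h => by linarith [h.1]), zero_add, add_zero]
  · rw [indicator_of_notMem (fun h => by linarith [h.2]),
      indicator_of_notMem (fun h => by linarith [h.2]),
      indicator_of_mem (show x + -(2 * π) ∈ Ioo 0 (2 * π) from ⟨by linarith, by linarith⟩),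
      zero_add, zero_add]

/-- Three periods suffice: for `R < 2π` the cone of dependence of a point of `(0, 2π)` stays within
`(-2π, 4π)`. The exceptional lines are the interior seams `0` and `2π`. -/
theorem eq_zero_of_gluePeriods (hq : IsPotential q) (hU : IsRestWave q (Ioo 0 (2 * π)) R U Ux Ut)
    (hR : R < 2 * π) (h0 : ∀ t ∈ Ioo 0 R, U (0, t) = U (2 * π, t))
    (h1 : ∀ t ∈ Ioo 0 R, Ux (0, t) = Ux (2 * π, t)) {x t : ℝ} (hx : x ∈ Ioo 0 (2 * π))
    (ht : t ∈ Ioo 0 R) : U (x, t) = 0 := by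
  have hπ := Real.pi_pos
  have hR0 : 0 < R := ht.1.trans ht.2
  have cl : closure (Ioo 0 (2 * π)) = Icc 0 (2 * π) := closure_Ioo Real.two_pi_pos.ne
  have c0 : (0 : ℝ) ∈ closure (Ioo 0 (2 * π)) := by rw [cl]; exact ⟨le_rfl, by linarith⟩
  have c1 : 2 * π ∈ closure (Ioo 0 (2 * π)) := by rw [cl]; exact ⟨by linarith, le_rfl⟩
  have h2 : ∀ t ∈ Ioo 0 R, Ut (0, t) = Ut (2 * π, t) := fun t ht => hU.matching_t hU c0 c1 h0 ht
  rw [← (gluePeriods_eq (h0 t ht)).2.1 ⟨hx.1.le, hx.2.le⟩]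
  refine eq_zero_of_isWaveAt (N := {0, 2 * π}) (x₀ := x) (Set.Countable.insert _
    (countable_singleton _)) hq.integrable_periodsPotential (continuous_gluePeriods hU.cont)
    (continuous_gluePeriods hU.cont_x) (continuous_gluePeriods hU.cont_t)
    (fun z hz hz' hzN => ?_) (fun y _ => ?_) ht.1.le ht.2 (by
      rintro (h | h)
      · exact hx.1.ne' h
      · exact hx.2.ne h)
  · obtain ⟨y, τ⟩ := z
    simp only at hz hz'
    have hτ : τ ∈ Ioo 0 R := ⟨hz, by linarith [abs_nonneg (y - x)]⟩
    have hy := abs_lt.1 (show |y - x| < R by linarith)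
    have hne : y ≠ 0 ∧ y ≠ 2 * π := by simpa [not_or] using hzN
    have ev : ∀ {a b : ℝ}, y ∈ Ioo a b → ∀ᶠ w : ℝ × ℝ in 𝓝 (y, τ), w.1 ∈ Icc a b ∧
        w.2 ∈ Ioo 0 R := fun h =>
      ((continuousAt_fst.tendsto.eventually (Ioo_mem_nhds h.1 h.2)).mono fun _ h =>
          ⟨h.1.le, h.2.le⟩).and (continuousAt_snd.tendsto.eventually (Ioo_mem_nhds hτ.1 hτ.2))
    rcases lt_or_gt_of_ne hne.1 with hy0 | hy0
    · have hm : y ∈ Ioo (-(2 * π)) 0 := ⟨by linarith [hy.1, hx.1], hy0⟩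
      exact (hU.wave (y + 2 * π) ⟨by linarith [hm.1], by linarith⟩ τ hτ).translate.congr
        ((periodsPotential_eq y).1 hm)
        ((ev hm).mono fun w hw => (gluePeriods_eq (h0 _ hw.2)).1 hw.1)
        ((ev hm).mono fun w hw => (gluePeriods_eq (h1 _ hw.2)).1 hw.1)
        ((ev hm).mono fun w hw => (gluePeriods_eq (h2 _ hw.2)).1 hw.1)
    rcases lt_or_gt_of_ne hne.2 with hy1 | hy1
    · have hm : y ∈ Ioo 0 (2 * π) := ⟨hy0, hy1⟩
      exact (hU.wave y hm τ hτ).congr ((periodsPotential_eq y).2.1 hm)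
        ((ev hm).mono fun w hw => (gluePeriods_eq (h0 _ hw.2)).2.1 hw.1)
        ((ev hm).mono fun w hw => (gluePeriods_eq (h1 _ hw.2)).2.1 hw.1)
        ((ev hm).mono fun w hw => (gluePeriods_eq (h2 _ hw.2)).2.1 hw.1)
    · have hm : y ∈ Ioo (2 * π) (4 * π) := ⟨hy1, by linarith [hy.2, hx.2]⟩
      exact (hU.wave (y + -(2 * π)) ⟨by linarith, by linarith [hm.2]⟩ τ hτ).translate.congr
        ((periodsPotential_eq y).2.2 hm)
        ((ev hm).mono fun w hw => (gluePeriods_eq (h0 _ hw.2)).2.2 hw.1)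
        ((ev hm).mono fun w hw => (gluePeriods_eq (h1 _ hw.2)).2.2 hw.1)
        ((ev hm).mono fun w hw => (gluePeriods_eq (h2 _ hw.2)).2.2 hw.1)
  · have a : ∀ y, y ∈ Icc 0 (2 * π) → U (y, 0) = 0 ∧ Ux (y, 0) = 0 ∧ Ut (y, 0) = 0 := fun y hy =>
      hU.init_closure isOpen_Ioo hR0 (by rwa [cl])
    have b := fun y => a _ (clampPeriod_mem y)
    have d0 := a 0 ⟨le_rfl, by linarith⟩
    have d1 := a (2 * π) ⟨by linarith, le_rfl⟩
    simp [gluePeriods, b, d0, d1]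

end Gluing

/-! ### Uniqueness for the two problems -/

section Uniqueness

variable {p q : ℝ → ℝ} {F : ℝ → ℝ × ℝ} {u u' : ℝ → ℝ → ℝ}

theorem limUnder_eq_of_extension {G : ℝ × ℝ → ℝ} (hG : Continuous G) {g : ℝ → ℝ} {l : Filter ℝ}
    [l.NeBot] {a t : ℝ} (hl : l ≤ 𝓝 a) (h : ∀ᶠ x in l, G (x, t) = g x) :
    limUnder l g = G (a, t) :=
  (((by fun_prop : Continuous fun x => G (x, t)).tendsto a |>.mono_left hl).congr' h).limUnder_eq

theorem IsLineSolution.unique (hp : Integrable p) (hu : IsLineSolution p (2 * π) F u)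
    (hu' : IsLineSolution p (2 * π) F u') {x t : ℝ} (hx : x ≠ 0) (ht : t ∈ Ioo 0 (2 * π)) :
    u x t = u' x t := by
  -- Solutions need not extend continuously to `t = 2π`, so the argument is run up to some `R`
  -- strictly between `t` and `2π`.
  obtain ⟨R, htR, hR⟩ := exists_between ht.2
  have hR0 : 0 < R := ht.1.trans htR
  have ex : ∀ {w : ℝ → ℝ → ℝ}, IsLineSolution p (2 * π) F w → ∃ A Ax At B Bx Bt,
      IsRestWave p (Iio 0) R A Ax At ∧ IsRestWave p (Ioi 0) R B Bx Bt ∧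
      (∀ x < 0, ∀ t ∈ Ioo 0 R, A (x, t) = w x t) ∧ (∀ x > 0, ∀ t ∈ Ioo 0 R, B (x, t) = w x t) ∧
      ∀ t ∈ Ioo 0 R, B (0, t) - A (0, t) = (F t).1 ∧
        Bx (0, t) - Ax (0, t) = deriv (fun s => (F s).2) t := by
    intro w hw
    obtain ⟨A, Ax, At, hA, eA⟩ := exists_isRestWave (p := p) (s := Iio 0) (R := R)
      (r := fun x => min x 0) isOpen_Iio (by fun_prop) (fun x => by simp [closure_Iio])
      (fun x hx => by rw [closure_Iio] at hx; exact min_eq_left hx) hR0 hR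
      (hw.contDiffOn.mono (prod_mono (fun x hx => ne_of_lt hx) Subset.rfl))
      hw.upToBoundary_left (fun x hx => hw.wave x (ne_of_lt hx))
      fun x hx => hw.initial x (ne_of_lt hx)
    obtain ⟨B, Bx, Bt, hB, eB⟩ := exists_isRestWave (p := p) (s := Ioi 0) (R := R)
      (r := fun x => max x 0) isOpen_Ioi (by fun_prop) (fun x => by simp [closure_Ioi])
      (fun x hx => by rw [closure_Ioi] at hx; exact max_eq_left hx) hR0 hR
      (hw.contDiffOn.mono (prod_mono (fun x hx => ne_of_gt hx) Subset.rfl))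
      hw.upToBoundary_right (fun x hx => hw.wave x (ne_of_gt hx))
      fun x hx => hw.initial x (ne_of_gt hx)
    refine ⟨A, Ax, At, B, Bx, Bt, hA, hB, fun x hx t ht => (eA x hx t ht).1,
      fun x hx t ht => (eB x hx t ht).1, fun t ht => ?_⟩
    have b := hw.boundary t ⟨ht.1, ht.2.trans hR⟩
    rw [lineGamma0, traceRight, traceRight, traceLeft, traceLeft,
      limUnder_eq_of_extension hB.cont (t := t) nhdsWithin_le_nhds
        (by filter_upwards [self_mem_nhdsWithin] with x hx using (eB x hx t ht).1),
      limUnder_eq_of_extension hA.cont (t := t) nhdsWithin_le_nhds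
        (by filter_upwards [self_mem_nhdsWithin] with x hx using (eA x hx t ht).1),
      limUnder_eq_of_extension hB.cont_x (t := t) nhdsWithin_le_nhds
        (by filter_upwards [self_mem_nhdsWithin] with x hx using (eB x hx t ht).2),
      limUnder_eq_of_extension hA.cont_x (t := t) nhdsWithin_le_nhds
        (by filter_upwards [self_mem_nhdsWithin] with x hx using (eA x hx t ht).2)] at b
    exact Prod.mk.inj b
  obtain ⟨A, Ax, At, B, Bx, Bt, hA, hB, eA, eB, b⟩ := ex hu
  obtain ⟨A', Ax', At', B', Bx', Bt', hA', hB', eA', eB', b'⟩ := ex hu'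
  have m0 : ∀ t ∈ Ioo 0 R, A (0, t) - A' (0, t) = B (0, t) - B' (0, t) := fun t ht => by
    linarith [(b t ht).1, (b' t ht).1]
  have key := eq_zero_of_glueAtZero hp (hA.sub hA') (hB.sub hB') m0
    (fun t ht => by linarith [(b t ht).2, (b' t ht).2]) hx (t := t) ⟨ht.1, htR⟩
  have htm : t ∈ Ioo 0 R := ⟨ht.1, htR⟩
  rcases lt_or_gt_of_ne hx with h | h
  · rw [glueAtZero_of_nonpos h.le, eA x h t htm, eA' x h t htm] at key
    exact sub_eq_zero.1 key
  · rw [glueAtZero_of_nonneg (m0 t htm) h.le, eB x h t htm, eB' x h t htm] at key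
    exact sub_eq_zero.1 key

theorem IsPeriodicSolution.unique (hq : IsPotential q) (hu : IsPeriodicSolution q (2 * π) F u)
    (hu' : IsPeriodicSolution q (2 * π) F u') {x t : ℝ} (hx : x ∈ Ioo 0 (2 * π))
    (ht : t ∈ Ioo 0 (2 * π)) : u x t = u' x t := by
  obtain ⟨R, htR, hR⟩ := exists_between ht.2
  have hR0 : 0 < R := ht.1.trans htR
  have cl : closure (Ioo 0 (2 * π)) = Icc 0 (2 * π) := closure_Ioo Real.two_pi_pos.ne
  have ex : ∀ {w : ℝ → ℝ → ℝ}, IsPeriodicSolution q (2 * π) F w → ∃ A Ax At,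
      IsRestWave q (Ioo 0 (2 * π)) R A Ax At ∧
      (∀ x ∈ Ioo 0 (2 * π), ∀ t ∈ Ioo 0 R, A (x, t) = w x t) ∧
      ∀ t ∈ Ioo 0 R, A (0, t) - A (2 * π, t) = (F t).1 ∧
        Ax (0, t) - Ax (2 * π, t) = deriv (fun s => (F s).2) t := by
    intro w hw
    obtain ⟨A, Ax, At, hA, eA⟩ := exists_isRestWave (p := q) (R := R)
      (r := clampPeriod) isOpen_Ioo continuous_clampPeriod
      (fun x => by rw [cl]; exact clampPeriod_mem x)
      (fun x hx => by rw [cl] at hx; exact clampPeriod_of_mem hx) hR0 hR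
      hw.contDiffOn hw.upToBoundary hw.wave hw.initial
    have hr : ∀ᶠ x in 𝓝[>] (0 : ℝ), x ∈ Ioo 0 (2 * π) := Ioo_mem_nhdsGT Real.two_pi_pos
    have hl : ∀ᶠ x in 𝓝[<] (2 * π), x ∈ Ioo 0 (2 * π) := Ioo_mem_nhdsLT Real.two_pi_pos
    refine ⟨A, Ax, At, hA, fun x hx t ht => (eA x hx t ht).1, fun t ht => ?_⟩
    have b := hw.boundary t ⟨ht.1, ht.2.trans hR⟩
    rw [Gamma0, traceRight, traceRight, traceLeft, traceLeft,
      limUnder_eq_of_extension hA.cont (t := t) nhdsWithin_le_nhds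
        (hr.mono fun x hx => (eA x hx t ht).1),
      limUnder_eq_of_extension hA.cont (t := t) nhdsWithin_le_nhds
        (hl.mono fun x hx => (eA x hx t ht).1),
      limUnder_eq_of_extension hA.cont_x (t := t) nhdsWithin_le_nhds
        (hr.mono fun x hx => (eA x hx t ht).2),
      limUnder_eq_of_extension hA.cont_x (t := t) nhdsWithin_le_nhds
        (hl.mono fun x hx => (eA x hx t ht).2)] at b
    exact Prod.mk.inj b
  obtain ⟨A, Ax, At, hA, eA, b⟩ := ex hu
  obtain ⟨A', Ax', At', hA', eA', b'⟩ := ex hu'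
  have key := eq_zero_of_gluePeriods hq (hA.sub hA') hR
    (fun t ht => by linarith [(b t ht).1, (b' t ht).1])
    (fun t ht => by linarith [(b t ht).2, (b' t ht).2]) hx (t := t) ⟨ht.1, htR⟩
  rw [eA x hx t ⟨ht.1, htR⟩, eA' x hx t ⟨ht.1, htR⟩] at key
  exact sub_eq_zero.1 key

end Uniqueness

/-! ### Square integrable controls: estimates -/

section SquareIntegrable

variable {W : ℝ → ℝ → ℝ} {f : ℝ → ℝ}

theorem kernelConv_eq_integral_cutKernel (hf : ∀ t ∉ Ioo 0 (2 * π), f t = 0) (x t : ℝ) :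
    kernelConv W f x t = ∫ s, cutKernel W x s * f (t - s) := by
  have hf0 : ∀ t ≤ 0, f t = 0 := fun t ht => hf t fun h => h.1.not_ge ht
  rcases le_or_gt t |x| with h | h
  · rw [kernelConv_of_le hf0 h]
    have : ∀ s, cutKernel W x s * f (t - s) = 0 := fun s => by
      rw [cutKernel]
      split_ifs with hs
      · rw [hf0 _ (by linarith), mul_zero]
      · rw [zero_mul]
    simp [this]
  · rw [kernelConv, intervalIntegral.integral_of_le h.le, ← integral_indicator measurableSet_Ioc]
    congr 1
    ext s
    by_cases hs : s ∈ Ioc |x| t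
    · rw [indicator_of_mem hs, cutKernel, if_pos hs.1]
    · rw [indicator_of_notMem hs, cutKernel]
      split_ifs with h1
      · rw [hf0 _ (by
          by_contra! h2
          exact hs ⟨h1, by linarith⟩), mul_zero]
      · rw [zero_mul]

theorem aestronglyMeasurable_kernelConv (hW : Continuous (Function.uncurry W))
    (hm : AEStronglyMeasurable f) (hf : ∀ t ∉ Ioo 0 (2 * π), f t = 0) (t : ℝ) :
    AEStronglyMeasurable fun x => kernelConv W f x t := by
  simp only [kernelConv_eq_integral_cutKernel hf]
  refine AEStronglyMeasurable.integral_prod_right' (μ := volume) (ν := volume)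
    (f := fun z : ℝ × ℝ => cutKernel W z.1 z.2 * f (t - z.2)) ?_
  refine (isCausal_cutKernel hW).meas.aestronglyMeasurable.mul ?_
  exact AEStronglyMeasurable.comp_snd (f := fun s => f (t - s))
    (hm.comp_measurePreserving (Measure.measurePreserving_sub_left volume t))

/-- On the bounded part of the cone `|W| ≤ M`, so the convolution is at most `M ‖f‖₁` pointwise. It
lives on `[-2π, 2π]`, and `‖f‖₁` is controlled by `‖f‖₂` on the bounded time interval. -/
theorem exists_eLpNorm_kernelConv_le (hW : Continuous (Function.uncurry W)) :
    ∃ C : ENNReal, C ≠ ⊤ ∧ ∀ f : ℝ → ℝ, AEStronglyMeasurable f →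
      (∀ t ∉ Ioo 0 (2 * π), f t = 0) → ∀ t < 2 * π,
      eLpNorm (fun x => kernelConv W f x t) 2 volume ≤ C * eLpNorm f 2 volume := by
  obtain ⟨M, hM⟩ := exists_bound_of_continuous hW (2 * π)
  set I : Set ℝ := Icc (-(2 * π)) (2 * π)
  refine ⟨volume I ^ (1 / (2 : ENNReal).toReal) * (ENNReal.ofReal M *
    volume (Ioo 0 (2 * π)) ^ (1 / (1 : ENNReal).toReal - 1 / (2 : ENNReal).toReal)), ?_,
    fun f hm hf t ht => ?_⟩
  · refine ENNReal.mul_ne_top (ENNReal.rpow_ne_top_of_nonneg (by simp) (by simp [I])) ?_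
    exact ENNReal.mul_ne_top (by simp) (ENNReal.rpow_ne_top_of_nonneg (by norm_num)
      measure_Ioo_lt_top.ne)
  have hfi : (Ioo 0 (2 * π)).indicator f = f := by
    ext s
    by_cases hs : s ∈ Ioo 0 (2 * π)
    · rw [indicator_of_mem hs]
    · rw [indicator_of_notMem hs, hf s hs]
  have h1 : eLpNorm f 1 volume ≤ eLpNorm f 2 volume *
      volume (Ioo 0 (2 * π)) ^ (1 / (1 : ENNReal).toReal - 1 / (2 : ENNReal).toReal) := by
    have := eLpNorm_le_eLpNorm_mul_rpow_measure_univ (p := 1) (q := 2) (by norm_num)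
      (hm.restrict (s := Ioo 0 (2 * π)))
    rwa [← eLpNorm_indicator_eq_eLpNorm_restrict measurableSet_Ioo,
      ← eLpNorm_indicator_eq_eLpNorm_restrict measurableSet_Ioo, hfi,
      Measure.restrict_apply_univ] at this
  have h2 : ∀ x, ‖kernelConv W f x t‖ₑ ≤ ‖I.indicator
      (fun _ => ENNReal.ofReal M * eLpNorm f 1 volume) x‖ₑ := by
    intro x
    rw [enorm_eq_self]
    by_cases hx : x ∈ I
    · rw [indicator_of_mem hx, kernelConv_eq_integral_cutKernel hf]
      refine (enorm_integral_le_lintegral_enorm _).trans ?_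
      have e : eLpNorm f 1 volume = ∫⁻ s, ‖f (t - s)‖ₑ := by
        rw [eLpNorm_one_eq_lintegral_enorm]
        exact (lintegral_sub_left_eq_self (fun s => ‖f s‖ₑ) t).symm
      rw [e, ← lintegral_const_mul' _ _ ENNReal.ofReal_ne_top]
      refine lintegral_mono fun s => ?_
      rw [enorm_mul, cutKernel]
      split_ifs with hs
      · by_cases hs' : t - s ∈ Ioo 0 (2 * π)
        · gcongr
          rw [← ofReal_norm]
          exact ENNReal.ofReal_le_ofReal (hM x s hs.le (by linarith [hs'.1]))
        · simp [hf _ hs']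
      · simp
    · rw [kernelConv_of_le (fun s hs => hf s fun h => h.1.not_ge hs)]
      · simp
      · by_contra! h
        exact hx (abs_le.1 (h.le.trans ht.le))
  calc eLpNorm (fun x => kernelConv W f x t) 2 volume
      ≤ eLpNorm (I.indicator fun _ => ENNReal.ofReal M * eLpNorm f 1 volume) 2 volume :=
        eLpNorm_mono_enorm h2
    _ = ENNReal.ofReal M * eLpNorm f 1 volume * volume I ^ (1 / (2 : ENNReal).toReal) := by
        rw [eLpNorm_indicator_const measurableSet_Icc (by norm_num) (by norm_num), enorm_eq_self]
    _ ≤ _ := by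
        grw [h1]
        apply le_of_eq
        ring

/-- On each half-line the singular part is a translate or reflected translate of `f`, whose `L²`
norm does not depend on `t`; this makes the constant uniform in `t`. -/
theorem exists_eLpNorm_lineWave_le (cp cm : ℝ) (hW : Continuous (Function.uncurry W)) :
    ∃ C : ENNReal, C ≠ ⊤ ∧ ∀ f : ℝ → ℝ, AEStronglyMeasurable f →
      (∀ t ∉ Ioo 0 (2 * π), f t = 0) → ∀ t < 2 * π,
      AEStronglyMeasurable (fun x => lineWave cp cm W f x t) ∧
      eLpNorm (fun x => lineWave cp cm W f x t) 2 volume ≤ C * eLpNorm f 2 volume := by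
  obtain ⟨C, hC, hK⟩ := exists_eLpNorm_kernelConv_le hW
  refine ⟨‖cp‖ₑ + ‖cm‖ₑ + C, by simp [hC], fun f hm hf t ht => ?_⟩
  have m1 := Measure.measurePreserving_sub_left (volume : Measure ℝ) t
  have m2 := measurePreserving_add_left (volume : Measure ℝ) t
  have a1 : AEStronglyMeasurable fun x => f (t - x) := hm.comp_measurePreserving m1
  have a2 : AEStronglyMeasurable fun x => f (t + x) := hm.comp_measurePreserving m2
  have b1 : AEStronglyMeasurable ((Ioi 0).indicator (cp • fun x => f (t - x))) :=
    (a1.const_smul cp).indicator measurableSet_Ioi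
  have b2 : AEStronglyMeasurable ((Iic 0).indicator (cm • fun x => f (t + x))) :=
    (a2.const_smul cm).indicator measurableSet_Iic
  have b3 := aestronglyMeasurable_kernelConv hW hm hf t
  have e : (fun x => lineWave cp cm W f x t) = (Ioi 0).indicator (cp • fun x => f (t - x)) +
      (Iic 0).indicator (cm • fun x => f (t + x)) + fun x => kernelConv W f x t := by
    ext x
    simp only [lineWave, jump, Pi.add_apply]
    rcases lt_or_ge 0 x with h | h
    · rw [indicator_of_mem (show x ∈ Ioi 0 from h),
        indicator_of_notMem (show x ∉ Iic 0 from h.not_ge), if_pos h, abs_of_pos h]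
      simp
    · rw [indicator_of_notMem (show x ∉ Ioi 0 from h.not_gt),
        indicator_of_mem (show x ∈ Iic 0 from h), if_neg h.not_gt, abs_of_nonpos h]
      simp
  have n1 : eLpNorm ((Ioi 0).indicator (cp • fun x => f (t - x))) 2 volume ≤
      ‖cp‖ₑ * eLpNorm f 2 volume := by
    refine (eLpNorm_indicator_le _).trans ?_
    rw [eLpNorm_const_smul]
    exact (congrArg _ (eLpNorm_comp_measurePreserving hm m1)).le
  have n2 : eLpNorm ((Iic 0).indicator (cm • fun x => f (t + x))) 2 volume ≤
      ‖cm‖ₑ * eLpNorm f 2 volume := by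
    refine (eLpNorm_indicator_le _).trans ?_
    rw [eLpNorm_const_smul]
    exact (congrArg _ (eLpNorm_comp_measurePreserving hm m2)).le
  rw [e]
  refine ⟨(b1.add b2).add b3, ?_⟩
  have h12 : (1 : ENNReal) ≤ 2 := by norm_num
  calc _ ≤ _ := (eLpNorm_add_le (b1.add b2) b3 h12).trans
        (add_le_add_left (eLpNorm_add_le b1 b2 h12) _)
    _ ≤ ‖cp‖ₑ * eLpNorm f 2 volume + ‖cm‖ₑ * eLpNorm f 2 volume + C * eLpNorm f 2 volume :=
        add_le_add (add_le_add n1 n2) (hK f hm hf t ht)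
    _ = _ := by ring

end SquareIntegrable

section Controls

variable {W₁ W₂ : ℝ → ℝ → ℝ} {F G : ℝ → ℝ × ℝ}

theorem IsSmoothControl.isL2Control (hF : IsSmoothControl F) : IsL2Control (2 * π) F :=
  ⟨(hF.1.continuous.memLp_of_hasCompactSupport hF.2.1).restrict _, fun _ ht => hF.zero ht⟩

theorem IsL2Control.sub {T : ℝ} (hF : IsL2Control T F) (hG : IsL2Control T G) :
    IsL2Control T fun t => F t - G t :=
  ⟨hF.1.sub hG.1, fun t ht => by simp [hF.2 t ht, hG.2 t ht]⟩

/-- Nothing is known of a square integrable control after `2π`, but the formulas for `t < 2π` use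
only earlier arguments, so the control may be cut off there. -/
theorem indicator_eq_of_lt (hF : ∀ t ≤ 0, F t = 0) {s : ℝ} (hs : s < 2 * π) :
    (Ioo 0 (2 * π)).indicator F s = F s := by
  by_cases h : s ∈ Ioo 0 (2 * π)
  · rw [indicator_of_mem h]
  · rw [indicator_of_notMem h, hF s]
    by_contra! h'
    exact h ⟨h', hs⟩

theorem intervalIntegrable_kernel_mul {W : ℝ → ℝ → ℝ} (hW : Continuous (Function.uncurry W))
    {f : ℝ → ℝ} (hf : Integrable f) (x t a b : ℝ) :
    IntervalIntegrable (fun s => W x s * f (t - s)) volume a b :=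
  (hf.comp_sub_left t).intervalIntegrable.continuousOn_mul
    (hW.comp (f := fun s : ℝ => (x, s)) (by fun_prop)).continuousOn

theorem IsL2Control.integrable (hF : IsL2Control (2 * π) F) :
    Integrable ((Ioo 0 (2 * π)).indicator F) :=
  (integrable_indicator_iff measurableSet_Ioo).2
    (memLp_one_iff_integrable.1 (hF.1.mono_exponent (by norm_num)))

theorem uIcc_sub_lt {x t s : ℝ} (ht : t < 2 * π) (hs : s ∈ uIcc |x| t) : t - s < 2 * π := by
  have h0 := abs_nonneg x
  have hπ := Real.two_pi_pos
  rcases le_total |x| t with h | h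
  · rw [uIcc_of_le h] at hs
    linarith [hs.1]
  · rw [uIcc_of_ge h] at hs
    linarith [hs.1]

theorem controlWave_eq_of_isL2Control (h₁ : Continuous (Function.uncurry W₁))
    (h₂ : Continuous (Function.uncurry W₂)) (hF : IsL2Control (2 * π) F) {x t : ℝ}
    (ht : t < 2 * π) :
    controlWave W₁ W₂ F (x, t) =
      lineWave (1 / 2) (-(1 / 2)) W₁ (fun t => ((Ioo 0 (2 * π)).indicator F t).1) x t +
      lineWave (-(1 / 2)) (-(1 / 2)) W₂ (fun t => ((Ioo 0 (2 * π)).indicator F t).2) x t := by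
  have i₁ := intervalIntegrable_kernel_mul h₁ hF.integrable.fst x t |x| t
  have i₂ := intervalIntegrable_kernel_mul h₂ hF.integrable.snd x t |x| t
  have e := indicator_eq_of_lt hF.2 (s := t - |x|) (by linarith [abs_nonneg x])
  rw [lineWave, lineWave, kernelConv, kernelConv, e, controlWave]
  have e' : ∫ s in |x|..t, (W₁ x s * (F (t - s)).1 + W₂ x s * (F (t - s)).2) =
      (∫ s in |x|..t, W₁ x s * ((Ioo 0 (2 * π)).indicator F (t - s)).1) +
        ∫ s in |x|..t, W₂ x s * ((Ioo 0 (2 * π)).indicator F (t - s)).2 := by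
    rw [← intervalIntegral.integral_add i₁ i₂]
    refine intervalIntegral.integral_congr fun s hs => ?_
    simp only [indicator_eq_of_lt hF.2 (uIcc_sub_lt ht hs)]
  simp only [e', jump, ite_self]
  ring

theorem controlWave_sub (h₁ : Continuous (Function.uncurry W₁))
    (h₂ : Continuous (Function.uncurry W₂)) (hF : IsL2Control (2 * π) F)
    (hG : IsL2Control (2 * π) G) {x t : ℝ} (ht : t < 2 * π) :
    controlWave W₁ W₂ (fun t => F t - G t) (x, t) =
      controlWave W₁ W₂ F (x, t) - controlWave W₁ W₂ G (x, t) := by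
  rw [controlWave_eq_of_isL2Control h₁ h₂ (hF.sub hG) ht,
    controlWave_eq_of_isL2Control h₁ h₂ hF ht, controlWave_eq_of_isL2Control h₁ h₂ hG ht]
  have s₁ : ∀ {W : ℝ → ℝ → ℝ} {f g : ℝ → ℝ} (a b : ℝ), Continuous (Function.uncurry W) →
      Integrable f → Integrable g → lineWave a b W (fun t => f t - g t) x t =
        lineWave a b W f x t - lineWave a b W g x t := by
    intro W f g a b hW hf hg
    have := intervalIntegral.integral_sub (intervalIntegrable_kernel_mul hW hf x t |x| t)
      (intervalIntegrable_kernel_mul hW hg x t |x| t)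
    simp only [lineWave, kernelConv, mul_sub, this]
    ring
  have e : (Ioo 0 (2 * π)).indicator (fun t => F t - G t) = fun t =>
      (Ioo 0 (2 * π)).indicator F t - (Ioo 0 (2 * π)).indicator G t :=
    indicator_sub _ F G
  simp only [e, Prod.fst_sub, Prod.snd_sub]
  rw [s₁ _ _ h₁ hF.integrable.fst hG.integrable.fst, s₁ _ _ h₂ hF.integrable.snd hG.integrable.snd]
  ring

theorem exists_eLpNorm_controlWave_le (h₁ : Continuous (Function.uncurry W₁))
    (h₂ : Continuous (Function.uncurry W₂)) :
    ∃ C : ENNReal, C ≠ ⊤ ∧ ∀ F, IsL2Control (2 * π) F → ∀ t < 2 * π,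
      AEStronglyMeasurable (fun x => controlWave W₁ W₂ F (x, t)) ∧
      eLpNorm (fun x => controlWave W₁ W₂ F (x, t)) 2 volume ≤
        C * eLpNorm F 2 (volume.restrict (Ioo 0 (2 * π))) := by
  obtain ⟨C₁, hC₁, H₁⟩ := exists_eLpNorm_lineWave_le (1 / 2) (-(1 / 2)) h₁
  obtain ⟨C₂, hC₂, H₂⟩ := exists_eLpNorm_lineWave_le (-(1 / 2)) (-(1 / 2)) h₂
  refine ⟨C₁ + C₂, by simp [hC₁, hC₂], fun F hF t ht => ?_⟩
  have hm := hF.integrable.aestronglyMeasurable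
  have z : ∀ t ∉ Ioo 0 (2 * π), (Ioo 0 (2 * π)).indicator F t = 0 := fun t ht =>
    indicator_of_notMem ht F
  obtain ⟨a₁, b₁⟩ := H₁ _ hm.fst (fun t ht => by rw [z t ht]; rfl) t ht
  obtain ⟨a₂, b₂⟩ := H₂ _ hm.snd (fun t ht => by rw [z t ht]; rfl) t ht
  have e : (fun x => controlWave W₁ W₂ F (x, t)) = _ :=
    funext fun x => controlWave_eq_of_isL2Control h₁ h₂ hF (x := x) ht
  have n : eLpNorm ((Ioo 0 (2 * π)).indicator F) 2 volume =
      eLpNorm F 2 (volume.restrict (Ioo 0 (2 * π))) :=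
    eLpNorm_indicator_eq_eLpNorm_restrict measurableSet_Ioo
  rw [e]
  refine ⟨a₁.add a₂, (eLpNorm_add_le a₁ a₂ (by norm_num)).trans ?_⟩
  rw [add_mul, ← n]
  exact add_le_add (b₁.trans (by gcongr; exact eLpNorm_mono fun s => norm_fst_le _))
    (b₂.trans (by gcongr; exact eLpNorm_mono fun s => norm_snd_le _))

end Controls

/-! ### Density of smooth controls -/

section Density

variable {F : ℝ → ℝ × ℝ}

theorem exists_smooth_cutoff {δ : ℝ} (hδ : 0 < δ) : ∃ χ : ℝ → ℝ, ContDiff ℝ ∞ χ ∧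
    (∀ t ≤ δ, χ t = 0) ∧ (∀ t, 2 * δ ≤ t → χ t = 1) ∧ ∀ t, |χ t - 1| ≤ 1 := by
  refine ⟨fun t => Real.smoothTransition (t / δ - 1),
    Real.smoothTransition.contDiff.comp (by fun_prop),
    fun t ht => Real.smoothTransition.zero_of_nonpos (by rwa [sub_nonpos, div_le_one hδ]),
    fun t ht => Real.smoothTransition.one_of_one_le
      (by rw [le_sub_iff_add_le, le_div_iff₀ hδ]; linarith), fun t => ?_⟩
  have h1 := Real.smoothTransition.nonneg (t / δ - 1)
  have h2 := Real.smoothTransition.le_one (t / δ - 1)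
  rw [abs_le]
  constructor <;> linarith

/-- The error is supported in `[0, a²]`, where it is at most `K`; the length is written as a square
to spare a root in the bound. -/
theorem eLpNorm_cutoff_sub_le {g : ℝ → ℝ × ℝ} {χ : ℝ → ℝ} {K a : ℝ} (ha : 0 ≤ a) (hK0 : 0 ≤ K)
    (hK : ∀ t, ‖g t‖ ≤ K) (hχ1 : ∀ t, a ^ 2 ≤ t → χ t = 1) (hχb : ∀ t, |χ t - 1| ≤ 1) :
    eLpNorm (fun t => χ t • g t - g t) 2 (volume.restrict (Ioo 0 (2 * π))) ≤
      ENNReal.ofReal (K * a) := by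
  have hb : ∀ t ∈ Ioo 0 (2 * π), ‖χ t • g t - g t‖ ≤ ‖(Icc 0 (a ^ 2)).indicator
      (fun _ => K) t‖ := fun t ht => by
    by_cases h : t ∈ Icc 0 (a ^ 2)
    · have e : χ t • g t - g t = (χ t - 1) • g t := by rw [sub_smul, one_smul]
      rw [indicator_of_mem h, e, norm_smul, Real.norm_of_nonneg hK0]
      exact (mul_le_mul (hχb t) (hK t) (norm_nonneg _) zero_le_one).trans_eq (one_mul K)
    · rw [hχ1 t (by
        by_contra! h'
        exact h ⟨ht.1.le, h'.le⟩), one_smul, sub_self, norm_zero]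
      exact norm_nonneg _
  refine (eLpNorm_mono_ae (g := (Icc 0 (a ^ 2)).indicator fun _ => K) ?_).trans
    ((eLpNorm_restrict_le _ _ _ _).trans (le_of_eq ?_))
  · filter_upwards [ae_restrict_mem measurableSet_Ioo] with t ht using hb t ht
  · rw [eLpNorm_indicator_const measurableSet_Icc (by norm_num) (by norm_num),
      Real.volume_Icc, sub_zero, ENNReal.ofReal_rpow_of_nonneg (sq_nonneg a) (by norm_num),
      Real.enorm_of_nonneg hK0, ← ENNReal.ofReal_mul hK0, ENNReal.toReal_ofNat,
      ← Real.sqrt_eq_rpow, Real.sqrt_sq ha]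

/-- A smooth compactly supported approximation may fail to vanish near `t ≤ 0`. A cutoff near `0`
repairs its support at small cost, since the approximation is bounded. -/
theorem IsL2Control.exists_smoothControl_sub_le (hF : IsL2Control (2 * π) F) {ε : ℝ} (hε : 0 < ε) :
    ∃ G, IsSmoothControl G ∧
      eLpNorm (fun t => G t - F t) 2 (volume.restrict (Ioo 0 (2 * π))) ≤ ENNReal.ofReal ε := by
  have hFm : MemLp ((Ioo 0 (2 * π)).indicator F) 2 :=
    (memLp_indicator_iff_restrict measurableSet_Ioo).2 hF.1
  obtain ⟨g, hg, hgs, hgε⟩ := hFm.exist_eLpNorm_sub_le (by norm_num) (by norm_num) (half_pos hε)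
  obtain ⟨K, hK⟩ := hg.exists_bound_of_continuous hgs.continuous
  have hK0 : 0 ≤ K := (norm_nonneg _).trans (hK 0)
  obtain ⟨a, ha0, haK⟩ : ∃ a : ℝ, 0 < a ∧ K * a ≤ ε / 2 :=
    -- Dividing by `K + 1` avoids the case `K = 0`.
    ⟨ε / 2 / (K + 1), by positivity, by
      rw [mul_div_assoc', div_le_iff₀ (by positivity)]
      linarith⟩
  obtain ⟨χ, hχs, hχ0, hχ1, hχb⟩ := exists_smooth_cutoff (δ := a ^ 2 / 2) (by positivity)
  have hGs : ContDiff ℝ ∞ fun t => χ t • g t := hχs.smul hgs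
  have hGc : HasCompactSupport fun t => χ t • g t := hg.mono fun t ht h => ht (by
    simp only [h, smul_zero])
  refine ⟨fun t => χ t • g t, ⟨hGs, hGc, ?_⟩, ?_⟩
  · refine (closure_minimal (t := Ici (a ^ 2 / 2)) (fun t ht => ?_) isClosed_Ici).trans
      (Ici_subset_Ioi.2 (by positivity))
    by_contra h
    exact ht (by simp only [hχ0 t (not_le.1 h).le, zero_smul])
  · have e : (fun t => χ t • g t - F t) = (fun t => χ t • g t - g t) + fun t => g t - F t :=
      funext fun t => (sub_add_sub_cancel (χ t • g t) (g t) (F t)).symm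
    have m1 : AEStronglyMeasurable (fun t => χ t • g t - g t)
        (volume.restrict (Ioo 0 (2 * π))) :=
      (hGs.continuous.sub hgs.continuous).aestronglyMeasurable
    have m2 : AEStronglyMeasurable (fun t => g t - F t) (volume.restrict (Ioo 0 (2 * π))) :=
      hgs.continuous.aestronglyMeasurable.sub hF.1.aestronglyMeasurable
    have n1 := eLpNorm_cutoff_sub_le ha0.le hK0 hK (fun t ht => hχ1 t (by linarith)) hχb
    have n2 : eLpNorm (fun t => g t - F t) 2 (volume.restrict (Ioo 0 (2 * π))) ≤
        ENNReal.ofReal (ε / 2) := by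
      refine le_trans (le_trans (le_of_eq ?_) (eLpNorm_restrict_le _ _ _ (Ioo 0 (2 * π)))) hgε
      rw [eLpNorm_sub_comm]
      refine eLpNorm_congr_ae ?_
      filter_upwards [ae_restrict_mem measurableSet_Ioo] with t ht
      rw [Pi.sub_apply, indicator_of_mem ht]
    rw [e]
    refine (eLpNorm_add_le m1 m2 (by norm_num)).trans
      ((add_le_add (n1.trans (ENNReal.ofReal_le_ofReal haK)) n2).trans_eq ?_)
    rw [← ENNReal.ofReal_add (by positivity) (by positivity), add_halves]

theorem IsL2Control.exists_tendsto_smoothControl (hF : IsL2Control (2 * π) F) :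
    ∃ G : ℕ → ℝ → ℝ × ℝ, (∀ n, IsSmoothControl (G n)) ∧
      Tendsto (fun n => eLpNorm (fun t => G n t - F t) 2 (volume.restrict (Ioo 0 (2 * π))))
        atTop (𝓝 0) := by
  choose G hG hle using fun n : ℕ =>
    hF.exists_smoothControl_sub_le (Nat.one_div_pos_of_nat (α := ℝ) (n := n))
  refine ⟨G, hG, tendsto_of_tendsto_of_tendsto_of_le_of_le tendsto_const_nhds ?_
    (fun _ => zero_le) hle⟩
  simpa using ENNReal.tendsto_ofReal (tendsto_one_div_add_atTop_nhds_zero_nat (𝕜 := ℝ))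

end Density

/-! ### Generalized solutions -/

section Generalized

variable {q : ℝ → ℝ} {W₁ W₂ : ℝ → ℝ → ℝ} {F : ℝ → ℝ × ℝ} {u v : ℝ → ℝ → ℝ}

theorem memLp_controlWave (h₁ : Continuous (Function.uncurry W₁))
    (h₂ : Continuous (Function.uncurry W₂)) (hF : IsL2Control (2 * π) F) {t : ℝ}
    (ht : t < 2 * π) : MemLp (fun x => controlWave W₁ W₂ F (x, t)) 2 := by
  obtain ⟨C, hC, h⟩ := exists_eLpNorm_controlWave_le h₁ h₂
  obtain ⟨hm, hn⟩ := h F hF t ht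
  exact ⟨hm, hn.trans_lt (ENNReal.mul_lt_top hC.lt_top hF.1.2)⟩

theorem tendsto_iSup_controlWave (h₁ : Continuous (Function.uncurry W₁))
    (h₂ : Continuous (Function.uncurry W₂)) (hF : IsL2Control (2 * π) F) {G : ℕ → ℝ → ℝ × ℝ}
    (hG : ∀ n, IsSmoothControl (G n))
    (hlim : Tendsto (fun n => eLpNorm (fun t => G n t - F t) 2 (volume.restrict (Ioo 0 (2 * π))))
      atTop (𝓝 0)) :
    Tendsto (fun n => ⨆ t ∈ Ioo 0 (2 * π), eLpNorm (fun x =>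
      controlWave W₁ W₂ (G n) (x, t) - controlWave W₁ W₂ F (x, t)) 2 volume) atTop (𝓝 0) := by
  obtain ⟨C, hC, h⟩ := exists_eLpNorm_controlWave_le h₁ h₂
  have hlim' := ENNReal.Tendsto.const_mul hlim (Or.inr hC)
  rw [mul_zero] at hlim'
  refine tendsto_of_tendsto_of_tendsto_of_le_of_le tendsto_const_nhds hlim' (fun _ => zero_le)
    fun n => iSup₂_le fun t ht => ?_
  have := (h _ ((hG n).isL2Control.sub hF) t ht.2).2
  simpa only [controlWave_sub h₁ h₂ (hG n).isL2Control hF ht.2] using this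

theorem eLpNorm_wrap_sub_le {f g : ℝ × ℝ → ℝ} {t : ℝ} (hf : MemLp (fun x => f (x, t)) 2)
    (hg : MemLp (fun x => g (x, t)) 2) :
    eLpNorm (fun x => wrap f x t - wrap g x t) 2 (volume.restrict (Ioo 0 (2 * π))) ≤
      2 * eLpNorm (fun x => f (x, t) - g (x, t)) 2 volume := by
  have hm := (hf.sub hg).aestronglyMeasurable
  have mp := measurePreserving_sub_right (volume : Measure ℝ) (2 * π)
  have e : (fun x => wrap f x t - wrap g x t) = ((fun x => f (x, t)) - fun x => g (x, t)) +
      (((fun x => f (x, t)) - fun x => g (x, t)) ∘ fun x => x - 2 * π) := by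
    ext x
    simp only [wrap, Pi.add_apply, Pi.sub_apply, Function.comp_apply]
    ring
  refine (eLpNorm_restrict_le _ _ _ _).trans ?_
  rw [e]
  refine (eLpNorm_add_le hm (hm.comp_measurePreserving mp) (by norm_num)).trans ?_
  rw [eLpNorm_comp_measurePreserving hm mp, ← two_mul]
  rfl

theorem tendsto_iSup_wrap_controlWave (h₁ : Continuous (Function.uncurry W₁))
    (h₂ : Continuous (Function.uncurry W₂)) (hF : IsL2Control (2 * π) F) {G : ℕ → ℝ → ℝ × ℝ}
    (hG : ∀ n, IsSmoothControl (G n))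
    (hlim : Tendsto (fun n => eLpNorm (fun t => G n t - F t) 2 (volume.restrict (Ioo 0 (2 * π))))
      atTop (𝓝 0)) :
    Tendsto (fun n => ⨆ t ∈ Ioo 0 (2 * π), eLpNorm (fun x =>
      wrap (controlWave W₁ W₂ (G n)) x t - wrap (controlWave W₁ W₂ F) x t) 2
        (volume.restrict (Ioo 0 (2 * π)))) atTop (𝓝 0) := by
  have hlim' := ENNReal.Tendsto.const_mul (a := 2) (tendsto_iSup_controlWave h₁ h₂ hF hG hlim)
    (Or.inr (by norm_num))
  rw [mul_zero] at hlim'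
  refine tendsto_of_tendsto_of_tendsto_of_le_of_le tendsto_const_nhds hlim' (fun _ => zero_le)
    fun n => iSup₂_le fun t ht => ?_
  refine (eLpNorm_wrap_sub_le (memLp_controlWave h₁ h₂ (hG n).isL2Control ht.2)
    (memLp_controlWave h₁ h₂ hF ht.2)).trans ?_
  gcongr
  exact le_iSup₂ (f := fun t (_ : t ∈ Ioo 0 (2 * π)) => eLpNorm (fun x =>
    controlWave W₁ W₂ (G n) (x, t) - controlWave W₁ W₂ F (x, t)) 2 volume) t ht

theorem isGeneralizedPeriodicSolution_wrap (hq : IsPotential q)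
    (h₁ : IsWaveKernel (linePotential q) (1 / 2) (-(1 / 2)) W₁)
    (h₂ : IsWaveKernel (linePotential q) (-(1 / 2)) (-(1 / 2)) W₂) (hF : IsL2Control (2 * π) F) :
    IsGeneralizedPeriodicSolution q (2 * π) F (wrap (controlWave W₁ W₂ F)) := by
  obtain ⟨G, hG, hlim⟩ := hF.exists_tendsto_smoothControl
  exact ⟨fun t ht => (memLp_wrap (memLp_controlWave h₁.cont h₂.cont hF ht.2)).restrict _, G,
    fun n => wrap (controlWave W₁ W₂ (G n)), hG,
    fun n => isPeriodicSolution_wrap_controlWave hq h₁ h₂ (hG n), hlim,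
    tendsto_iSup_wrap_controlWave h₁.cont h₂.cont hF hG hlim⟩

theorem isGeneralizedLineSolution_controlWave (hq : IsPotential q)
    (h₁ : IsWaveKernel (linePotential q) (1 / 2) (-(1 / 2)) W₁)
    (h₂ : IsWaveKernel (linePotential q) (-(1 / 2)) (-(1 / 2)) W₂) (hF : IsL2Control (2 * π) F) :
    IsGeneralizedLineSolution (linePotential q) (2 * π) F
      fun x t => controlWave W₁ W₂ F (x, t) := by
  obtain ⟨G, hG, hlim⟩ := hF.exists_tendsto_smoothControl
  exact ⟨fun t ht => memLp_controlWave h₁.cont h₂.cont hF ht.2, G,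
    fun n x t => controlWave W₁ W₂ (G n) (x, t), hG,
    fun n => isLineSolution_controlWave hq h₁ h₂ (hG n), hlim,
    tendsto_iSup_controlWave h₁.cont h₂.cont hF hG hlim⟩

/-- A limit in `L²` is unique up to null sets; uniform convergence in `t` gives this at each single
`t`. -/
theorem ae_eq_of_tendsto {μ : Measure ℝ} {f g : ℝ → ℝ → ℝ} {U : ℕ → ℝ → ℝ → ℝ} {S : Set ℝ} {t : ℝ}
    (ht : t ∈ S) (hf : AEStronglyMeasurable (fun x => f x t) μ)
    (hg : AEStronglyMeasurable (fun x => g x t) μ)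
    (hU : ∀ n, AEStronglyMeasurable (fun x => U n x t) μ)
    (h : Tendsto (fun n => ⨆ t ∈ S, eLpNorm (fun x => U n x t - f x t) 2 μ) atTop (𝓝 0))
    (h' : Tendsto (fun n => ⨆ t ∈ S, eLpNorm (fun x => U n x t - g x t) 2 μ) atTop (𝓝 0)) :
    ∀ᵐ x ∂μ, f x t = g x t := by
  have hle : ∀ {k : ℝ → ℝ → ℝ} n, eLpNorm (fun x => U n x t - k x t) 2 μ ≤
      ⨆ t ∈ S, eLpNorm (fun x => U n x t - k x t) 2 μ := fun {k} n =>
    le_iSup₂ (f := fun t (_ : t ∈ S) => eLpNorm (fun x => U n x t - k x t) 2 μ) t ht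
  have key : eLpNorm (fun x => f x t - g x t) 2 μ = 0 := by
    refine le_antisymm (ge_of_tendsto' (by simpa using h.add h') fun n => ?_) zero_le
    have e : (fun x => f x t - g x t) =
        (fun x => U n x t - g x t) - fun x => U n x t - f x t := by
      ext x
      simp
    rw [e, add_comm]
    exact (eLpNorm_sub_le ((hU n).sub hg) ((hU n).sub hf) (by norm_num)).trans
      (add_le_add (hle n) (hle n))
  filter_upwards [(eLpNorm_eq_zero_iff (hf.sub hg) (by norm_num)).1 key] with x hx
  exact sub_eq_zero.1 hx

/-- The approximating solutions are given by the explicit formula, by uniqueness. For the same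
controls the formula also converges to its value at `F`, so the choice of approximating sequence
does not matter. -/
theorem IsGeneralizedLineSolution.ae_eq (hq : IsPotential q)
    (h₁ : IsWaveKernel (linePotential q) (1 / 2) (-(1 / 2)) W₁)
    (h₂ : IsWaveKernel (linePotential q) (-(1 / 2)) (-(1 / 2)) W₂) (hF : IsL2Control (2 * π) F)
    (hv : IsGeneralizedLineSolution (linePotential q) (2 * π) F v) {t : ℝ}
    (ht : t ∈ Ioo 0 (2 * π)) : ∀ᵐ x, v x t = controlWave W₁ W₂ F (x, t) := by
  obtain ⟨hm, G, V, hG, hV, hlim, hlimV⟩ := hv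
  have hae : ∀ n, ∀ t ∈ Ioo 0 (2 * π),
      (fun x => V n x t) =ᵐ[volume] fun x => controlWave W₁ W₂ (G n) (x, t) := by
    intro n t ht
    have h0 : ∀ᵐ x : ℝ, x ≠ 0 := (countable_singleton (0 : ℝ)).ae_notMem volume
    filter_upwards [h0] with x hx
    exact (hV n).unique hq.isLinePotential.integrable
      (isLineSolution_controlWave hq h₁ h₂ (hG n)) hx ht
  have hm' := fun n => (memLp_controlWave h₁.cont h₂.cont (hG n).isL2Control
    ht.2).aestronglyMeasurable.congr (hae n t ht).symm
  refine ae_eq_of_tendsto (f := v) (g := fun x t => controlWave W₁ W₂ F (x, t)) ht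
    (hm t ht).aestronglyMeasurable
    (memLp_controlWave h₁.cont h₂.cont hF ht.2).aestronglyMeasurable hm' hlimV ?_
  refine (tendsto_iSup_controlWave h₁.cont h₂.cont hF hG hlim).congr fun n =>
    iSup_congr fun t => iSup_congr fun ht => eLpNorm_congr_ae ?_
  filter_upwards [hae n t ht] with x hx
  simp only [hx]

theorem IsGeneralizedPeriodicSolution.ae_eq (hq : IsPotential q)
    (h₁ : IsWaveKernel (linePotential q) (1 / 2) (-(1 / 2)) W₁)
    (h₂ : IsWaveKernel (linePotential q) (-(1 / 2)) (-(1 / 2)) W₂) (hF : IsL2Control (2 * π) F)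
    (hu : IsGeneralizedPeriodicSolution q (2 * π) F u) {t : ℝ} (ht : t ∈ Ioo 0 (2 * π)) :
    ∀ᵐ x ∂(volume.restrict (Ioo 0 (2 * π))), u x t = wrap (controlWave W₁ W₂ F) x t := by
  obtain ⟨hm, G, V, hG, hV, hlim, hlimV⟩ := hu
  have hae : ∀ n, ∀ t ∈ Ioo 0 (2 * π), (fun x => V n x t)
      =ᵐ[volume.restrict (Ioo 0 (2 * π))] fun x => wrap (controlWave W₁ W₂ (G n)) x t := by
    intro n t ht
    filter_upwards [ae_restrict_mem measurableSet_Ioo] with x hx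
    exact (hV n).unique hq (isPeriodicSolution_wrap_controlWave hq h₁ h₂ (hG n)) hx ht
  have hw : ∀ {H : ℝ → ℝ × ℝ}, IsL2Control (2 * π) H → AEStronglyMeasurable
      (fun x => wrap (controlWave W₁ W₂ H) x t) (volume.restrict (Ioo 0 (2 * π))) := fun hH =>
    ((memLp_wrap (memLp_controlWave h₁.cont h₂.cont hH ht.2)).restrict _).aestronglyMeasurable
  refine ae_eq_of_tendsto ht (hm t ht).aestronglyMeasurable (hw hF)
    (fun n => (hw (hG n).isL2Control).congr (hae n t ht).symm) hlimV ?_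
  refine (tendsto_iSup_wrap_controlWave h₁.cont h₂.cont hF hG hlim).congr fun n =>
    iSup_congr fun t => iSup_congr fun ht => eLpNorm_congr_ae ?_
  filter_upwards [hae n t ht] with x hx
  simp only [hx]

end Generalized

/-! ### Response operators and the inverse problem -/

section Main

variable {q : ℝ → ℝ} {W₁ W₂ : ℝ → ℝ → ℝ} {F : ℝ → ℝ × ℝ} {u v : ℝ → ℝ → ℝ}

/-- By uniqueness the given solutions are the constructed wave and its superposition, whose `Γ₁`
data were expressed by the same four traces. -/
theorem Gamma1_eq_lineGamma1 (hq : IsPotential q) (hF : IsSmoothControl F)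
    (hu : IsPeriodicSolution q (2 * π) F u)
    (hv : IsLineSolution (linePotential q) (2 * π) F v) {t : ℝ} (ht : t ∈ Ioo 0 (2 * π)) :
    Gamma1 (fun x => u x t) = lineGamma1 (fun x => v x t) := by
  have hp := hq.isLinePotential
  obtain ⟨W₁, h₁⟩ := exists_isWaveKernel hp.integrable (1 / 2) (-(1 / 2))
  obtain ⟨W₂, h₂⟩ := exists_isWaveKernel hp.integrable (-(1 / 2)) (-(1 / 2))
  obtain ⟨vx, vt, vxt, vtt, h⟩ := exists_isLineWave hq h₁ h₂ hF
  obtain ⟨r, l, r', l', -, -, hl, hc⟩ := h.exists_traces ht.2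
  rw [(hc (fun x => u x t) fun x hx =>
      hu.unique hq (isPeriodicSolution_wrap_controlWave hq h₁ h₂ hF) hx ht).2,
    hl (fun x => v x t) fun x hx =>
      hv.unique hp.integrable (isLineSolution_controlWave hq h₁ h₂ hF) hx ht]

theorem periodicResponse_eq_lineResponse (hq : IsPotential q) :
    periodicResponse q (2 * π) = lineResponse (linePotential q) (2 * π) := by
  have hp := hq.isLinePotential
  obtain ⟨W₁, h₁⟩ := exists_isWaveKernel hp.integrable (1 / 2) (-(1 / 2))
  obtain ⟨W₂, h₂⟩ := exists_isWaveKernel hp.integrable (-(1 / 2)) (-(1 / 2))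
  ext1 F
  have hF : IsSmoothControl F.1 :=
    ⟨F.2.1, F.2.2.1, F.2.2.2.trans Ioo_subset_Ioi_self⟩
  ext1 t
  -- The response operators use arbitrarily chosen solutions; existence makes the choices genuine
  -- solutions.
  exact Gamma1_eq_lineGamma1 hq hF
    (Classical.epsilon_spec ⟨_, isPeriodicSolution_wrap_controlWave hq h₁ h₂ hF⟩)
    (Classical.epsilon_spec ⟨_, isLineSolution_controlWave hq h₁ h₂ hF⟩) t.2

/-- The interval `(-π, π)` covers each point of the period except `x = π`, which corresponds to its
excluded ends; there equality follows from continuity of the potentials. -/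
theorem eqOn_iff_eqOn_linePotential {q₁ q₂ : ℝ → ℝ} (h₁ : IsPotential q₁) (h₂ : IsPotential q₂) :
    EqOn q₁ q₂ (Ioo 0 (2 * π)) ↔ EqOn (linePotential q₁) (linePotential q₂) (Ioo (-π) π) := by
  have hπ := Real.pi_pos
  refine ⟨fun h x _ => ?_, fun h => ?_⟩
  · unfold linePotential
    split_ifs with h1 h2
    · exact h h1
    · exact h ⟨by linarith [h2.1], by linarith [h2.2]⟩
    · rfl
  · have key : ∀ x ∈ Ioo 0 (2 * π), x ≠ π → q₁ x = q₂ x := fun x hx hne => by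
      rcases lt_or_gt_of_ne hne with h' | h'
      · have := h (show x ∈ Ioo (-π) π from ⟨by linarith [hx.1], h'⟩)
        rwa [linePotential_of_pos hx.1 hx.2, linePotential_of_pos hx.1 hx.2] at this
      · have := h (show x - 2 * π ∈ Ioo (-π) π from ⟨by linarith, by linarith [hx.2]⟩)
        rwa [linePotential_sub_period hx, linePotential_sub_period hx] at this
    intro x hx
    rcases eq_or_ne x π with rfl | hne
    · have c₁ := (h₁.1.continuousOn.continuousAt (Ioo_mem_nhds hx.1 hx.2)).tendsto.mono_left
        (nhdsWithin_le_nhds (s := {π}ᶜ))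
      have c₂ := (h₂.1.continuousOn.continuousAt (Ioo_mem_nhds hx.1 hx.2)).tendsto.mono_left
        (nhdsWithin_le_nhds (s := {π}ᶜ))
      refine tendsto_nhds_unique (c₁.congr' ?_) c₂
      filter_upwards [self_mem_nhdsWithin, mem_nhdsWithin_of_mem_nhds (Ioo_mem_nhds hx.1 hx.2)]
        with y hy hy' using key y hy' hy
    · exact key x hx hne

theorem forall_eq_linePotential_iff (g : ℝ → ℝ) (q : ℝ → ℝ) :
    (∀ x ∈ Ioo (-π) π, x ≠ 0 → g x = linePotential q x) ↔
      ∀ x ∈ Ioo 0 (2 * π), x ≠ π → unfold g x = q x := by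
  have hπ := Real.pi_pos
  refine ⟨fun h x hx hne => ?_, fun h x hx hne => ?_⟩
  · unfold unfold
    split_ifs with h'
    · rw [h x ⟨by linarith [hx.1], h'⟩ hx.1.ne', linePotential_of_pos hx.1 hx.2]
    · have h'' := lt_of_le_of_ne (not_lt.1 h') hne.symm
      rw [h (x - 2 * π) ⟨by linarith, by linarith [hx.2]⟩ (sub_neg.2 hx.2).ne,
        linePotential_sub_period hx]
  · rcases lt_or_gt_of_ne hne with h' | h'
    · have := h (x + 2 * π) ⟨by linarith [hx.1], by linarith⟩ (by linarith [hx.1])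
      rwa [unfold, if_neg (by linarith [hx.1]), add_sub_cancel_right,
        ← linePotential_of_neg (q := q) h' (by linarith [hx.1])] at this
    · have := h x ⟨h', by linarith [hx.2]⟩ hx.2.ne
      rwa [unfold, if_pos hx.2, ← linePotential_of_pos (q := q) h' (by linarith [hx.2])] at this

end Main

end PeriodicWave

end
theorem mainTheorem3 :
    -- for every potential `q` on `(0, 2π)`
    (∀ q : ℝ → ℝ, PeriodicWave.IsPotential q →
      -- both problems are uniquely solvable for smooth controls
      (∀ F : ℝ → ℝ × ℝ, PeriodicWave.IsSmoothControl F →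
        (∃ u, PeriodicWave.IsPeriodicSolution q (2 * π) F u) ∧
        (∀ u u', PeriodicWave.IsPeriodicSolution q (2 * π) F u →
          PeriodicWave.IsPeriodicSolution q (2 * π) F u' →
          ∀ x ∈ Ioo 0 (2 * π), ∀ t ∈ Ioo 0 (2 * π), u x t = u' x t) ∧
        (∃ v, PeriodicWave.IsLineSolution (PeriodicWave.linePotential q) (2 * π) F v) ∧
        (∀ v v', PeriodicWave.IsLineSolution (PeriodicWave.linePotential q) (2 * π) F v →
          PeriodicWave.IsLineSolution (PeriodicWave.linePotential q) (2 * π) F v' →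
          ∀ x ≠ 0, ∀ t ∈ Ioo 0 (2 * π), v x t = v' x t)) ∧
      -- the solutions coincide, for smooth and for square integrable controls
      (∃ a₁ a₂ b₁ b₂ : ℝ → ℝ → ℝ,
        PeriodicWave.IsGoursatPair q (-1) a₁ b₁ ∧ PeriodicWave.IsGoursatPair q 1 a₂ b₂ ∧
        (∀ F : ℝ → ℝ × ℝ, PeriodicWave.IsSmoothControl F →
          ∀ u v, PeriodicWave.IsPeriodicSolution q (2 * π) F u →
          PeriodicWave.IsLineSolution (PeriodicWave.linePotential q) (2 * π) F v →
          ∀ t ∈ Ioo 0 (2 * π),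
            (∀ x ∈ Ioo 0 (2 * π), u x t =
              PeriodicWave.waveFromZero a₁ a₂ F x t + PeriodicWave.waveFromTwoPi b₁ b₂ F x t) ∧
            (∀ x ∈ Ioo 0 (2 * π), v x t = PeriodicWave.waveFromZero a₁ a₂ F x t) ∧
            (∀ x ∈ Ioo (-(2 * π)) 0,
              v x t = PeriodicWave.waveFromTwoPi b₁ b₂ F (x + 2 * π) t) ∧
            (∀ x ∈ Ioo 0 (2 * π), u x t = v x t + v (x - 2 * π) t)) ∧
        (∀ F : ℝ → ℝ × ℝ, PeriodicWave.IsL2Control (2 * π) F →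
          (∃ u, PeriodicWave.IsGeneralizedPeriodicSolution q (2 * π) F u) ∧
          (∃ v, PeriodicWave.IsGeneralizedLineSolution
            (PeriodicWave.linePotential q) (2 * π) F v) ∧
          ∀ u v, PeriodicWave.IsGeneralizedPeriodicSolution q (2 * π) F u →
          PeriodicWave.IsGeneralizedLineSolution (PeriodicWave.linePotential q) (2 * π) F v →
          ∀ t ∈ Ioo 0 (2 * π),
            (∀ᵐ x ∂(volume.restrict (Ioo 0 (2 * π))), u x t =
              PeriodicWave.waveFromZero a₁ a₂ F x t + PeriodicWave.waveFromTwoPi b₁ b₂ F x t) ∧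
            (∀ᵐ x ∂(volume.restrict (Ioo 0 (2 * π))),
              v x t = PeriodicWave.waveFromZero a₁ a₂ F x t) ∧
            (∀ᵐ x ∂(volume.restrict (Ioo (-(2 * π)) 0)),
              v x t = PeriodicWave.waveFromTwoPi b₁ b₂ F (x + 2 * π) t) ∧
            (∀ᵐ x ∂(volume.restrict (Ioo 0 (2 * π))), u x t = v x t + v (x - 2 * π) t))) ∧
      -- the boundary data coincide
      (∀ F : ℝ → ℝ × ℝ, PeriodicWave.IsSmoothControl F →
        ∀ u v, PeriodicWave.IsPeriodicSolution q (2 * π) F u →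
        PeriodicWave.IsLineSolution (PeriodicWave.linePotential q) (2 * π) F v →
        ∀ t ∈ Ioo 0 (2 * π),
          PeriodicWave.Gamma1 (fun x => u x t) = PeriodicWave.lineGamma1 (fun x => v x t)) ∧
      -- the response operators coincide
      PeriodicWave.periodicResponse q (2 * π) =
        PeriodicWave.lineResponse (PeriodicWave.linePotential q) (2 * π)) ∧
    -- `q` on `(0, 2π)` and its line potential on `(-π, π)` carry the same information
    (∀ q₁ q₂ : ℝ → ℝ, PeriodicWave.IsPotential q₁ → PeriodicWave.IsPotential q₂ →
      (EqOn q₁ q₂ (Ioo 0 (2 * π)) ↔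
        EqOn (PeriodicWave.linePotential q₁) (PeriodicWave.linePotential q₂) (Ioo (-π) π))) ∧
    -- a procedure `S` recovers the line potential on `(-π, π)` from the response operator on the
    -- line exactly if its rearrangement recovers `q` from the periodic response operator
    (∀ S : (PeriodicWave.ResponseDomain (2 * π) → Ioo 0 (2 * π) → ℝ × ℝ) → ℝ → ℝ,
      (∀ q : ℝ → ℝ, PeriodicWave.IsPotential q → ∀ x ∈ Ioo (-π) π, x ≠ 0 →
        S (PeriodicWave.lineResponse (PeriodicWave.linePotential q) (2 * π)) x =
          PeriodicWave.linePotential q x) ↔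
      (∀ q : ℝ → ℝ, PeriodicWave.IsPotential q → ∀ x ∈ Ioo 0 (2 * π), x ≠ π →
        PeriodicWave.unfold (S (PeriodicWave.periodicResponse q (2 * π))) x = q x)) := by
  refine ⟨fun q hq => ?_, fun q₁ q₂ h₁ h₂ => PeriodicWave.eqOn_iff_eqOn_linePotential h₁ h₂,
    fun S => forall₂_congr fun q hq => ?_⟩
  · have hp := hq.isLinePotential
    obtain ⟨W₁, h₁⟩ := PeriodicWave.exists_isWaveKernel hp.integrable (1 / 2) (-(1 / 2))
    obtain ⟨W₂, h₂⟩ := PeriodicWave.exists_isWaveKernel hp.integrable (-(1 / 2)) (-(1 / 2))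
    have hU := fun F hF => PeriodicWave.isPeriodicSolution_wrap_controlWave (F := F) hq h₁ h₂ hF
    have hV := fun F hF => PeriodicWave.isLineSolution_controlWave (F := F) hq h₁ h₂ hF
    refine ⟨fun F hF => ⟨⟨_, hU F hF⟩, fun u u' hu hu' x hx t ht => hu.unique hq hu' hx ht,
      ⟨_, hV F hF⟩, fun v v' hv hv' x hx t ht => hv.unique hp.integrable hv' hx ht⟩,
      ⟨W₁, W₂, fun x => W₁ (x - 2 * π), fun x => W₂ (x - 2 * π),
        -- The sign `σ = -1` gives the coefficient `-σ / 2 = 1 / 2` of the kernel for `f₁`, and `σ =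
        -- 1` gives `-1 / 2` for `f₂`.
        PeriodicWave.IsWaveKernel.isGoursatPair hq (by convert h₁ using 1; norm_num),
        PeriodicWave.IsWaveKernel.isGoursatPair hq (by convert h₂ using 1; norm_num),
        fun F hF u v hu hv t ht => ?_, fun F hF => ⟨⟨_,
          PeriodicWave.isGeneralizedPeriodicSolution_wrap hq h₁ h₂ hF⟩, ⟨_,
          PeriodicWave.isGeneralizedLineSolution_controlWave hq h₁ h₂ hF⟩,
          fun u v hu hv t ht => ?_⟩⟩,
      fun F hF u v hu hv t ht => PeriodicWave.Gamma1_eq_lineGamma1 hq hF hu hv ht,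
      PeriodicWave.periodicResponse_eq_lineResponse hq⟩
    · have eu : ∀ x ∈ Ioo 0 (2 * π), u x t =
          PeriodicWave.wrap (PeriodicWave.controlWave W₁ W₂ F) x t := fun x hx =>
        hu.unique hq (hU F hF) hx ht
      have ev : ∀ x ≠ 0, v x t = PeriodicWave.controlWave W₁ W₂ F (x, t) := fun x hx =>
        hv.unique hp.integrable (hV F hF) hx ht
      refine ⟨fun x hx => (eu x hx).trans (PeriodicWave.wrap_controlWave hx),
        fun x hx => (ev x hx.1.ne').trans (PeriodicWave.controlWave_of_pos hx.1),
        fun x hx => (ev x hx.2.ne).trans (PeriodicWave.controlWave_of_neg hx.2), fun x hx => ?_⟩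
      rw [eu x hx, ev x hx.1.ne', ev _ (sub_neg.2 hx.2).ne, PeriodicWave.wrap]
    · have eu := hu.ae_eq hq h₁ h₂ hF ht
      have ev := hv.ae_eq hq h₁ h₂ hF ht
      have ev' : ∀ᵐ x, v (x - 2 * π) t =
          PeriodicWave.controlWave W₁ W₂ F (x - 2 * π, t) :=
        (measurePreserving_sub_right volume (2 * π)).quasiMeasurePreserving.ae ev
      have hI := ae_restrict_mem (μ := (volume : Measure ℝ))
        (measurableSet_Ioo (a := 0) (b := 2 * π))
      refine ⟨?_, ?_, ?_, ?_⟩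
      · filter_upwards [eu, hI] with x h hx using h.trans (PeriodicWave.wrap_controlWave hx)
      · filter_upwards [ae_restrict_of_ae ev, hI] with x h hx using
          h.trans (PeriodicWave.controlWave_of_pos hx.1)
      · filter_upwards [ae_restrict_of_ae ev, ae_restrict_mem measurableSet_Ioo] with x h hx
          using h.trans (PeriodicWave.controlWave_of_neg hx.2)
      · filter_upwards [eu, ae_restrict_of_ae ev, ae_restrict_of_ae ev'] with x h h' h''
        rw [h, h', h'', PeriodicWave.wrap]
  -- Both sides now apply `S` to the same operator, so the equivalence is a pointwise rearrangement
  -- for each `q` separately.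
  · rw [PeriodicWave.periodicResponse_eq_lineResponse hq]
    exact PeriodicWave.forall_eq_linePotential_iff _ _
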